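/- A link is a finite disjoint union of smoothly embedded circles in $S^3$, and links are considered up to smooth isotopy. A diagram of an oriented link $L$ is a generic projection to $S^2$ (an immersion whose only multiple points are transverse double points), with over/under information at each double point, of a link isotopic to $L$; diagrams are considered up to isotopy of $S^2$. A diagram is alternating if over- and under-crossings appear alternately along every component, and positive if every crossing has sign $+$. For oriented diagrams $A$ and $B$ on $S^2$, a connected sum $A\sharp B$ is a diagram obtained by removing from each of the two spheres a disc that meets the diagram in a single crossingless arc (and in nothing else) and gluing the remaining discs along their boundary circles compatibly with all orientations; it depends on the chosen arcs. Let $m\ge 1$, let $L$ be an oriented link and let $D$ be a diagram of $L$ such that $D=D_1\sharp D_2\sharp\cdots\sharp D_m$ (for some bracketing and some choice of arcs), where $D_1,\dots,D_m$ are oriented diagrams each of which is alternating. If $D$ is positive, then $L$ has a diagram that is both positive and alternating. -/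

import Mathlib

open scoped ContDiff

/-- Three-dimensional Euclidean space, whose unit sphere is the projection sphere `S²`. -/
abbrev E3 : Type := EuclideanSpace ℝ (Fin 3)

/-- The three-sphere, as the unit sphere of `ℝ³ × ℝ`: pairs `(x, w)` with `|x|² + w² = 1`. -/
def S3 : Set (E3 × ℝ) := {q | ‖q.1‖ ^ 2 + q.2 ^ 2 = 1}

/-- The points with parameters `s` on circle `i` and `t` on circle `j` are the same point of the
disjoint union of circles `ι × (ℝ / ℤ)`. -/
def SamePoint {ι : Type} (i : ι) (s : ℝ) (j : ι) (t : ℝ) : Prop :=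
  i = j ∧ ∃ n : ℤ, t = s + n

/-- `c` is a smooth embedding of the disjoint union of the oriented circles `{i} × (ℝ / ℤ)`
into `S³`, each circle being parametrized by `ℝ` with period `1`. -/
structure IsLinkEmbedding {ι : Type} (c : ι → ℝ → E3 × ℝ) : Prop where
  mem_sphere : ∀ i t, c i t ∈ S3
  smooth : ∀ i, ContDiff ℝ ∞ (c i)
  periodic : ∀ i, Function.Periodic (c i) 1
  immersion : ∀ i t, deriv (c i) t ≠ 0
  injective : ∀ i s j t, c i s = c j t → SamePoint i s j t

/-- A (smooth) oriented link in `S³` with finitely many components, indexed by `ι`. -/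
structure OrientedLink where
  ι : Type
  finite : Finite ι
  curve : ι → ℝ → E3 × ℝ
  isLink : IsLinkEmbedding curve

namespace OrientedLink

/-- Two oriented links represent the same link type: after matching the components, there is a
smooth isotopy through oriented links from one to the other. (This also identifies two
parametrizations of the same oriented link.) -/
def Isotopic (K L : OrientedLink) : Prop :=
  ∃ (e : K.ι ≃ L.ι) (H : K.ι → ℝ → ℝ → E3 × ℝ),
    (∀ i, ContDiff ℝ ∞ (fun q : ℝ × ℝ => H i q.1 q.2)) ∧
    (∀ s ∈ Set.Icc (0 : ℝ) 1, IsLinkEmbedding (fun i => H i s)) ∧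
    (∀ i t, H i 0 t = K.curve i t) ∧
    (∀ i t, H i 1 t = L.curve (e i) t)

variable (K : OrientedLink)

/-- The projection of the link to `S²`, along the meridians `(x, w) ↦ x / |x|` that join the two
poles `(0, ± 1)` of `S³`. It is meaningful when the link avoids the poles. -/
noncomputable def shadow (i : K.ι) (t : ℝ) : E3 := ‖(K.curve i t).1‖⁻¹ • (K.curve i t).1

/-- The height along the direction of projection. Among two points with the same projection, the
one with the larger height is the upper one (`S²` is looked at from outside). -/
def height (i : K.ι) (t : ℝ) : ℝ := (K.curve i t).2

/-- Two distinct points of the link have the same projection. -/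
def IsCrossing (i : K.ι) (s : ℝ) (j : K.ι) (t : ℝ) : Prop :=
  K.shadow i s = K.shadow j t ∧ ¬ SamePoint i s j t

/-- The projection of the link to `S²` is generic: it is defined, it is an immersion, and its
only multiple points are transverse double points. (By compactness there are then only finitely
many double points.) -/
structure IsRegular : Prop where
  avoids_poles : ∀ i t, (K.curve i t).1 ≠ 0
  immersion : ∀ i t, deriv (K.shadow i) t ≠ 0
  transverse : ∀ i s j t, K.IsCrossing i s j t →
    LinearIndependent ℝ ![deriv (K.shadow i) s, deriv (K.shadow j) t]
  no_triple : ∀ i s j t k r, K.IsCrossing i s j t → K.IsCrossing i s k r → SamePoint j t k r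

end OrientedLink

/-- An oriented link diagram on `S²`, given by a link with generic projection. The notions below
only use the projected curves and the information which strand is the upper one at each double
point. -/
structure LinkDiagram extends OrientedLink where
  regular : toOrientedLink.IsRegular

namespace LinkDiagram

variable (D : LinkDiagram)

/-- `D` is a diagram of the oriented link `L`. -/
def IsDiagramOf (L : OrientedLink) : Prop := D.toOrientedLink.Isotopic L

/-- The component `i` passes a crossing at parameter `s`. -/
def MeetsCrossing (i : D.ι) (s : ℝ) : Prop := ∃ j t, D.IsCrossing i s j t

/-- The component `i` passes a crossing at parameter `s`, as the upper strand. -/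
def PassesOver (i : D.ι) (s : ℝ) : Prop :=
  ∃ j t, D.IsCrossing i s j t ∧ D.height j t < D.height i s

/-- Along every component, over- and under-crossings appear alternately: of any two consecutive
passages of crossings, exactly one is an over-crossing. -/
def IsAlternating : Prop :=
  ∀ i s t, s < t → D.MeetsCrossing i s → D.MeetsCrossing i t →
    (∀ r ∈ Set.Ioo s t, ¬ D.MeetsCrossing i r) → (D.PassesOver i s ↔ ¬ D.PassesOver i t)

/-- Every crossing is positive: at every crossing, the direction of the upper strand followed by
the direction of the lower strand is a positive basis of the tangent plane of `S²`, which is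
oriented by the outer normal. -/
def IsPositive : Prop :=
  ∀ i s j t, D.IsCrossing i s j t → D.height j t < D.height i s →
    0 < Matrix.det (Matrix.of ![(D.shadow i s).ofLp, (deriv (D.shadow i) s).ofLp,
      (deriv (D.shadow j) t).ofLp])

end LinkDiagram

/-- `Φ s`, for `0 ≤ s ≤ 1`, is a smooth ambient isotopy of `S²` that starts at the identity. (A
smooth family of maps of `S²` is given through a smooth extension to `ℝ³ ∖ {0}`; a bijective
immersion of `S²` onto itself is a diffeomorphism.) -/
structure IsSphereIsotopy (Φ : ℝ → E3 → E3) : Prop where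
  smooth : ContDiffOn ℝ ∞ (fun q : ℝ × E3 => Φ q.1 q.2) {q | q.2 ≠ 0}
  bijOn : ∀ s ∈ Set.Icc (0 : ℝ) 1,
    Set.BijOn (Φ s) (Metric.sphere (0 : E3) 1) (Metric.sphere (0 : E3) 1)
  immersion : ∀ s ∈ Set.Icc (0 : ℝ) 1, ∀ p ∈ Metric.sphere (0 : E3) 1, ∀ u : E3,
    inner ℝ p u = 0 → u ≠ 0 → fderiv ℝ (Φ s) p u ≠ 0
  start : ∀ p ∈ Metric.sphere (0 : E3) 1, Φ 0 p = p

/-- An orientation preserving reparametrization of the circle `ℝ / ℤ`, lifted to `ℝ`. -/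
structure IsCircleReparam (φ : ℝ → ℝ) : Prop where
  smooth : ContDiff ℝ ∞ φ
  deriv_pos : ∀ t, 0 < deriv φ t
  equivariant : ∀ t, φ (t + 1) = φ t + 1

namespace LinkDiagram

/-- `D` and `D'` are the same oriented diagram up to isotopy of `S²`: an ambient isotopy of `S²`
carries the projected oriented curves of `D` to those of `D'`, and the upper strands of `D` to the
upper strands of `D'`. -/
def SameDiagram (D D' : LinkDiagram) : Prop :=
  ∃ (Φ : ℝ → E3 → E3) (e : D.ι ≃ D'.ι) (φ : D.ι → ℝ → ℝ),
    IsSphereIsotopy Φ ∧ (∀ i, IsCircleReparam (φ i)) ∧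
    (∀ i t, D'.shadow (e i) (φ i t) = Φ 1 (D.shadow i t)) ∧
    (∀ i s j t, D.IsCrossing i s j t →
      (D.height i s < D.height j t ↔ D'.height (e i) (φ i s) < D'.height (e j) (φ j t)))

end LinkDiagram

/-- The great circle of `S²` through `(-1, 0, 0)` (`t = 0`), the north pole (`t = 1/4`),
`(1, 0, 0)` (`t = 1/2`) and the south pole (`t = 3/4`), placed at height `0` in `S³`. -/
noncomputable def greatCircle (t : ℝ) : E3 × ℝ :=
  (!₂[-Real.cos (2 * Real.pi * t), 0, Real.sin (2 * Real.pi * t)], 0)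

namespace LinkDiagram

/-- `D` is glued from `A` and `B`, which are in standard position. In the cap `z ≥ -1/2` of `S²`
the diagram `A` is one arc of the great circle, and in the cap `z ≤ 1/2` the diagram `B` is the
opposite arc (up to contacts of the remaining part with the boundary circle of the cap). The
diagram `D` consists of the part of `A` in the southern hemisphere and the part of `B` in the
northern hemisphere: the component `a` of `A` and the component `b` of `B` are joined to the
component `c` of `D`, and the other components are kept. -/
def IsGluedSum (A B D : LinkDiagram) : Prop :=
  ∃ (a : A.ι) (b : B.ι) (c : D.ι) (f : {i // i ≠ a} ⊕ {j // j ≠ b} ≃ {k // k ≠ c}),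
    (∀ t ∈ Set.Icc (-1 / 12 : ℝ) (7 / 12), A.curve a t = greatCircle t) ∧
    (∀ t ∈ Set.Icc (7 / 12 : ℝ) (11 / 12), A.shadow a t 2 ≤ -1 / 2) ∧
    (∀ i, i ≠ a → ∀ t, A.shadow i t 2 ≤ -1 / 2) ∧
    (∀ t ∈ Set.Icc (5 / 12 : ℝ) (13 / 12), B.curve b t = greatCircle t) ∧
    (∀ t ∈ Set.Icc (1 / 12 : ℝ) (5 / 12), 1 / 2 ≤ B.shadow b t 2) ∧
    (∀ j, j ≠ b → ∀ t, 1 / 2 ≤ B.shadow j t 2) ∧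
    (∀ t ∈ Set.Icc (0 : ℝ) (1 / 2), D.curve c t = B.curve b t) ∧
    (∀ t ∈ Set.Icc (1 / 2 : ℝ) 1, D.curve c t = A.curve a t) ∧
    (∀ i t, D.curve (f (Sum.inl i)) t = A.curve i t) ∧
    (∀ j t, D.curve (f (Sum.inr j)) t = B.curve j t)

/-- `D` is a connected sum `A ♯ B` of the oriented diagrams `A` and `B`, along some arc of `A` and
some arc of `B`. Diagrams are taken up to isotopy of `S²`. -/
def IsConnectedSum (A B D : LinkDiagram) : Prop :=
  ∃ A' B' D' : LinkDiagram,
    A.SameDiagram A' ∧ B.SameDiagram B' ∧ D.SameDiagram D' ∧ IsGluedSum A' B' D'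

/-- `IsIteratedSum [D₁, …, Dₘ] D` says `D = D₁ ♯ ⋯ ♯ Dₘ` with `m ≥ 1`, for some bracketing and
some choice of the arcs along which the connected sums are formed. -/
inductive IsIteratedSum : List LinkDiagram → LinkDiagram → Prop
  | single (D : LinkDiagram) : IsIteratedSum [D] D
  | sum {l₁ l₂ : List LinkDiagram} {A B D : LinkDiagram} :
      IsIteratedSum l₁ A → IsIteratedSum l₂ B → IsConnectedSum A B D →
      IsIteratedSum (l₁ ++ l₂) D

end LinkDiagram

/-!
The main tool is a flip. Suppose that a plane orthogonal to the plane `y = 0` cuts `S²` in such a way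
that, near the cut, a diagram lies on the great circle `y = 0`. Then the part of the link on one side
of the cut can be rotated by `π` about the great circle `y = w = 0` of `S³`
(`LinkDiagram.isotopic_flip`). In the diagram, this part is reflected in `y = 0` and all its crossings
are switched. Each of the two operations changes the signs of crossings, so a positive diagram stays
positive (`LinkDiagram.IsFlip.isPositive`), while in the flipped part over- and under-crossings are
exchanged.

Let `D` be glued from alternating diagrams `A` and `B`. Going along the joined component, one changes
from `A` to `B` and from `B` to `A`. Since `A` and `B` alternate, either both changes fit into the
alternating pattern or both violate it (`IsChange.iff`). In the first case `D` is alternating; in the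
second case `D` becomes alternating when the part that comes from `A` is flipped
(`LinkDiagram.IsGluing.isAlternating_or`). In both cases, `D` is related to an alternating diagram
by changes that keep the link and positivity; `LinkDiagram.FlipsToAlternating` is the class of such
diagrams, the changes being diffeomorphisms of `S²`, flips, and rotations of the whole diagram.

It remains to see that this class is closed under connected sums
(`LinkDiagram.FlipsToAlternating.sum`). For this, the changes of a summand are made in the sum. The
only obstacle is that the other summand is inserted somewhere in the first one, possibly across the
cut of a flip. But the cap of the first summand that is replaced contains only a trivial arc, so it
can be squeezed into a small disc (`exists_squeeze`), after the cut was tilted away from the centre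
of this disc (`LinkDiagram.IsFlip.exists_lin_ne_zero`). If the disc is on the side of the cut that is
not moved, then the flip of the summand is a flip of the sum (`LinkDiagram.IsGluing.of_isFlip`).
Otherwise one flips the part on the other side instead, which differs from the given flip by a
rotation of the whole diagram (`LinkDiagram.IsFlip.neg_rot`).

A link that avoids the poles is treated as a pair of a projected curve on `S²` and a real function,
the ratio `w / |x|`. All changes of diagrams are described by the projected curves and the order of
the strands at crossings, and two links for which these agree are isotopic
(`LinkDiagram.PreservesIsotopy.id`). Diffeomorphisms of `S²` come from ambient isotopies and are
extended to `ℝ³` by homogeneity (`IsSphereIsotopy.exists_isSphereDiffeo`).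
-/

/-! ### Points of a disjoint union of circles -/

namespace SamePoint

variable {ι : Type} {i j k : ι} {s t r : ℝ}

theorem symm (h : SamePoint i s j t) : SamePoint j t i s := by
  obtain ⟨h, n, hn⟩ := h
  exact ⟨h.symm, -n, by push_cast; linarith⟩

theorem trans (h : SamePoint i s j t) (h' : SamePoint j t k r) : SamePoint i s k r := by
  obtain ⟨h, n, hn⟩ := h
  obtain ⟨h', m, hm⟩ := h'
  exact ⟨h.trans h', n + m, by push_cast; linarith⟩

theorem eq_of_periodic {X : Type*} {f : ι → ℝ → X} (hf : ∀ i, Function.Periodic (f i) 1)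
    (h : SamePoint i s j t) : f i s = f j t := by
  obtain ⟨rfl, n, rfl⟩ := h
  have := (hf i).int_mul n s
  rw [mul_one] at this
  exact this.symm

end SamePoint

/-! ### Isotopy of links is an equivalence relation -/

namespace OrientedLink

theorem Isotopic.refl (K : OrientedLink) : K.Isotopic K :=
  ⟨Equiv.refl _, fun i _ t => K.curve i t, fun i => (K.isLink.smooth i).comp contDiff_snd,
    fun _ _ => K.isLink, fun _ _ => rfl, fun _ _ => rfl⟩

theorem Isotopic.symm {K L : OrientedLink} (h : K.Isotopic L) : L.Isotopic K := by
  obtain ⟨e, H, hs, hl, h0, h1⟩ := h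
  refine ⟨e.symm, fun i s t => H (e.symm i) (1 - s) t, fun i => ?_, fun s hs' => ?_, ?_, ?_⟩
  · exact (hs (e.symm i)).comp
      (f := fun q : ℝ × ℝ => ((1 - q.1, q.2) : ℝ × ℝ)) (by fun_prop)
  · have hl' := hl (1 - s) ⟨by linarith [hs'.2], by linarith [hs'.1]⟩
    refine ⟨fun i => hl'.1 _, fun i => hl'.2 _, fun i => hl'.3 _, fun i => hl'.4 _, ?_⟩
    intro i s j t hst
    obtain ⟨h, n⟩ := hl'.5 _ s _ t hst
    exact ⟨e.symm.injective h, n⟩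
  · intro i t
    simp [h1]
  · intro i t
    simp [h0]

theorem Isotopic.trans {K L M : OrientedLink} (h : K.Isotopic L) (h' : L.Isotopic M) :
    K.Isotopic M := by
  obtain ⟨e, H, hs, hl, h0, h1⟩ := h
  obtain ⟨e', H', hs', hl', h0', h1'⟩ := h'
  -- Both isotopies are slowed down to be constant near their ends, so that they fit together.
  let f : ℝ → ℝ := fun s => Real.smoothTransition (3 * s)
  let f' : ℝ → ℝ := fun s => Real.smoothTransition (3 * s - 2)
  have hf : ContDiff ℝ ∞ f := Real.smoothTransition.contDiff.comp (by fun_prop)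
  have hf' : ContDiff ℝ ∞ f' := Real.smoothTransition.contDiff.comp (by fun_prop)
  have f1 : ∀ s, 1 / 3 ≤ s → f s = 1 := fun s h =>
    Real.smoothTransition.one_of_one_le (by linarith)
  have f0' : ∀ s, s ≤ 2 / 3 → f' s = 0 := fun s h =>
    Real.smoothTransition.zero_of_nonpos (by linarith)
  let G : K.ι → ℝ → ℝ → E3 × ℝ := fun i s t =>
    if s < 1 / 2 then H i (f s) t else H' (e i) (f' s) t
  have mid : ∀ i s t, 1 / 3 ≤ s → s ≤ 2 / 3 → H i (f s) t = H' (e i) (f' s) t := by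
    intro i s t h1s h2s
    rw [f1 s h1s, f0' s h2s, h1, h0']
  refine ⟨e.trans e', G, fun i => ?_, fun s _ => ?_, fun i t => ?_, fun i t => ?_⟩
  · rw [contDiff_iff_contDiffAt]
    rintro ⟨s, t⟩
    rcases lt_or_ge s (2 / 3) with h | h
    · have : ContDiffAt ℝ ∞ (fun q : ℝ × ℝ => H i (f q.1) q.2) (s, t) :=
        ((hs i).comp (f := fun q : ℝ × ℝ => ((f q.1, q.2) : ℝ × ℝ)) (by fun_prop)).contDiffAt
      refine this.congr_of_eventuallyEq ?_
      have : ∀ᶠ q : ℝ × ℝ in nhds (s, t), q.1 < 2 / 3 :=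
        (continuous_fst.tendsto (s, t)).eventually (gt_mem_nhds h)
      filter_upwards [this] with q hq
      by_cases hq' : q.1 < 1 / 2
      · simp only [G, if_pos hq']
      · simp only [G, if_neg hq']
        exact (mid i _ _ (by linarith) hq.le).symm
    · have : ContDiffAt ℝ ∞ (fun q : ℝ × ℝ => H' (e i) (f' q.1) q.2) (s, t) :=
        ((hs' (e i)).comp (f := fun q : ℝ × ℝ => ((f' q.1, q.2) : ℝ × ℝ)) (by fun_prop)).contDiffAt
      refine this.congr_of_eventuallyEq ?_
      have : ∀ᶠ q : ℝ × ℝ in nhds (s, t), 1 / 2 < q.1 :=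
        (continuous_fst.tendsto (s, t)).eventually (lt_mem_nhds (by linarith))
      filter_upwards [this] with q hq
      simp only [G, if_neg hq.not_gt]
  · have hI : ∀ s, Real.smoothTransition s ∈ Set.Icc (0 : ℝ) 1 := fun s =>
      ⟨Real.smoothTransition.nonneg s, Real.smoothTransition.le_one s⟩
    by_cases h : s < 1 / 2
    · simp only [G, if_pos h]
      exact hl _ (hI _)
    · simp only [G, if_neg h]
      have h' := hl' _ (hI (3 * s - 2))
      refine ⟨fun i => h'.1 _, fun i => h'.2 _, fun i => h'.3 _, fun i => h'.4 _, ?_⟩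
      intro i s j t hst
      obtain ⟨h, n⟩ := h'.5 _ s _ t hst
      exact ⟨e.injective h, n⟩
  · have : f 0 = 0 := Real.smoothTransition.zero_of_nonpos (by norm_num)
    simp [G, this, h0]
  · have : f' 1 = 1 := Real.smoothTransition.one_of_one_le (by norm_num)
    have h' : ¬ ((1 : ℝ) < 1 / 2) := by norm_num
    simp only [G, if_neg h', this, h1']
    rfl

end OrientedLink

/-! ### Diagrams from projected curves and heights -/

/-- The data from which a link diagram can be built: curves `σ` on the unit sphere whose multiple
points are transverse double points, and real heights `η` that differ at double points. -/
structure IsDiagramData {ι : Type} (σ : ι → ℝ → E3) (η : ι → ℝ → ℝ) : Prop where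
  norm_eq : ∀ i t, ‖σ i t‖ = 1
  smooth : ∀ i, ContDiff ℝ ∞ (σ i)
  smooth_height : ∀ i, ContDiff ℝ ∞ (η i)
  periodic : ∀ i, Function.Periodic (σ i) 1
  periodic_height : ∀ i, Function.Periodic (η i) 1
  immersion : ∀ i t, deriv (σ i) t ≠ 0
  transverse : ∀ i s j t, σ i s = σ j t → ¬ SamePoint i s j t →
    LinearIndependent ℝ ![deriv (σ i) s, deriv (σ j) t]
  no_triple : ∀ i s j t k r, σ i s = σ j t → ¬ SamePoint i s j t → σ i s = σ k r →
    ¬ SamePoint i s k r → SamePoint j t k r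
  height_ne : ∀ i s j t, σ i s = σ j t → ¬ SamePoint i s j t → η i s ≠ η j t

/-- The point of `S³` that lies over the point `p` of `S²` with `w / |x| = a`. -/
noncomputable def spherePoint (p : E3) (a : ℝ) : E3 × ℝ :=
  (Real.cos (Real.arctan a) • p, Real.sin (Real.arctan a))

theorem sin_arctan_strictMono : StrictMono fun a : ℝ => Real.sin (Real.arctan a) := by
  intro a b h
  exact Real.strictMonoOn_sin ⟨(Real.neg_pi_div_two_lt_arctan a).le, (Real.arctan_lt_pi_div_two a).le⟩
    ⟨(Real.neg_pi_div_two_lt_arctan b).le, (Real.arctan_lt_pi_div_two b).le⟩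
    (Real.arctan_strictMono h)

theorem norm_spherePoint_fst {p : E3} (hp : ‖p‖ = 1) (a : ℝ) :
    ‖(spherePoint p a).1‖ = Real.cos (Real.arctan a) := by
  simp [spherePoint, norm_smul, hp, abs_of_pos (Real.cos_arctan_pos a)]

theorem spherePoint_mem {p : E3} (hp : ‖p‖ = 1) (a : ℝ) : spherePoint p a ∈ S3 := by
  simp only [S3, Set.mem_ofPred_eq, norm_spherePoint_fst hp]
  simp only [spherePoint]
  exact Real.cos_sq_add_sin_sq _

theorem spherePoint_proj {p : E3} (hp : ‖p‖ = 1) (a : ℝ) :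
    ‖(spherePoint p a).1‖⁻¹ • (spherePoint p a).1 = p := by
  rw [norm_spherePoint_fst hp]
  simp only [spherePoint, smul_smul]
  rw [inv_mul_cancel₀ (Real.cos_arctan_pos a).ne', one_smul]

theorem spherePoint_inj {p q : E3} (hp : ‖p‖ = 1) (hq : ‖q‖ = 1) {a b : ℝ}
    (h : spherePoint p a = spherePoint q b) : p = q ∧ a = b :=
  ⟨by rw [← spherePoint_proj hp a, h, spherePoint_proj hq],
    sin_arctan_strictMono.injective (congrArg Prod.snd h)⟩

/-- Each point of `S³` other than the poles is determined by its projection and the ratio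
`w / |x|`. -/
theorem spherePoint_eq {q : E3 × ℝ} (hq : q ∈ S3) (h0 : q.1 ≠ 0) :
    spherePoint (‖q.1‖⁻¹ • q.1) (q.2 / ‖q.1‖) = q := by
  have hn : 0 < ‖q.1‖ := norm_pos_iff.2 h0
  have hq : ‖q.1‖ ^ 2 + q.2 ^ 2 = 1 := hq
  have h1 : 1 + (q.2 / ‖q.1‖) ^ 2 = (‖q.1‖⁻¹) ^ 2 := by
    field_simp
    linarith
  have h2 : Real.sqrt (1 + (q.2 / ‖q.1‖) ^ 2) = ‖q.1‖⁻¹ := by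
    rw [h1, Real.sqrt_sq (by positivity)]
  ext1
  · simp only [spherePoint, Real.cos_arctan, h2, smul_smul]
    rw [one_div, inv_inv, mul_inv_cancel₀ hn.ne', one_smul]
  · simp only [spherePoint, Real.sin_arctan, h2]
    field_simp

theorem contDiff_spherePoint {E : Type*} [NormedAddCommGroup E] [NormedSpace ℝ E] {f : E → E3}
    {g : E → ℝ} (hf : ContDiff ℝ ∞ f) (hg : ContDiff ℝ ∞ g) :
    ContDiff ℝ ∞ fun x => spherePoint (f x) (g x) := by
  unfold spherePoint
  have : ContDiff ℝ ∞ fun x => Real.arctan (g x) := Real.contDiff_arctan.comp hg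
  exact ((Real.contDiff_cos.comp this).smul hf).prodMk (Real.contDiff_sin.comp this)

/-- Wherever a curve in `ℝ³ × ℝ` stands still, so does its projection to `S²`. -/
theorem deriv_ne_zero_of_proj {c : ℝ → E3 × ℝ} {t : ℝ} (hc : DifferentiableAt ℝ c t)
    (h0 : (c t).1 ≠ 0) (h : deriv (fun t => ‖(c t).1‖⁻¹ • (c t).1) t ≠ 0) : deriv c t ≠ 0 := by
  intro hd
  apply h
  have h1 : HasDerivAt c 0 t := hd ▸ hc.hasDerivAt
  have h2 : HasFDerivAt (fun q : E3 × ℝ => ‖q.1‖⁻¹ • q.1)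
      (fderiv ℝ (fun q : E3 × ℝ => ‖q.1‖⁻¹ • q.1) (c t)) (c t) := by
    apply DifferentiableAt.hasFDerivAt
    have : DifferentiableAt ℝ (fun q : E3 × ℝ => ‖q.1‖) (c t) :=
      differentiableAt_fst.norm ℝ h0
    exact (this.inv (norm_ne_zero_iff.2 h0)).smul differentiableAt_fst
  have := h2.comp_hasDerivAt t h1
  have h3 := this.deriv
  rw [map_zero] at h3
  exact h3

namespace IsDiagramData

variable {ι : Type} {σ : ι → ℝ → E3} {η : ι → ℝ → ℝ}

/-- The projections may have arbitrary multiple points here, as long as the heights separate them. -/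
theorem isLinkEmbedding (hn : ∀ i t, ‖σ i t‖ = 1) (hs : ∀ i, ContDiff ℝ ∞ (σ i))
    (hs' : ∀ i, ContDiff ℝ ∞ (η i)) (hp : ∀ i, Function.Periodic (σ i) 1)
    (hp' : ∀ i, Function.Periodic (η i) 1) (hd : ∀ i t, deriv (σ i) t ≠ 0)
    (hi : ∀ i s j t, σ i s = σ j t → η i s = η j t → SamePoint i s j t) :
    IsLinkEmbedding fun i t => spherePoint (σ i t) (η i t) where
  mem_sphere i t := spherePoint_mem (hn i t) _
  smooth i := contDiff_spherePoint (hs i) (hs' i)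
  periodic i t := by simp only [hp i t, hp' i t]
  immersion i t := by
    have hc := contDiff_spherePoint (hs i) (hs' i)
    refine deriv_ne_zero_of_proj (hc.differentiable (by simp) t) ?_ ?_
    · rw [← norm_ne_zero_iff, norm_spherePoint_fst (hn i t)]
      exact (Real.cos_arctan_pos _).ne'
    · simp only [spherePoint_proj (hn i _)]
      exact hd i t
  injective i s j t h := by
    obtain ⟨h1, h2⟩ := spherePoint_inj (hn i s) (hn j t) h
    exact hi i s j t h1 h2

end IsDiagramData

namespace LinkDiagram

/-- The link diagram with projected curves `σ` and heights given by `η`. -/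
@[reducible] noncomputable def ofData {ι : Type} [Finite ι] {σ : ι → ℝ → E3} {η : ι → ℝ → ℝ}
    (h : IsDiagramData σ η) : LinkDiagram where
  ι := ι
  finite := inferInstance
  curve := fun i t => spherePoint (σ i t) (η i t)
  isLink := IsDiagramData.isLinkEmbedding h.norm_eq h.smooth h.smooth_height h.periodic
    h.periodic_height h.immersion fun i s j t h1 h2 => by
      by_contra hne
      exact h.height_ne i s j t h1 hne h2
  regular := by
    have key : ∀ i t, ‖(spherePoint (σ i t) (η i t)).1‖⁻¹ • (spherePoint (σ i t) (η i t)).1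
        = σ i t := fun i t => spherePoint_proj (h.norm_eq i t) _
    constructor
    · intro i t
      rw [← norm_ne_zero_iff, norm_spherePoint_fst (h.norm_eq i t)]
      exact (Real.cos_arctan_pos _).ne'
    · intro i t
      unfold OrientedLink.shadow
      simp only [key]
      exact h.immersion i t
    · intro i s j t hc
      unfold OrientedLink.IsCrossing OrientedLink.shadow at *
      simp only [key] at *
      exact h.transverse i s j t hc.1 hc.2
    · intro i s j t k r hc hc'
      unfold OrientedLink.IsCrossing OrientedLink.shadow at *
      simp only [key] at *
      exact h.no_triple i s j t k r hc.1 hc.2 hc'.1 hc'.2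

section ofData

variable {ι : Type} [Finite ι] {σ : ι → ℝ → E3} {η : ι → ℝ → ℝ} (h : IsDiagramData σ η)

@[simp]
theorem shadow_ofData (i : ι) (t : ℝ) : (ofData h).shadow i t = σ i t :=
  spherePoint_proj (h.norm_eq i t) _

theorem height_ofData_lt (i : ι) (s : ℝ) (j : ι) (t : ℝ) :
    (ofData h).height i s < (ofData h).height j t ↔ η i s < η j t :=
  sin_arctan_strictMono.lt_iff_lt

end ofData

variable (D : LinkDiagram)

/-- The ratio `w / |x|`: a measure of height that can be any real number. -/
noncomputable def slope (i : D.ι) (t : ℝ) : ℝ := (D.curve i t).2 / ‖(D.curve i t).1‖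

theorem curve_eq (i : D.ι) (t : ℝ) : D.curve i t = spherePoint (D.shadow i t) (D.slope i t) :=
  (spherePoint_eq (D.isLink.mem_sphere i t) (D.regular.avoids_poles i t)).symm

theorem slope_lt_iff {i s j t} : D.slope i s < D.slope j t ↔ D.height i s < D.height j t := by
  have h : ∀ i t, D.height i t = Real.sin (Real.arctan (D.slope i t)) := fun i t =>
    congrArg Prod.snd (D.curve_eq i t)
  rw [h, h]
  exact sin_arctan_strictMono.lt_iff_lt.symm

theorem norm_shadow (i : D.ι) (t : ℝ) : ‖D.shadow i t‖ = 1 := by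
  have := norm_ne_zero_iff.2 (D.regular.avoids_poles i t)
  simp [OrientedLink.shadow, norm_smul, this]

theorem shadow_ne_zero (i : D.ι) (t : ℝ) : D.shadow i t ≠ 0 := by
  rw [← norm_ne_zero_iff, norm_shadow]
  exact one_ne_zero

theorem smooth_norm_curve_fst (i : D.ι) : ContDiff ℝ ∞ fun t => ‖(D.curve i t).1‖ :=
  ((contDiff_fst.comp (D.isLink.smooth i))).norm ℝ (D.regular.avoids_poles i)

theorem smooth_shadow (i : D.ι) : ContDiff ℝ ∞ (D.shadow i) :=
  ((D.smooth_norm_curve_fst i).inv fun t => norm_ne_zero_iff.2 (D.regular.avoids_poles i t)).smul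
    (contDiff_fst.comp (D.isLink.smooth i))

theorem smooth_slope (i : D.ι) : ContDiff ℝ ∞ (D.slope i) :=
  (contDiff_snd.comp (D.isLink.smooth i)).div (D.smooth_norm_curve_fst i)
    fun t => norm_ne_zero_iff.2 (D.regular.avoids_poles i t)

theorem periodic_shadow (i : D.ι) : Function.Periodic (D.shadow i) 1 := fun t => by
  simp [OrientedLink.shadow, D.isLink.periodic i t]

theorem periodic_slope (i : D.ι) : Function.Periodic (D.slope i) 1 := fun t => by
  simp [slope, D.isLink.periodic i t]

theorem differentiableAt_shadow (i : D.ι) (t : ℝ) : DifferentiableAt ℝ (D.shadow i) t :=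
  (D.smooth_shadow i).differentiable (by simp) t

theorem hasDerivAt_shadow (i : D.ι) (t : ℝ) :
    HasDerivAt (D.shadow i) (deriv (D.shadow i) t) t :=
  (D.differentiableAt_shadow i t).hasDerivAt

theorem samePoint_of_shadow_of_slope {i s j t} (h : D.shadow i s = D.shadow j t)
    (h' : D.slope i s = D.slope j t) : SamePoint i s j t :=
  D.isLink.injective i s j t (by rw [curve_eq, curve_eq, h, h'])

theorem isDiagramData : IsDiagramData D.shadow D.slope where
  norm_eq := D.norm_shadow
  smooth := D.smooth_shadow
  smooth_height := D.smooth_slope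
  periodic := D.periodic_shadow
  periodic_height := D.periodic_slope
  immersion := D.regular.immersion
  transverse i s j t h h' := D.regular.transverse i s j t ⟨h, h'⟩
  no_triple i s j t k r h1 h2 h3 h4 := D.regular.no_triple i s j t k r ⟨h1, h2⟩ ⟨h3, h4⟩
  height_ne _ _ _ _ h h' h'' := h' (D.samePoint_of_shadow_of_slope h h'')

/-- An isotopy between links with generic projections can be given by a family of projected curves
and a family of heights. -/
theorem isotopic_of_family {K K' : LinkDiagram} (e : K.ι ≃ K'.ι) (σ : K.ι → ℝ → ℝ → E3)
    (η : K.ι → ℝ → ℝ → ℝ) (hσ : ∀ i, ContDiff ℝ ∞ fun q : ℝ × ℝ => σ i q.1 q.2)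
    (hη : ∀ i, ContDiff ℝ ∞ fun q : ℝ × ℝ => η i q.1 q.2)
    (hn : ∀ s ∈ Set.Icc (0 : ℝ) 1, ∀ i t, ‖σ i s t‖ = 1)
    (hp : ∀ s ∈ Set.Icc (0 : ℝ) 1, ∀ i, Function.Periodic (σ i s) 1)
    (hp' : ∀ s ∈ Set.Icc (0 : ℝ) 1, ∀ i, Function.Periodic (η i s) 1)
    (hd : ∀ s ∈ Set.Icc (0 : ℝ) 1, ∀ i t, deriv (σ i s) t ≠ 0)
    (hi : ∀ s ∈ Set.Icc (0 : ℝ) 1, ∀ i t j t', σ i s t = σ j s t' → η i s t = η j s t' →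
      SamePoint i t j t')
    (h0 : ∀ i t, σ i 0 t = K.shadow i t) (h0' : ∀ i t, η i 0 t = K.slope i t)
    (h1 : ∀ i t, σ i 1 t = K'.shadow (e i) t) (h1' : ∀ i t, η i 1 t = K'.slope (e i) t) :
    K.Isotopic K'.toOrientedLink := by
  refine ⟨e, fun i s t => spherePoint (σ i s t) (η i s t), fun i => ?_, fun s hs => ?_, ?_, ?_⟩
  · exact contDiff_spherePoint (hσ i) (hη i)
  · refine IsDiagramData.isLinkEmbedding (hn s hs) (fun i => ?_) (fun i => ?_) (hp s hs)
      (hp' s hs) (hd s hs) (hi s hs)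
    · exact (hσ i).comp (f := fun t : ℝ => ((s, t) : ℝ × ℝ)) (by fun_prop)
    · exact (hη i).comp (f := fun t : ℝ => ((s, t) : ℝ × ℝ)) (by fun_prop)
  · intro i t
    simp only [h0, h0', curve_eq]
  · intro i t
    simp only [h1, h1', curve_eq]

end LinkDiagram

theorem OrientedLink.IsCrossing.symm {K : OrientedLink} {i s j t} (h : K.IsCrossing i s j t) :
    K.IsCrossing j t i s :=
  ⟨h.1.symm, fun h' => h.2 h'.symm⟩

theorem OrientedLink.IsCrossing.height_ne {D : LinkDiagram} {i s j t}
    (h : D.IsCrossing i s j t) : D.height i s ≠ D.height j t := by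
  rcases (D.isDiagramData.height_ne i s j t h.1 h.2).lt_or_gt with h' | h'
  · exact (D.slope_lt_iff.1 h').ne
  · exact (D.slope_lt_iff.1 h').ne'

/-! ### Reparametrizations of the circle -/

namespace IsCircleReparam

variable {φ ψ : ℝ → ℝ}

theorem id : IsCircleReparam fun t => t :=
  ⟨contDiff_id, fun t => by simp, fun _ => rfl⟩

theorem hasDerivAt (h : IsCircleReparam φ) (t : ℝ) : HasDerivAt φ (deriv φ t) t :=
  (h.smooth.differentiable (by simp) t).hasDerivAt

theorem comp (h : IsCircleReparam φ) (h' : IsCircleReparam ψ) :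
    IsCircleReparam fun t => φ (ψ t) where
  smooth := h.smooth.comp h'.smooth
  deriv_pos t := by
    have := ((h.hasDerivAt (ψ t)).comp t (h'.hasDerivAt t)).deriv
    exact lt_of_lt_of_eq (mul_pos (h.deriv_pos _) (h'.deriv_pos _)) this.symm
  equivariant t := by rw [h'.equivariant, h.equivariant]

theorem strictMono (h : IsCircleReparam φ) : StrictMono φ := strictMono_of_deriv_pos h.deriv_pos

theorem add_int (h : IsCircleReparam φ) (t : ℝ) (n : ℤ) : φ (t + n) = φ t + n := by
  have : Function.Periodic (fun t => φ t - t) 1 := fun t => by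
    simp only [h.equivariant]
    ring
  have := this.int_mul n t
  simp only [mul_one] at this
  linarith

theorem surjective (h : IsCircleReparam φ) : Function.Surjective φ := by
  intro y
  have h1 : φ (0 + ⌊y - φ 0⌋) ≤ y := by
    rw [h.add_int]
    linarith [Int.floor_le (y - φ 0)]
  have h2 : y ≤ φ (0 + (⌊y - φ 0⌋ + 1 : ℤ)) := by
    rw [h.add_int]
    push_cast
    linarith [Int.lt_floor_add_one (y - φ 0)]
  have h3 : (0 + (⌊y - φ 0⌋ : ℝ)) ≤ 0 + (⌊y - φ 0⌋ + 1 : ℤ) := by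
    push_cast
    linarith
  obtain ⟨x, -, hx⟩ := intermediate_value_Icc h3 h.smooth.continuous.continuousOn ⟨h1, h2⟩
  exact ⟨x, hx⟩

theorem exists_inverse (h : IsCircleReparam φ) :
    ∃ ψ, IsCircleReparam ψ ∧ (∀ t, ψ (φ t) = t) ∧ ∀ t, φ (ψ t) = t := by
  let e : ℝ ≃ₜ ℝ := (h.strictMono.orderIsoOfSurjective φ h.surjective).toHomeomorph
  have he : ∀ t, e t = φ t := fun t => rfl
  have h1 : ∀ t, e.symm (φ t) = t := fun t => e.symm_apply_apply t
  have h2 : ∀ t, φ (e.symm t) = t := fun t => e.apply_symm_apply t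
  have hd : ∀ t, HasDerivAt e.symm (deriv φ (e.symm t))⁻¹ t := fun t =>
    HasDerivAt.of_local_left_inverse e.symm.continuous.continuousAt (h.hasDerivAt _)
      (h.deriv_pos _).ne' (Filter.Eventually.of_forall h2)
  refine ⟨e.symm, ⟨?_, fun t => ?_, fun t => ?_⟩, h1, h2⟩
  · rw [contDiff_iff_contDiffAt]
    intro t
    exact e.toOpenPartialHomeomorph.contDiffAt_symm_deriv (h.deriv_pos (e.symm t)).ne'
      (Set.mem_univ _) (h.hasDerivAt _) h.smooth.contDiffAt
  · rw [(hd t).deriv]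
    exact inv_pos.2 (h.deriv_pos _)
  · apply h.strictMono.injective
    rw [h2, h.equivariant, h2]

theorem samePoint_iff {ι : Type} {φ : ι → ℝ → ℝ} (h : ∀ i, IsCircleReparam (φ i)) {i s j t} :
    SamePoint i (φ i s) j (φ j t) ↔ SamePoint i s j t := by
  constructor
  · rintro ⟨rfl, n, hn⟩
    rw [← (h i).add_int] at hn
    exact ⟨rfl, n, (h i).strictMono.injective hn⟩
  · rintro ⟨rfl, n, rfl⟩
    exact ⟨rfl, n, (h i).add_int s n⟩

end IsCircleReparam

/-! ### Diffeomorphisms of the sphere -/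

/-- The determinant by which the sign of a crossing is defined. -/
noncomputable def det3 (p u v : E3) : ℝ := Matrix.det (Matrix.of ![p.ofLp, u.ofLp, v.ofLp])

theorem det3_map (L : E3 →L[ℝ] E3) (p u v : E3) :
    det3 (L p) (L u) (L v) = L.det * det3 p u v := by
  have key : ∀ p u v : E3, det3 p u v = (EuclideanSpace.basisFun (Fin 3) ℝ).toBasis.det ![p, u, v] := by
    intro p u v
    rw [Module.Basis.det_apply, det3, ← Matrix.det_transpose]
    congr 1
    ext i j
    fin_cases j <;> simp [Module.Basis.toMatrix_apply]
  rw [key, key]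
  have := (EuclideanSpace.basisFun (Fin 3) ℝ).toBasis.det_comp (L : E3 →ₗ[ℝ] E3) ![p, u, v]
  have h' : (⇑(L : E3 →ₗ[ℝ] E3) ∘ ![p, u, v]) = ![L p, L u, L v] := by
    ext i
    fin_cases i <;> simp
  rw [h'] at this
  exact this

theorem det3_swap (p u v : E3) : det3 p v u = - det3 p u v := by
  simp only [det3, Matrix.det_fin_three, Matrix.of_apply, Matrix.cons_val]
  ring

theorem det3_smul (p u v : E3) (a b : ℝ) : det3 p (a • u) (b • v) = a * b * det3 p u v := by
  simp only [det3, Matrix.det_fin_three, Matrix.of_apply, Matrix.cons_val, PiLp.smul_apply,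
    smul_eq_mul]
  ring

/-- `g` is an orientation preserving diffeomorphism of `S²` with inverse `g'`, both of them extended
to `ℝ³` by homogeneity. -/
structure IsSphereDiffeo (g g' : E3 → E3) : Prop where
  smooth : ContDiffOn ℝ ∞ g {0}ᶜ
  smooth_inv : ContDiffOn ℝ ∞ g' {0}ᶜ
  norm_map : ∀ x, ‖g x‖ = ‖x‖
  norm_inv : ∀ x, ‖g' x‖ = ‖x‖
  homog : ∀ r : ℝ, 0 < r → ∀ x, g (r • x) = r • g x
  left_inv : ∀ x, g' (g x) = x
  right_inv : ∀ x, g (g' x) = x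
  det_pos : ∀ x ≠ 0, 0 < (fderiv ℝ g x).det

namespace IsSphereDiffeo

variable {g g' k k' : E3 → E3}

theorem map_ne_zero (h : IsSphereDiffeo g g') {x : E3} (hx : x ≠ 0) : g x ≠ 0 := by
  rwa [← norm_ne_zero_iff, h.norm_map, norm_ne_zero_iff]

theorem inv_ne_zero (h : IsSphereDiffeo g g') {x : E3} (hx : x ≠ 0) : g' x ≠ 0 := by
  rwa [← norm_ne_zero_iff, h.norm_inv, norm_ne_zero_iff]

theorem injective (h : IsSphereDiffeo g g') : Function.Injective g :=
  Function.LeftInverse.injective h.left_inv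

theorem contDiffAt (h : IsSphereDiffeo g g') {x : E3} (hx : x ≠ 0) : ContDiffAt ℝ ∞ g x :=
  h.smooth.contDiffAt (isOpen_compl_singleton.mem_nhds hx)

theorem hasFDerivAt (h : IsSphereDiffeo g g') {x : E3} (hx : x ≠ 0) :
    HasFDerivAt g (fderiv ℝ g x) x :=
  ((h.contDiffAt hx).differentiableAt (by simp)).hasFDerivAt

theorem hasFDerivAt_inv (h : IsSphereDiffeo g g') {x : E3} (hx : x ≠ 0) :
    HasFDerivAt g' (fderiv ℝ g' x) x :=
  ((h.smooth_inv.contDiffAt (isOpen_compl_singleton.mem_nhds hx)).differentiableAt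
    (by simp)).hasFDerivAt

theorem fderiv_inv_comp (h : IsSphereDiffeo g g') {x : E3} (hx : x ≠ 0) :
    (fderiv ℝ g' (g x)).comp (fderiv ℝ g x) = ContinuousLinearMap.id ℝ E3 := by
  have h1 := (h.hasFDerivAt_inv (h.map_ne_zero hx)).comp x (h.hasFDerivAt hx)
  have h2 : g' ∘ g = fun x => x := funext h.left_inv
  rw [h2] at h1
  exact h1.unique (hasFDerivAt_id x)

theorem fderiv_injective (h : IsSphereDiffeo g g') {x : E3} (hx : x ≠ 0) {u : E3}
    (hu : fderiv ℝ g x u = 0) : u = 0 := by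
  have := congrArg (fun L : E3 →L[ℝ] E3 => L u) (h.fderiv_inv_comp hx)
  simpa [hu] using this.symm

theorem fderiv_self (h : IsSphereDiffeo g g') {x : E3} (hx : x ≠ 0) : fderiv ℝ g x x = g x := by
  have h1 : HasDerivAt (fun r : ℝ => r • x) x 1 := by
    simpa using (hasDerivAt_id (1 : ℝ)).smul_const x
  have h2 : HasDerivAt (fun r : ℝ => g (r • x)) (fderiv ℝ g x x) 1 := by
    have h3 : HasFDerivAt g (fderiv ℝ g x) ((1 : ℝ) • x) := by
      rw [one_smul]
      exact h.hasFDerivAt hx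
    exact h3.comp_hasDerivAt (1 : ℝ) h1
  have h3 : HasDerivAt (fun r : ℝ => r • g x) (g x) 1 := by
    simpa using (hasDerivAt_id (1 : ℝ)).smul_const (g x)
  refine (h2.congr_of_eventuallyEq ?_).unique h3 |>.symm ▸ rfl
  filter_upwards [lt_mem_nhds (zero_lt_one' ℝ)] with r hr
  exact (h.homog r hr x).symm

theorem hasDerivAt_comp (h : IsSphereDiffeo g g') {c : ℝ → E3} {c' : E3} {t : ℝ}
    (hc : HasDerivAt c c' t) (h0 : c t ≠ 0) :
    HasDerivAt (fun t => g (c t)) (fderiv ℝ g (c t) c') t :=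
  (h.hasFDerivAt h0).comp_hasDerivAt t hc

theorem id : IsSphereDiffeo (fun x => x) fun x => x where
  smooth := contDiffOn_id
  smooth_inv := contDiffOn_id
  norm_map _ := rfl
  norm_inv _ := rfl
  homog _ _ _ := rfl
  left_inv _ := rfl
  right_inv _ := rfl
  det_pos x _ := by
    have : fderiv ℝ (fun x : E3 => x) x = ContinuousLinearMap.id ℝ E3 := fderiv_id
    rw [this]
    simp [ContinuousLinearMap.det]

theorem symm (h : IsSphereDiffeo g g') : IsSphereDiffeo g' g where
  smooth := h.smooth_inv
  smooth_inv := h.smooth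
  norm_map := h.norm_inv
  norm_inv := h.norm_map
  homog r hr x := by
    apply h.injective
    rw [h.right_inv, h.homog r hr, h.right_inv]
  left_inv := h.right_inv
  right_inv := h.left_inv
  det_pos x hx := by
    have h1 := h.fderiv_inv_comp (h.inv_ne_zero hx)
    rw [h.right_inv] at h1
    have h2 := h.det_pos _ (h.inv_ne_zero hx)
    have h3 : (fderiv ℝ g' x).det * (fderiv ℝ g (g' x)).det = 1 := by
      have := congrArg ContinuousLinearMap.det h1
      have h4 : (ContinuousLinearMap.id ℝ E3).det = 1 := by simp [ContinuousLinearMap.det]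
      rw [h4] at this
      rw [← this]
      exact (LinearMap.det_comp _ _).symm
    by_contra h5
    nlinarith

theorem comp (h : IsSphereDiffeo g g') (hk : IsSphereDiffeo k k') :
    IsSphereDiffeo (fun x => g (k x)) fun x => k' (g' x) where
  smooth := h.smooth.comp hk.smooth fun _ hx => hk.map_ne_zero hx
  smooth_inv := hk.smooth_inv.comp h.smooth_inv fun _ hx => h.inv_ne_zero hx
  norm_map x := by rw [h.norm_map, hk.norm_map]
  norm_inv x := by rw [hk.norm_inv, h.norm_inv]
  homog r hr x := by rw [hk.homog r hr, h.homog r hr]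
  left_inv x := by rw [h.left_inv, hk.left_inv]
  right_inv x := by rw [hk.right_inv, h.right_inv]
  det_pos x hx := by
    have h1 : HasFDerivAt (fun x => g (k x)) _ x :=
      (h.hasFDerivAt (hk.map_ne_zero hx)).comp x (hk.hasFDerivAt hx)
    rw [h1.fderiv]
    have := mul_pos (h.det_pos _ (hk.map_ne_zero hx)) (hk.det_pos _ hx)
    exact lt_of_lt_of_eq this (LinearMap.det_comp _ _).symm

end IsSphereDiffeo

/-! ### Transporting diagrams -/

namespace LinkDiagram

/-- The diagram `D'` is the image of `D` under the map `g` of `S²`, up to the reparametrizations `φ`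
and the matching `e` of the components. -/
structure IsTransport (D D' : LinkDiagram) (g : E3 → E3) (e : D.ι ≃ D'.ι) (φ : D.ι → ℝ → ℝ) :
    Prop where
  reparam : ∀ i, IsCircleReparam (φ i)
  shadow_eq : ∀ i t, D'.shadow (e i) (φ i t) = g (D.shadow i t)
  order : ∀ i s j t, D.IsCrossing i s j t →
    (D.height i s < D.height j t ↔ D'.height (e i) (φ i s) < D'.height (e j) (φ j t))

namespace IsTransport

variable {D D' D'' : LinkDiagram} {g g' k : E3 → E3} {e : D.ι ≃ D'.ι} {φ : D.ι → ℝ → ℝ}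

theorem samePoint_iff (h : IsTransport D D' g e φ) {i s j t} :
    SamePoint (e i) (φ i s) (e j) (φ j t) ↔ SamePoint i s j t := by
  rw [← IsCircleReparam.samePoint_iff h.reparam (i := i) (j := j)]
  simp only [SamePoint, e.injective.eq_iff]

theorem isCrossing_iff (h : IsTransport D D' g e φ) (hg : Function.Injective g) {i s j t} :
    D'.IsCrossing (e i) (φ i s) (e j) (φ j t) ↔ D.IsCrossing i s j t := by
  unfold OrientedLink.IsCrossing
  rw [h.samePoint_iff, h.shadow_eq, h.shadow_eq, hg.eq_iff]

theorem exists_preimage (h : IsTransport D D' g e φ) (i' : D'.ι) (s' : ℝ) :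
    ∃ i s, e i = i' ∧ φ i s = s' := by
  obtain ⟨s, hs⟩ := (h.reparam (e.symm i')).surjective s'
  exact ⟨e.symm i', s, e.apply_symm_apply i', hs⟩

theorem symm (h : IsTransport D D' g e φ) (hg : IsSphereDiffeo g g') :
    ∃ φ', IsTransport D' D g' e.symm φ' := by
  choose ψ h1 h2 h3 using fun i => (h.reparam i).exists_inverse
  refine ⟨fun i => ψ (e.symm i), fun i => h1 _, fun i t => ?_, fun i s j t hc => ?_⟩
  · have := h.shadow_eq (e.symm i) (ψ (e.symm i) t)
    rw [h3, e.apply_symm_apply] at this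
    rw [this, hg.left_inv]
  · have h4 := h.order (e.symm i) (ψ (e.symm i) s) (e.symm j) (ψ (e.symm j) t)
    rw [← h.isCrossing_iff hg.injective, h3, h3, e.apply_symm_apply, e.apply_symm_apply] at h4
    exact (h4 hc).symm

theorem trans {e' : D'.ι ≃ D''.ι} {φ' : D'.ι → ℝ → ℝ} (h : IsTransport D D' g e φ)
    (h' : IsTransport D' D'' k e' φ') (hg : Function.Injective g) :
    IsTransport D D'' (fun x => k (g x)) (e.trans e') fun i t => φ' (e i) (φ i t) where
  reparam i := (h'.reparam _).comp (h.reparam i)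
  shadow_eq i t := by rw [Equiv.trans_apply, h'.shadow_eq, h.shadow_eq]
  order i s j t hc := by
    rw [h.order i s j t hc, Equiv.trans_apply, Equiv.trans_apply,
      h'.order _ _ _ _ ((h.isCrossing_iff hg).2 hc)]

theorem meetsCrossing_iff (h : IsTransport D D' g e φ) (hg : Function.Injective g) {i s} :
    D'.MeetsCrossing (e i) (φ i s) ↔ D.MeetsCrossing i s := by
  constructor
  · rintro ⟨j', t', hc⟩
    obtain ⟨j, t, rfl, rfl⟩ := h.exists_preimage j' t'
    exact ⟨j, t, (h.isCrossing_iff hg).1 hc⟩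
  · rintro ⟨j, t, hc⟩
    exact ⟨_, _, (h.isCrossing_iff hg).2 hc⟩

theorem passesOver_iff (h : IsTransport D D' g e φ) (hg : Function.Injective g) {i s} :
    D'.PassesOver (e i) (φ i s) ↔ D.PassesOver i s := by
  constructor
  · rintro ⟨j', t', hc, hlt⟩
    obtain ⟨j, t, rfl, rfl⟩ := h.exists_preimage j' t'
    have hc' := (h.isCrossing_iff hg).1 hc
    exact ⟨j, t, hc', (h.order _ _ _ _ hc'.symm).2 hlt⟩
  · rintro ⟨j, t, hc, hlt⟩
    exact ⟨_, _, (h.isCrossing_iff hg).2 hc, (h.order _ _ _ _ hc.symm).1 hlt⟩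

theorem isAlternating (h : IsTransport D D' g e φ) (hg : Function.Injective g)
    (hD : D.IsAlternating) : D'.IsAlternating := by
  intro i' s' t' hst hs ht hr
  obtain ⟨i, s, rfl, rfl⟩ := h.exists_preimage i' s'
  obtain ⟨t, rfl⟩ := (h.reparam i).surjective t'
  rw [h.passesOver_iff hg, h.passesOver_iff hg]
  rw [h.meetsCrossing_iff hg] at hs ht
  have hm := (h.reparam i).strictMono
  refine hD i s t (hm.lt_iff_lt.1 hst) hs ht fun r hr' hrc => ?_
  exact hr (φ i r) ⟨hm hr'.1, hm hr'.2⟩ ((h.meetsCrossing_iff hg).2 hrc)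

/-- The velocity of the transported curve. -/
theorem deriv_shadow (h : IsTransport D D' g e φ) (hg : IsSphereDiffeo g g') (i t) :
    deriv (φ i) t • deriv (D'.shadow (e i)) (φ i t)
      = fderiv ℝ g (D.shadow i t) (deriv (D.shadow i) t) := by
  have h1 : HasDerivAt (fun t => D'.shadow (e i) (φ i t)) _ t :=
    (D'.hasDerivAt_shadow (e i) (φ i t)).scomp t ((h.reparam i).hasDerivAt t)
  have h2 : HasDerivAt (fun t => g (D.shadow i t)) _ t :=
    hg.hasDerivAt_comp (D.hasDerivAt_shadow i t) (D.shadow_ne_zero i t)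
  simp only [h.shadow_eq] at h1
  exact h1.unique h2

theorem isPositive (h : IsTransport D D' g e φ) (hg : IsSphereDiffeo g g') (hD : D.IsPositive) :
    D'.IsPositive := by
  intro i' s' j' t' hc hlt
  obtain ⟨i, s, rfl, rfl⟩ := h.exists_preimage i' s'
  obtain ⟨j, t, rfl, rfl⟩ := h.exists_preimage j' t'
  have hc' := (h.isCrossing_iff hg.injective).1 hc
  have h0 : 0 < det3 (D.shadow i s) (deriv (D.shadow i) s) (deriv (D.shadow j) t) :=
    hD i s j t hc' ((h.order _ _ _ _ hc'.symm).2 hlt)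
  have hne := D.shadow_ne_zero i s
  have h1 := det3_map (fderiv ℝ g (D.shadow i s)) (D.shadow i s) (deriv (D.shadow i) s)
    (deriv (D.shadow j) t)
  rw [hg.fderiv_self hne, ← h.deriv_shadow hg, hc'.1, ← h.deriv_shadow hg, det3_smul, ← hc'.1,
    ← h.shadow_eq] at h1
  have h2 := mul_pos (hg.det_pos _ hne) h0
  rw [← h1] at h2
  exact pos_of_mul_pos_right h2 (mul_pos ((h.reparam i).deriv_pos s) ((h.reparam j).deriv_pos t)).le

end IsTransport

variable (D : LinkDiagram) {g g' : E3 → E3} {φ : D.ι → ℝ → ℝ}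

theorem isDiagramData_map (hg : IsSphereDiffeo g g') (hφ : ∀ i, IsCircleReparam (φ i)) :
    IsDiagramData (fun i t => g (D.shadow i (φ i t))) fun i t => D.slope i (φ i t) := by
  have hc : ∀ i s j t, g (D.shadow i (φ i s)) = g (D.shadow j (φ j t)) → ¬ SamePoint i s j t →
      D.IsCrossing i (φ i s) j (φ j t) := fun i s j t h h' =>
    ⟨hg.injective h, by rwa [IsCircleReparam.samePoint_iff hφ]⟩
  have hder : ∀ i t, HasDerivAt (fun t => g (D.shadow i (φ i t)))
      (fderiv ℝ g (D.shadow i (φ i t)) (deriv (φ i) t • deriv (D.shadow i) (φ i t))) t := by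
    intro i t
    have h1 : HasDerivAt (fun t => D.shadow i (φ i t)) _ t :=
      (D.hasDerivAt_shadow i (φ i t)).scomp t ((hφ i).hasDerivAt t)
    exact hg.hasDerivAt_comp h1 (D.shadow_ne_zero _ _)
  constructor
  · intro i t
    rw [hg.norm_map, norm_shadow]
  · intro i
    exact hg.smooth.comp_contDiff ((D.smooth_shadow i).comp (hφ i).smooth)
      fun t => D.shadow_ne_zero i (φ i t)
  · exact fun i => (D.smooth_slope i).comp (hφ i).smooth
  · intro i t
    simp only [(hφ i).equivariant, D.periodic_shadow i _]
  · intro i t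
    simp only [(hφ i).equivariant, D.periodic_slope i _]
  · intro i t h
    rw [(hder i t).deriv] at h
    have := hg.fderiv_injective (D.shadow_ne_zero _ _) h
    exact (smul_ne_zero ((hφ i).deriv_pos t).ne' (D.regular.immersion _ _)) this
  · intro i s j t h h'
    have hcr := hc i s j t h h'
    have h3 := D.regular.transverse _ _ _ _ hcr
    rw [LinearIndependent.pair_iff] at h3 ⊢
    intro a b hab
    rw [(hder i s).deriv, (hder j t).deriv, ← hcr.1, ← map_smul, ← map_smul, ← map_add,
      smul_smul, smul_smul] at hab
    have h4 := h3 _ _ (hg.fderiv_injective (D.shadow_ne_zero _ _) hab)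
    exact ⟨(mul_eq_zero.1 h4.1).resolve_right ((hφ i).deriv_pos s).ne',
      (mul_eq_zero.1 h4.2).resolve_right ((hφ j).deriv_pos t).ne'⟩
  · intro i s j t k r h1 h2 h3 h4
    exact (IsCircleReparam.samePoint_iff hφ).1
      (D.regular.no_triple _ _ _ _ _ _ (hc _ _ _ _ h1 h2) (hc _ _ _ _ h3 h4))
  · intro i s j t h1 h2
    have hcr := hc _ _ _ _ h1 h2
    exact D.isDiagramData.height_ne _ _ _ _ hcr.1 hcr.2

/-- The image of a diagram under a diffeomorphism of `S²`, reparametrized. -/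
@[reducible] noncomputable def map (hg : IsSphereDiffeo g g') (hφ : ∀ i, IsCircleReparam (φ i)) : LinkDiagram :=
  @ofData _ D.finite _ _ (D.isDiagramData_map hg hφ)

section map

variable {D} (hg : IsSphereDiffeo g g') (hφ : ∀ i, IsCircleReparam (φ i))

theorem shadow_map (i : D.ι) (t : ℝ) : (D.map hg hφ).shadow i t = g (D.shadow i (φ i t)) :=
  haveI := D.finite
  shadow_ofData _ i t

theorem height_map_lt (i : D.ι) (s : ℝ) (j : D.ι) (t : ℝ) :
    (D.map hg hφ).height i s < (D.map hg hφ).height j t ↔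
      D.height i (φ i s) < D.height j (φ j t) :=
  haveI := D.finite
  (height_ofData_lt _ i s j t).trans D.slope_lt_iff

theorem isCrossing_map (i : D.ι) (s : ℝ) (j : D.ι) (t : ℝ) :
    (D.map hg hφ).IsCrossing i s j t ↔ D.IsCrossing i (φ i s) j (φ j t) := by
  unfold OrientedLink.IsCrossing
  rw [shadow_map, shadow_map, hg.injective.eq_iff, IsCircleReparam.samePoint_iff hφ]

theorem isTransport_map {ψ : D.ι → ℝ → ℝ} (hψ : ∀ i, IsCircleReparam (ψ i))
    (hinv : ∀ i t, φ i (ψ i t) = t) :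
    IsTransport D (D.map hg hφ) g (Equiv.refl D.ι) ψ where
  reparam := hψ
  shadow_eq i t := by
    rw [Equiv.refl_apply, shadow_map, hinv]
  order i s j t _ := by
    rw [Equiv.refl_apply, Equiv.refl_apply, height_map_lt, hinv, hinv]

end map

/-- Moving a diagram by `g` does not change the isotopy class of the link. -/
def PreservesIsotopy (g : E3 → E3) : Prop :=
  ∀ (K K' : LinkDiagram) (e : K.ι ≃ K'.ι), IsTransport K K' g e (fun _ t => t) →
    K.Isotopic K'.toOrientedLink

/-- A reparametrization of a link is joined to the identity by convex combinations. -/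
theorem isotopic_reparam {K K' : LinkDiagram} (e : K.ι ≃ K'.ι) (φ : K.ι → ℝ → ℝ)
    (hφ : ∀ i, IsCircleReparam (φ i)) (h : ∀ i t, K'.shadow (e i) t = K.shadow i (φ i t))
    (h' : ∀ i t, K'.slope (e i) t = K.slope i (φ i t)) : K.Isotopic K'.toOrientedLink := by
  have hψ : ∀ s ∈ Set.Icc (0 : ℝ) 1, ∀ i, IsCircleReparam fun t => (1 - s) * t + s * φ i t := by
    intro s hs i
    refine ⟨?_, fun t => ?_, fun t => ?_⟩
    · exact (contDiff_const.mul contDiff_id).add (contDiff_const.mul (hφ i).smooth)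
    · have : HasDerivAt (fun t => (1 - s) * t + s * φ i t) ((1 - s) * 1 + s * deriv (φ i) t) t :=
        ((hasDerivAt_id t).const_mul _).add (((hφ i).hasDerivAt t).const_mul _)
      rw [this.deriv]
      have h1 := (hφ i).deriv_pos t
      rcases hs.1.eq_or_lt with rfl | h0
      · norm_num
      · nlinarith [hs.2, mul_pos h0 h1]
    · simp only [(hφ i).equivariant]
      ring
  have hsm : ∀ i, ContDiff ℝ ∞ fun q : ℝ × ℝ => (1 - q.1) * q.2 + q.1 * φ i q.2 := fun i =>
    ((contDiff_const.sub contDiff_fst).mul contDiff_snd).add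
      (contDiff_fst.mul ((hφ i).smooth.comp contDiff_snd))
  refine isotopic_of_family e (fun i s t => K.shadow i ((1 - s) * t + s * φ i t))
    (fun i s t => K.slope i ((1 - s) * t + s * φ i t)) (fun i => (K.smooth_shadow i).comp (hsm i))
    (fun i => (K.smooth_slope i).comp (hsm i)) ?_ ?_ ?_ ?_ ?_ ?_ ?_ ?_ ?_
  · intro s _ i t
    exact K.norm_shadow _ _
  · intro s hs i t
    simp only [(hψ s hs i).equivariant, K.periodic_shadow i _]
  · intro s hs i t
    simp only [(hψ s hs i).equivariant, K.periodic_slope i _]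
  · intro s hs i t
    have := ((K.hasDerivAt_shadow i _).scomp t ((hψ s hs i).hasDerivAt t)).deriv
    exact this ▸ smul_ne_zero ((hψ s hs i).deriv_pos t).ne' (K.regular.immersion _ _)
  · intro s hs i t j t' h1 h2
    exact (IsCircleReparam.samePoint_iff (hψ s hs)).1 (K.samePoint_of_shadow_of_slope h1 h2)
  all_goals
    intro i t
    simp [h, h']

/-- A transport of diagrams gives an isotopy of links. -/
theorem IsTransport.isotopic {D D' : LinkDiagram} {e : D.ι ≃ D'.ι} {φ : D.ι → ℝ → ℝ}
    (h : IsTransport D D' g e φ) (hg : PreservesIsotopy g) : D.Isotopic D'.toOrientedLink := by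
  have hφ : ∀ i, IsCircleReparam ((fun i' => φ (e.symm i')) i) := fun i => h.reparam _
  -- The reparametrization and the diffeomorphism are realized one after the other.
  let E : LinkDiagram := D'.map IsSphereDiffeo.id hφ
  have h1 : ∀ i t, E.shadow (e i) t = D'.shadow (e i) (φ i t) := by
    intro i t
    have := shadow_map (D := D') IsSphereDiffeo.id hφ (e i) t
    simpa only [e.symm_apply_apply] using this
  have h2 : ∀ i s j t, E.height (e i) s < E.height (e j) t ↔
      D'.height (e i) (φ i s) < D'.height (e j) (φ j t) := by
    intro i s j t
    have := height_map_lt (D := D') IsSphereDiffeo.id hφ (e i) s (e j) t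
    simpa only [e.symm_apply_apply] using this
  have h3 : D.Isotopic E.toOrientedLink := hg D E e
    ⟨fun _ => IsCircleReparam.id, fun i t => by rw [h1, h.shadow_eq], fun i s j t hc => by
      rw [h2, h.order i s j t hc]⟩
  refine h3.trans (OrientedLink.Isotopic.symm ?_)
  refine isotopic_reparam (Equiv.refl _) _ hφ (fun i t => ?_) fun i t => ?_
  · exact shadow_map (D := D') IsSphereDiffeo.id hφ i t
  · have : ∀ i t, Real.sin (Real.arctan (E.slope i t))
        = Real.sin (Real.arctan (D'.slope i (φ (e.symm i) t))) := fun i t =>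
      (congrArg Prod.snd (E.curve_eq i t)).symm
    exact sin_arctan_strictMono.injective (this i t)

theorem PreservesIsotopy.symm (hg : IsSphereDiffeo g g') (h : PreservesIsotopy g) :
    PreservesIsotopy g' := by
  intro K K' e ht
  refine OrientedLink.Isotopic.symm (h K' K e.symm ⟨fun _ => IsCircleReparam.id, fun i t => ?_,
    fun i s j t hc => ?_⟩)
  · have := ht.shadow_eq (e.symm i) t
    rw [e.apply_symm_apply] at this
    rw [this, hg.right_inv]
  · have := ht.order (e.symm i) s (e.symm j) t
    rw [← ht.isCrossing_iff hg.symm.injective, e.apply_symm_apply, e.apply_symm_apply] at this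
    exact (this hc).symm

theorem PreservesIsotopy.comp {k k' : E3 → E3} (hk : IsSphereDiffeo k k')
    (h : PreservesIsotopy g) (h' : PreservesIsotopy k) : PreservesIsotopy fun x => g (k x) := by
  intro K K' e ht
  have hid : ∀ i : K.ι, IsCircleReparam ((fun _ t => t : K.ι → ℝ → ℝ) i) :=
    fun _ => IsCircleReparam.id
  have h1 : IsTransport K (K.map hk hid) k (Equiv.refl _) (fun _ t => t) :=
    isTransport_map hk hid hid fun _ _ => rfl
  refine (h' K (K.map hk hid) (Equiv.refl _) h1).trans ?_
  refine h (K.map hk hid) K' e ⟨hid, fun i t => ?_, fun i s j t hc => ?_⟩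
  · rw [ht.shadow_eq]
    exact congrArg g (shadow_map hk hid i t).symm
  · exact (height_map_lt hk hid i s j t).trans (ht.order i s j t ((isCrossing_map hk hid i s j t).1 hc))

theorem convex_comb_lt {s a b c d : ℝ} (hs : s ∈ Set.Icc (0 : ℝ) 1) (h : a < c) (h' : b < d) :
    (1 - s) * a + s * b < (1 - s) * c + s * d := by
  rcases hs.1.eq_or_lt with rfl | h0
  · linarith
  · have := mul_lt_mul_of_pos_left h' h0
    have := mul_le_mul_of_nonneg_left h.le (sub_nonneg.2 hs.2)
    linarith

/-- Heights can be changed as long as the order of the strands at each crossing is kept. -/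
theorem PreservesIsotopy.id : PreservesIsotopy fun x => x := by
  intro K K' e h
  refine isotopic_of_family e (fun i _ t => K.shadow i t)
    (fun i s t => (1 - s) * K.slope i t + s * K'.slope (e i) t)
    (fun i => (K.smooth_shadow i).comp contDiff_snd) (fun i => ?_)
    (fun _ _ => K.norm_shadow) (fun _ _ => K.periodic_shadow) ?_ (fun _ _ => K.regular.immersion)
    ?_ (fun _ _ => rfl) ?_ (fun i t => (h.shadow_eq i t).symm) ?_
  · exact ((contDiff_const.sub contDiff_fst).mul ((K.smooth_slope i).comp contDiff_snd)).add
      (contDiff_fst.mul ((K'.smooth_slope _).comp contDiff_snd))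
  · intro s _ i t
    simp only [K.periodic_slope i t, K'.periodic_slope _ t]
  · intro s hs i t j t' h1 h2
    by_contra hne
    have hc : K.IsCrossing i t j t' := ⟨h1, hne⟩
    rcases hc.height_ne.lt_or_gt with hlt | hlt
    · have ha := K.slope_lt_iff.2 hlt
      have hb := K'.slope_lt_iff.2 ((h.order _ _ _ _ hc).1 hlt)
      exact (convex_comb_lt hs ha hb).ne h2
    · have ha := K.slope_lt_iff.2 hlt
      have hb := K'.slope_lt_iff.2 ((h.order _ _ _ _ hc.symm).1 hlt)
      exact (convex_comb_lt hs ha hb).ne h2.symm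
  · intro i t
    simp
  · intro i t
    simp

end LinkDiagram

/-! ### Isotopies of the sphere -/

/-- The positively homogeneous map that agrees with `f` on the unit sphere. -/
noncomputable def radialExtension (f : E3 → E3) (x : E3) : E3 := ‖x‖ • f (‖x‖⁻¹ • x)

theorem radialExtension_of_norm_eq_one (f : E3 → E3) {p : E3} (hp : ‖p‖ = 1) :
    radialExtension f p = f p := by
  simp [radialExtension, hp]

theorem radialExtension_smul (f : E3 → E3) {r : ℝ} (hr : 0 < r) (x : E3) :
    radialExtension f (r • x) = r • radialExtension f x := by
  simp only [radialExtension, norm_smul, Real.norm_of_nonneg hr.le, smul_smul, mul_inv]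
  congr 3
  field_simp

theorem norm_inv_smul_self {x : E3} (hx : x ≠ 0) : ‖‖x‖⁻¹ • x‖ = 1 := by
  rw [norm_smul, norm_inv, norm_norm, inv_mul_cancel₀ (norm_ne_zero_iff.2 hx)]

theorem hasDerivAt_norm_line {x v : E3} (hx : x ≠ 0) (hv : inner ℝ x v = 0) :
    HasDerivAt (fun r : ℝ => ‖x + r • v‖) 0 0 := by
  have h1 : HasDerivAt (fun r : ℝ => x + r • v) v 0 := by
    simpa using ((hasDerivAt_id (0 : ℝ)).smul_const v).const_add x
  have h2 := h1.norm_sq.sqrt (by simpa using hx)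
  simp only [Real.sqrt_sq (norm_nonneg _), zero_smul, add_zero, hv] at h2
  simpa using h2

namespace IsSphereIsotopy

variable {Φ : ℝ → E3 → E3}

theorem contDiffOn_radialExtension (h : IsSphereIsotopy Φ) :
    ContDiffOn ℝ ∞ (fun q : ℝ × E3 => radialExtension (Φ q.1) q.2) {q | q.2 ≠ 0} := by
  have hn : ContDiffOn ℝ ∞ (fun q : ℝ × E3 => ‖q.2‖) {q | q.2 ≠ 0} :=
    contDiffOn_snd.norm ℝ fun q hq => hq
  have h1 : ContDiffOn ℝ ∞ (fun q : ℝ × E3 => ‖q.2‖⁻¹ • q.2) {q | q.2 ≠ 0} :=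
    (hn.inv fun q hq => norm_ne_zero_iff.2 hq).smul contDiffOn_snd
  refine hn.smul (h.smooth.comp (contDiffOn_fst.prodMk h1) fun q hq => ?_)
  exact smul_ne_zero (inv_ne_zero (norm_ne_zero_iff.2 hq)) hq

theorem contDiffAt_radialExtension (h : IsSphereIsotopy Φ) (s : ℝ) {x : E3} (hx : x ≠ 0) :
    ContDiffAt ℝ ∞ (radialExtension (Φ s)) x := by
  have : IsOpen {q : ℝ × E3 | q.2 ≠ 0} := isOpen_compl_singleton.preimage continuous_snd
  exact (h.contDiffOn_radialExtension.contDiffAt (this.mem_nhds (x := (s, x)) hx)).comp x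
    (f := fun x : E3 => ((s, x) : ℝ × E3)) (by fun_prop)

theorem norm_map (h : IsSphereIsotopy Φ) {s : ℝ} (hs : s ∈ Set.Icc (0 : ℝ) 1) {p : E3}
    (hp : ‖p‖ = 1) : ‖Φ s p‖ = 1 := by
  simpa using (h.bijOn s hs).mapsTo (x := p) (by simpa using hp)

theorem norm_radialExtension (h : IsSphereIsotopy Φ) {s : ℝ} (hs : s ∈ Set.Icc (0 : ℝ) 1)
    (x : E3) :
    ‖radialExtension (Φ s) x‖ = ‖x‖ := by
  rcases eq_or_ne x 0 with rfl | hx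
  · simp [radialExtension]
  · rw [radialExtension, norm_smul, norm_norm, h.norm_map hs (norm_inv_smul_self hx), mul_one]

theorem injective_radialExtension (h : IsSphereIsotopy Φ) {s : ℝ} (hs : s ∈ Set.Icc (0 : ℝ) 1) :
    Function.Injective (radialExtension (Φ s)) := by
  intro x y hxy
  have hn : ‖x‖ = ‖y‖ := by
    rw [← h.norm_radialExtension hs x, hxy, h.norm_radialExtension hs]
  rcases eq_or_ne x 0 with rfl | hx
  · rw [norm_zero] at hn
    exact (norm_eq_zero.1 hn.symm).symm
  · have hy : y ≠ 0 := by rwa [← norm_ne_zero_iff, ← hn, norm_ne_zero_iff]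
    have hx' := norm_ne_zero_iff.2 hx
    simp only [radialExtension, ← hn] at hxy
    have h1 := smul_right_injective E3 hx' hxy
    have h2 := (h.bijOn s hs).injOn (by simpa using norm_inv_smul_self hx)
      (by simpa [hn] using norm_inv_smul_self hy) h1
    exact smul_right_injective E3 (inv_ne_zero hx') h2

theorem surjective_radialExtension (h : IsSphereIsotopy Φ) {s : ℝ} (hs : s ∈ Set.Icc (0 : ℝ) 1) :
    Function.Surjective (radialExtension (Φ s)) := by
  intro y
  rcases eq_or_ne y 0 with rfl | hy
  · exact ⟨0, by simp [radialExtension]⟩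
  · obtain ⟨p, hp, hpy⟩ := (h.bijOn s hs).surjOn (show ‖y‖⁻¹ • y ∈ Metric.sphere (0 : E3) 1 by
      simpa using norm_inv_smul_self hy)
    have hp : ‖p‖ = 1 := by simpa using hp
    refine ⟨‖y‖ • p, ?_⟩
    rw [radialExtension_smul _ (norm_pos_iff.2 hy), radialExtension_of_norm_eq_one _ hp, hpy,
      smul_smul, mul_inv_cancel₀ (norm_ne_zero_iff.2 hy), one_smul]

theorem fderiv_radialExtension_injective (h : IsSphereIsotopy Φ) {s : ℝ}
    (hs : s ∈ Set.Icc (0 : ℝ) 1) {x : E3} (hx : x ≠ 0) {v : E3}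
    (hv : fderiv ℝ (radialExtension (Φ s)) x v = 0) : v = 0 := by
  have hd : HasFDerivAt (radialExtension (Φ s)) (fderiv ℝ (radialExtension (Φ s)) x) x :=
    ((h.contDiffAt_radialExtension s hx).differentiableAt (by simp)).hasFDerivAt
  have hline : HasDerivAt (fun r : ℝ => x + r • v) v 0 := by
    simpa using ((hasDerivAt_id (0 : ℝ)).smul_const v).const_add x
  have hd0 : HasFDerivAt (radialExtension (Φ s)) (fderiv ℝ (radialExtension (Φ s)) x)
      (x + (0 : ℝ) • v) := by simpa using hd
  have h1 : HasDerivAt (fun r : ℝ => radialExtension (Φ s) (x + r • v)) 0 0 := by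
    have := hd0.comp_hasDerivAt (0 : ℝ) hline
    rwa [hv] at this
  -- Since norms are preserved, `v` is tangent to the sphere through `x`.
  have hxv : inner ℝ x v = 0 := by
    have h2 := h1.norm_sq
    simp only [h.norm_radialExtension hs, inner_zero_right, mul_zero] at h2
    have h3 := hline.norm_sq.unique h2
    simpa using h3
  have hn := hasDerivAt_norm_line hx hxv
  have hx' : ‖x‖ ≠ 0 := norm_ne_zero_iff.2 hx
  have hin : HasDerivAt (fun r : ℝ => ‖x + r • v‖⁻¹) 0 0 := by
    simpa using hn.fun_inv (by simpa using hx)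
  have h3 : HasDerivAt (fun r : ℝ => ‖x + r • v‖⁻¹ • (x + r • v)) (‖x‖⁻¹ • v) 0 := by
    have := hin.fun_smul hline
    simpa only [zero_smul, add_zero, zero_mul] using this
  have hΦ : HasFDerivAt (Φ s) (fderiv ℝ (Φ s) (‖x‖⁻¹ • x)) (‖x + (0 : ℝ) • v‖⁻¹ • (x + (0 : ℝ) • v)) := by
    have h4 : ‖x‖⁻¹ • x ≠ 0 := smul_ne_zero (inv_ne_zero hx') hx
    have : IsOpen {q : ℝ × E3 | q.2 ≠ 0} := isOpen_compl_singleton.preimage continuous_snd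
    have h5 : ContDiffAt ℝ ∞ (Φ s) (‖x‖⁻¹ • x) :=
      (h.smooth.contDiffAt (this.mem_nhds (x := (s, ‖x‖⁻¹ • x)) h4)).comp (‖x‖⁻¹ • x)
        (f := fun x : E3 => ((s, x) : ℝ × E3)) (by fun_prop)
    simpa using (h5.differentiableAt (by simp)).hasFDerivAt
  have h4 : HasDerivAt (fun r : ℝ => Φ s (‖x + r • v‖⁻¹ • (x + r • v)))
      (fderiv ℝ (Φ s) (‖x‖⁻¹ • x) (‖x‖⁻¹ • v)) 0 := hΦ.comp_hasDerivAt (0 : ℝ) h3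
  have h5 := hn.smul h4
  have h6 : ‖x‖ • fderiv ℝ (Φ s) (‖x‖⁻¹ • x) (‖x‖⁻¹ • v) = 0 := by
    have := h5.unique h1
    simpa using this
  by_contra hv0
  refine h.immersion s hs (‖x‖⁻¹ • x) (by simpa using norm_inv_smul_self hx) (‖x‖⁻¹ • v) ?_
    (smul_ne_zero (inv_ne_zero hx') hv0) ((smul_eq_zero.1 h6).resolve_left hx')
  rw [inner_smul_left, inner_smul_right, hxv]
  simp

theorem det_ne_zero (h : IsSphereIsotopy Φ) {s : ℝ} (hs : s ∈ Set.Icc (0 : ℝ) 1) {x : E3}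
    (hx : x ≠ 0) :
    (fderiv ℝ (radialExtension (Φ s)) x).det ≠ 0 := by
  intro h0
  obtain ⟨v, hv, hv0⟩ := Submodule.exists_mem_ne_zero_of_ne_bot
    (LinearMap.bot_lt_ker_of_det_eq_zero h0).ne'
  exact hv0 (h.fderiv_radialExtension_injective hs hx hv)

/-- The determinant is positive at the beginning of the isotopy and never vanishes. -/
theorem det_pos (h : IsSphereIsotopy Φ) {x : E3} (hx : x ≠ 0) :
    0 < (fderiv ℝ (radialExtension (Φ 1)) x).det := by
  have hopen : IsOpen {q : ℝ × E3 | q.2 ≠ 0} := isOpen_compl_singleton.preimage continuous_snd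
  have hc : Continuous fun s : ℝ => (fderiv ℝ (radialExtension (Φ s)) x).det := by
    have h1 : ∀ s : ℝ, fderiv ℝ (radialExtension (Φ s)) x =
        (fderiv ℝ (fun q : ℝ × E3 => radialExtension (Φ q.1) q.2) (s, x)).comp
          (ContinuousLinearMap.inr ℝ ℝ E3) := by
      intro s
      have h2 := ((h.contDiffOn_radialExtension.contDiffAt (hopen.mem_nhds (x := (s, x)) hx)
        ).differentiableAt (by simp)).hasFDerivAt
      exact (h2.comp x (hasFDerivAt_prodMk_right s x)).fderiv
    have h2 : Continuous fun s : ℝ =>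
        fderiv ℝ (fun q : ℝ × E3 => radialExtension (Φ q.1) q.2) (s, x) :=
      (h.contDiffOn_radialExtension.continuousOn_fderiv_of_isOpen hopen (by simp)).comp_continuous
        (by fun_prop) fun s => hx
    simp only [h1]
    exact ContinuousLinearMap.continuous_det.comp (h2.clm_comp continuous_const)
  have h0 : (fderiv ℝ (radialExtension (Φ 0)) x).det = 1 := by
    have : radialExtension (Φ 0) =ᶠ[nhds x] fun x => x := by
      filter_upwards [isOpen_compl_singleton.mem_nhds hx] with y hy
      rw [radialExtension, h.start _ (by simpa using norm_inv_smul_self hy), smul_smul,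
        mul_inv_cancel₀ (norm_ne_zero_iff.2 hy), one_smul]
    rw [this.fderiv_eq, fderiv_fun_id]
    simp [ContinuousLinearMap.det]
  by_contra hneg
  obtain ⟨s, hs, hs0⟩ := intermediate_value_Icc' zero_le_one hc.continuousOn
    ⟨not_lt.1 hneg, h0.symm ▸ zero_le_one⟩
  exact h.det_ne_zero hs hx hs0

/-- The final map of an isotopy of `S²` is a diffeomorphism that does not change isotopy classes of
links. -/
theorem exists_isSphereDiffeo (h : IsSphereIsotopy Φ) : ∃ g g' : E3 → E3, IsSphereDiffeo g g' ∧
    LinkDiagram.PreservesIsotopy g ∧ ∀ p, ‖p‖ = 1 → g p = Φ 1 p := by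
  have h1 : (1 : ℝ) ∈ Set.Icc (0 : ℝ) 1 := by simp
  obtain ⟨g', hg'⟩ := (h.surjective_radialExtension h1).hasRightInverse
  have hl : ∀ x, g' (radialExtension (Φ 1) x) = x := fun x =>
    h.injective_radialExtension h1 (hg' _)
  have hn : ∀ x, ‖g' x‖ = ‖x‖ := fun x => by rw [← h.norm_radialExtension h1, hg']
  refine ⟨radialExtension (Φ 1), g', ⟨?_, ?_, h.norm_radialExtension h1, hn,
    fun r hr x => radialExtension_smul _ hr x, hl, hg', fun x hx => h.det_pos hx⟩, ?_,
    fun p hp => radialExtension_of_norm_eq_one _ hp⟩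
  · exact fun x hx => (h.contDiffAt_radialExtension 1 hx).contDiffWithinAt
  · intro y hy
    have hx : g' y ≠ 0 := by rwa [← norm_ne_zero_iff, hn, norm_ne_zero_iff]
    have hc := h.contDiffAt_radialExtension 1 hx
    have hker : (fderiv ℝ (radialExtension (Φ 1)) (g' y) : E3 →ₗ[ℝ] E3).ker = ⊥ :=
      (Submodule.eq_bot_iff _).2 fun v hv => h.fderiv_radialExtension_injective h1 hx hv
    let L : E3 ≃L[ℝ] E3 := (LinearEquiv.ofInjectiveEndo
      (fderiv ℝ (radialExtension (Φ 1)) (g' y) : E3 →ₗ[ℝ] E3)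
      (LinearMap.ker_eq_bot.1 hker)).toContinuousLinearEquiv
    have hL : HasFDerivAt (radialExtension (Φ 1)) (L : E3 →L[ℝ] E3) (g' y) :=
      (hc.differentiableAt (by simp)).hasFDerivAt
    have h2 := hc.to_localInverse hL (by simp)
    rw [hg'] at h2
    refine (h2.congr_of_eventuallyEq ?_).contDiffWithinAt
    have h3 := (hc.hasStrictFDerivAt' hL (by simp)).eventually_right_inverse
    rw [hg'] at h3
    filter_upwards [h3] with z hz
    refine h.injective_radialExtension h1 ?_
    rw [hg']
    exact hz.symm
  -- The link follows the isotopy, while its heights are changed by convex combinations. These keep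
  -- the order of the strands at each crossing.
  · intro K K' e ht
    refine LinkDiagram.isotopic_of_family e (fun i s t => Φ s (K.shadow i t))
      (fun i s t => (1 - s) * K.slope i t + s * K'.slope (e i) t) (fun i => ?_) (fun i => ?_)
      (fun s hs i t => h.norm_map hs (K.norm_shadow i t)) ?_ ?_ ?_ ?_ ?_ ?_ ?_ ?_
    · exact h.smooth.comp_contDiff (contDiff_fst.prodMk ((K.smooth_shadow i).comp contDiff_snd))
        fun q => K.shadow_ne_zero i q.2
    · exact ((contDiff_const.sub contDiff_fst).mul ((K.smooth_slope i).comp contDiff_snd)).add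
        (contDiff_fst.mul ((K'.smooth_slope _).comp contDiff_snd))
    · intro s _ i t
      simp only [K.periodic_shadow i t]
    · intro s _ i t
      simp only [K.periodic_slope i t, K'.periodic_slope _ t]
    · intro s hs i t
      have hopen : IsOpen {q : ℝ × E3 | q.2 ≠ 0} := isOpen_compl_singleton.preimage continuous_snd
      have h5 : ContDiffAt ℝ ∞ (Φ s) (K.shadow i t) :=
        (h.smooth.contDiffAt (hopen.mem_nhds (x := (s, K.shadow i t)) (K.shadow_ne_zero i t))).comp
          (K.shadow i t) (f := fun x : E3 => ((s, x) : ℝ × E3)) (by fun_prop)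
      have h6 := (h5.differentiableAt (by simp)).hasFDerivAt.comp_hasDerivAt t
        (K.hasDerivAt_shadow i t)
      have h7 : deriv (fun t => Φ s (K.shadow i t)) t = _ := h6.deriv
      rw [h7]
      refine h.immersion s hs _ (by simp [K.norm_shadow]) _ ?_ (K.regular.immersion i t)
      have h8 := (K.hasDerivAt_shadow i t).norm_sq
      simp only [K.norm_shadow] at h8
      have := h8.unique (hasDerivAt_const t _)
      simpa using this
    · intro s hs i t j t' h2 h3
      by_contra hne
      have hc : K.IsCrossing i t j t' := ⟨(h.bijOn s hs).injOn (by simp [K.norm_shadow])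
        (by simp [K.norm_shadow]) h2, hne⟩
      rcases hc.height_ne.lt_or_gt with hlt | hlt
      · have ha := K.slope_lt_iff.2 hlt
        have hb := K'.slope_lt_iff.2 ((ht.order _ _ _ _ hc).1 hlt)
        exact (LinkDiagram.convex_comb_lt hs ha hb).ne h3
      · have ha := K.slope_lt_iff.2 hlt
        have hb := K'.slope_lt_iff.2 ((ht.order _ _ _ _ hc.symm).1 hlt)
        exact (LinkDiagram.convex_comb_lt hs ha hb).ne h3.symm
    · intro i t
      exact h.start _ (by simp [K.norm_shadow])
    · intro i t
      simp
    · intro i t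
      have := ht.shadow_eq i t
      rw [radialExtension_of_norm_eq_one _ (K.norm_shadow i t)] at this
      exact this.symm
    · intro i t
      simp

end IsSphereIsotopy

/-! ### Rotations about a great circle -/

/-- The reflection `y ↦ -y` of `ℝ³`. -/
noncomputable def reflY : E3 →L[ℝ] E3 :=
  LinearMap.toContinuousLinearMap
    { toFun := fun x => !₂[x 0, -x 1, x 2]
      map_add' := fun x y => by
        ext i
        fin_cases i
        · rfl
        · simp [add_comm]
        · rfl
      map_smul' := fun r x => by
        ext i
        fin_cases i <;> simp }

theorem reflY_apply (x : E3) : reflY x = !₂[x 0, -x 1, x 2] := rfl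

@[simp] theorem reflY_zero (x : E3) : reflY x 0 = x 0 := rfl
@[simp] theorem reflY_one (x : E3) : reflY x 1 = -x 1 := rfl
@[simp] theorem reflY_two (x : E3) : reflY x 2 = x 2 := rfl

@[simp] theorem reflY_reflY (x : E3) : reflY (reflY x) = x := by
  ext i
  fin_cases i <;> simp

theorem reflY_injective : Function.Injective reflY :=
  Function.LeftInverse.injective reflY_reflY

theorem norm_sq_E3 (x : E3) : ‖x‖ ^ 2 = x 0 ^ 2 + x 1 ^ 2 + x 2 ^ 2 := by
  simp [EuclideanSpace.norm_sq_eq, Fin.sum_univ_three]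

@[simp] theorem norm_reflY (x : E3) : ‖reflY x‖ = ‖x‖ := by
  rw [← sq_eq_sq₀ (norm_nonneg _) (norm_nonneg _), norm_sq_E3, norm_sq_E3]
  simp

theorem reflY_eq_self_iff {x : E3} : reflY x = x ↔ x 1 = 0 := by
  constructor
  · intro h
    have : reflY x 1 = x 1 := by rw [h]
    rw [reflY_one] at this
    linarith
  · intro h
    ext i
    fin_cases i
    · rfl
    · simp [h]
    · rfl

theorem det3_reflY (p u v : E3) : det3 (reflY p) (reflY u) (reflY v) = - det3 p u v := by
  simp only [det3, Matrix.det_fin_three, Matrix.of_apply, Matrix.cons_val, reflY_zero, reflY_one,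
    reflY_two]
  ring

/-- The rotation of `ℝ³ × ℝ` by the angle `θ` in the plane of the coordinates `y` and `w`. It fixes
the great circle `y = w = 0` of `S³`. -/
noncomputable def turn (θ : ℝ) : E3 × ℝ →L[ℝ] E3 × ℝ :=
  LinearMap.toContinuousLinearMap
    { toFun := fun q => (!₂[q.1 0, Real.cos θ * q.1 1 - Real.sin θ * q.2, q.1 2],
        Real.sin θ * q.1 1 + Real.cos θ * q.2)
      map_add' := fun x y => by
        ext i
        · fin_cases i
          · rfl
          · simp
            ring
          · rfl
        · simp
          ring
      map_smul' := fun r x => by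
        ext i
        · fin_cases i
          · rfl
          · simp
            ring
          · rfl
        · simp
          ring }

theorem turn_apply (θ : ℝ) (q : E3 × ℝ) :
    turn θ q = (!₂[q.1 0, Real.cos θ * q.1 1 - Real.sin θ * q.2, q.1 2],
      Real.sin θ * q.1 1 + Real.cos θ * q.2) := rfl

theorem turn_neg_turn (θ : ℝ) (q : E3 × ℝ) : turn (-θ) (turn θ q) = q := by
  have h := Real.cos_sq_add_sin_sq θ
  ext i
  · fin_cases i
    · rfl
    · simp only [turn_apply, Real.cos_neg, Real.sin_neg, Fin.mk_one, Matrix.cons_val]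
      linear_combination q.1 1 * h
    · rfl
  · simp only [turn_apply, Real.cos_neg, Real.sin_neg, Matrix.cons_val]
    linear_combination q.2 * h

theorem turn_injective (θ : ℝ) : Function.Injective (turn θ) :=
  Function.LeftInverse.injective (turn_neg_turn θ)

theorem turn_mem {θ : ℝ} {q : E3 × ℝ} (hq : q ∈ S3) : turn θ q ∈ S3 := by
  have h := Real.cos_sq_add_sin_sq θ
  simp only [S3, Set.mem_ofPred_eq, norm_sq_E3] at hq ⊢
  simp only [turn_apply, PiLp.toLp_apply, Matrix.cons_val]
  linear_combination (q.1 1 ^ 2 + q.2 ^ 2) * h + hq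

theorem turn_zero (q : E3 × ℝ) : turn 0 q = q := by
  ext i
  · fin_cases i
    · rfl
    · simp [turn_apply]
    · rfl
  · simp [turn_apply]

theorem turn_eq_self {θ : ℝ} {q : E3 × ℝ} (h : q.1 1 = 0) (h' : q.2 = 0) : turn θ q = q := by
  ext i
  · fin_cases i
    · rfl
    · simp [turn_apply, h, h']
    · rfl
  · simp [turn_apply, h, h']

theorem turn_pi_spherePoint (p : E3) (a : ℝ) :
    turn Real.pi (spherePoint p a) = spherePoint (reflY p) (-a) := by
  ext i
  · fin_cases i
    · simp [turn_apply, spherePoint]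
    · simp [turn_apply, spherePoint]
    · simp [turn_apply, spherePoint]
  · simp [turn_apply, spherePoint]

theorem contDiff_turn {E : Type*} [NormedAddCommGroup E] [NormedSpace ℝ E] {θ : E → ℝ}
    {f : E → E3 × ℝ} (hθ : ContDiff ℝ ∞ θ) (hf : ContDiff ℝ ∞ f) :
    ContDiff ℝ ∞ fun x => turn (θ x) (f x) := by
  have h1 : ∀ k, ContDiff ℝ ∞ fun x => (f x).1 k := fun k =>
    contDiff_euclidean.1 (contDiff_fst.comp hf) k
  have h2 : ContDiff ℝ ∞ fun x => (f x).2 := contDiff_snd.comp hf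
  have hc := Real.contDiff_cos.comp hθ (n := ∞)
  have hs := Real.contDiff_sin.comp hθ (n := ∞)
  simp only [turn_apply]
  refine ContDiff.prodMk (contDiff_euclidean.2 fun k => ?_) ((hs.mul (h1 1)).add (hc.mul h2))
  fin_cases k
  · exact h1 0
  · exact (hc.mul (h1 1)).sub (hs.mul h2)
  · exact h1 2

namespace LinkDiagram

theorem isDiagramData_rot (D : LinkDiagram) :
    IsDiagramData (fun i t => reflY (D.shadow i t)) fun i t => -D.slope i t := by
  have hder : ∀ i t, deriv (fun t => reflY (D.shadow i t)) t = reflY (deriv (D.shadow i) t) :=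
    fun i t => (reflY.hasFDerivAt.comp_hasDerivAt t (D.hasDerivAt_shadow i t)).deriv
  have h0 := D.isDiagramData
  constructor
  · intro i t
    rw [norm_reflY, norm_shadow]
  · exact fun i => reflY.contDiff.comp (D.smooth_shadow i)
  · exact fun i => (D.smooth_slope i).neg
  · intro i t
    simp only [D.periodic_shadow i t]
  · intro i t
    simp only [D.periodic_slope i t]
  · intro i t h
    rw [hder, map_eq_zero_iff _ reflY_injective] at h
    exact D.regular.immersion i t h
  · intro i s j t h h'
    have := h0.transverse i s j t (reflY_injective h) h'
    rw [LinearIndependent.pair_iff] at this ⊢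
    intro a b hab
    rw [hder, hder, ← map_smul, ← map_smul, ← map_add, map_eq_zero_iff _ reflY_injective] at hab
    exact this a b hab
  · exact fun i s j t k r h1 h2 h3 h4 =>
      h0.no_triple i s j t k r (reflY_injective h1) h2 (reflY_injective h3) h4
  · exact fun i s j t h h' h'' => h0.height_ne i s j t (reflY_injective h) h' (neg_injective h'')

/-- The diagram of the link that is obtained by rotating by `π` about the great circle
`y = w = 0`: the diagram is reflected and all crossings are switched. -/
@[reducible] noncomputable def rot (D : LinkDiagram) : LinkDiagram :=
  @ofData _ D.finite _ _ D.isDiagramData_rot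

section rot

variable (D : LinkDiagram)

theorem shadow_rot (i : D.ι) (t : ℝ) : D.rot.shadow i t = reflY (D.shadow i t) :=
  haveI := D.finite
  shadow_ofData _ i t

theorem height_rot_lt (i : D.ι) (s : ℝ) (j : D.ι) (t : ℝ) :
    D.rot.height i s < D.rot.height j t ↔ D.height j t < D.height i s :=
  haveI := D.finite
  (height_ofData_lt _ i s j t).trans (neg_lt_neg_iff.trans D.slope_lt_iff)

theorem isCrossing_rot (i : D.ι) (s : ℝ) (j : D.ι) (t : ℝ) :
    D.rot.IsCrossing i s j t ↔ D.IsCrossing i s j t := by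
  unfold OrientedLink.IsCrossing
  rw [shadow_rot, shadow_rot, reflY_injective.eq_iff]

theorem isotopic_rot : D.Isotopic D.rot.toOrientedLink := by
  refine ⟨Equiv.refl _, fun i s t => turn (Real.pi * s) (D.curve i t), fun i => ?_, fun s _ => ?_,
    fun i t => ?_, fun i t => ?_⟩
  · exact contDiff_turn (contDiff_const.mul contDiff_fst) ((D.isLink.smooth i).comp contDiff_snd)
  · refine ⟨fun i t => turn_mem (D.isLink.mem_sphere i t),
      fun i => (turn _).contDiff.comp (D.isLink.smooth i), fun i t => ?_, fun i t h => ?_,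
      fun i s j t h => D.isLink.injective i s j t (turn_injective _ h)⟩
    · simp only [D.isLink.periodic i t]
    · have h1 := ((turn (Real.pi * s)).hasFDerivAt.comp_hasDerivAt t
        ((D.isLink.smooth i).differentiable (by simp) t).hasDerivAt).deriv
      have h2 : turn (Real.pi * s) (deriv (D.curve i) t) = 0 := h1.symm.trans h
      rw [map_eq_zero_iff _ (turn_injective _)] at h2
      exact D.isLink.immersion i t h2
  · simp only [mul_zero, turn_zero]
  · simp only [mul_one, D.curve_eq i t, turn_pi_spherePoint]
    rfl

/-- The reflection of the diagram and the exchange of its strands both change the sign of a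
crossing. -/
theorem isPositive_rot (h : D.IsPositive) : D.rot.IsPositive := by
  intro i s j t hc hlt
  have hder : ∀ i t, deriv (D.rot.shadow i) t = reflY (deriv (D.shadow i) t) := by
    intro i t
    have : D.rot.shadow i = fun t => reflY (D.shadow i t) := funext (D.shadow_rot i)
    rw [this]
    exact (reflY.hasFDerivAt.comp_hasDerivAt t (D.hasDerivAt_shadow i t)).deriv
  have hc := (D.isCrossing_rot i s j t).1 hc
  have h1 : 0 < det3 (D.shadow j t) (deriv (D.shadow j) t) (deriv (D.shadow i) s) :=
    h j t i s hc.symm ((D.height_rot_lt j t i s).1 hlt)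
  have h2 := det3_reflY (D.shadow i s) (deriv (D.shadow i) s) (deriv (D.shadow j) t)
  rw [← det3_swap, hc.1] at h2
  rw [← h2, ← hc.1, ← hder, ← hder, ← D.shadow_rot] at h1
  exact h1

end rot

/-! ### Diagrams up to diffeomorphism -/

/-- Two diagrams correspond to each other under a diffeomorphism of `S²` that does not change
isotopy classes of links. -/
def Equi (D D' : LinkDiagram) : Prop :=
  ∃ (g g' : E3 → E3) (e : D.ι ≃ D'.ι) (φ : D.ι → ℝ → ℝ),
    IsSphereDiffeo g g' ∧ PreservesIsotopy g ∧ IsTransport D D' g e φ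

theorem Equi.symm {D D' : LinkDiagram} (h : D.Equi D') : D'.Equi D := by
  obtain ⟨g, g', e, φ, hg, hi, ht⟩ := h
  obtain ⟨φ', ht'⟩ := ht.symm hg
  exact ⟨g', g, e.symm, φ', hg.symm, hi.symm hg, ht'⟩

theorem Equi.trans {D D' D'' : LinkDiagram} (h : D.Equi D') (h' : D'.Equi D'') : D.Equi D'' := by
  obtain ⟨g, g', e, φ, hg, hi, ht⟩ := h
  obtain ⟨k, k', e', φ', hk, hi', ht'⟩ := h'
  exact ⟨_, _, _, _, hk.comp hg, hi'.comp hg hi, ht.trans ht' hg.injective⟩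

theorem Equi.refl (D : LinkDiagram) : D.Equi D :=
  ⟨_, _, Equiv.refl _, fun _ t => t, IsSphereDiffeo.id, PreservesIsotopy.id,
    fun _ => IsCircleReparam.id, fun _ _ => rfl, fun _ _ _ _ _ => Iff.rfl⟩

theorem Equi.isotopic {D D' : LinkDiagram} (h : D.Equi D') : D.Isotopic D'.toOrientedLink := by
  obtain ⟨g, g', e, φ, hg, hi, ht⟩ := h
  exact ht.isotopic hi

theorem Equi.isPositive {D D' : LinkDiagram} (h : D.Equi D') (hD : D.IsPositive) :
    D'.IsPositive := by
  obtain ⟨g, g', e, φ, hg, hi, ht⟩ := h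
  exact ht.isPositive hg hD

theorem Equi.isAlternating {D D' : LinkDiagram} (h : D.Equi D') (hD : D.IsAlternating) :
    D'.IsAlternating := by
  obtain ⟨g, g', e, φ, hg, hi, ht⟩ := h
  exact ht.isAlternating hg.injective hD

theorem SameDiagram.equi {D D' : LinkDiagram} (h : D.SameDiagram D') : D.Equi D' := by
  obtain ⟨Φ, e, φ, hΦ, hφ, hs, ho⟩ := h
  obtain ⟨g, g', hg, hi, hgΦ⟩ := hΦ.exists_isSphereDiffeo
  refine ⟨g, g', e, φ, hg, hi, hφ, fun i t => ?_, ho⟩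
  rw [hs, hgΦ _ (D.norm_shadow i t)]

theorem equi_map (D : LinkDiagram) {g g' : E3 → E3} {φ : D.ι → ℝ → ℝ} (hg : IsSphereDiffeo g g')
    (hi : PreservesIsotopy g) (hφ : ∀ i, IsCircleReparam (φ i)) : D.Equi (D.map hg hφ) := by
  choose ψ h1 h2 h3 using fun i => (hφ i).exists_inverse
  exact ⟨g, g', Equiv.refl _, ψ, hg, hi, isTransport_map hg hφ h1 h3⟩

theorem _root_.IsSphereDiffeo.conj_reflY {g g' : E3 → E3} (hg : IsSphereDiffeo g g') :
    IsSphereDiffeo (fun x => reflY (g (reflY x))) fun x => reflY (g' (reflY x)) where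
  smooth := reflY.contDiff.comp_contDiffOn (hg.smooth.comp reflY.contDiff.contDiffOn
    fun x hx => (map_ne_zero_iff _ reflY_injective).2 hx)
  smooth_inv := reflY.contDiff.comp_contDiffOn (hg.smooth_inv.comp reflY.contDiff.contDiffOn
    fun x hx => (map_ne_zero_iff _ reflY_injective).2 hx)
  norm_map x := by rw [norm_reflY, hg.norm_map, norm_reflY]
  norm_inv x := by rw [norm_reflY, hg.norm_inv, norm_reflY]
  homog r hr x := by rw [map_smul, hg.homog r hr, map_smul]
  left_inv x := by rw [reflY_reflY, hg.left_inv, reflY_reflY]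
  right_inv x := by rw [reflY_reflY, hg.right_inv, reflY_reflY]
  det_pos x hx := by
    have hx' : reflY x ≠ 0 := (map_ne_zero_iff _ reflY_injective).2 hx
    have h1 : HasFDerivAt (fun x => reflY (g (reflY x))) _ x :=
      reflY.hasFDerivAt.comp x ((hg.hasFDerivAt hx').comp x reflY.hasFDerivAt)
    have h2 : reflY.comp ((fderiv ℝ g (reflY x)).comp reflY) = fderiv ℝ _ x := h1.fderiv.symm
    rw [← h2]
    have h3 : (reflY.comp ((fderiv ℝ g (reflY x)).comp reflY)).det
        = reflY.det * ((fderiv ℝ g (reflY x)).det * reflY.det) := by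
      rw [ContinuousLinearMap.det, ContinuousLinearMap.toLinearMap_comp, LinearMap.det_comp,
        ContinuousLinearMap.toLinearMap_comp, LinearMap.det_comp]
    have h4 : reflY.det * reflY.det = 1 := by
      have h5 : (reflY.comp reflY) = ContinuousLinearMap.id ℝ E3 := by
        ext1 x
        exact reflY_reflY x
      have h6 : (reflY.comp reflY).det = reflY.det * reflY.det := by
        rw [ContinuousLinearMap.det, ContinuousLinearMap.toLinearMap_comp, LinearMap.det_comp]
      rw [← h6, h5]
      simp [ContinuousLinearMap.det]
    rw [h3]
    have := hg.det_pos _ hx'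
    nlinarith

theorem IsTransport.rot {D D' : LinkDiagram} {g : E3 → E3} {e : D.ι ≃ D'.ι} {φ : D.ι → ℝ → ℝ}
    (h : IsTransport D D' g e φ) :
    IsTransport D.rot D'.rot (fun x => reflY (g (reflY x))) e φ where
  reparam := h.reparam
  shadow_eq i t := by
    have h1 := D'.shadow_rot (e i) (φ i t)
    rw [h.shadow_eq] at h1
    rw [D.shadow_rot, reflY_reflY]
    exact h1
  order i s j t hc := by
    have h1 := (D.isCrossing_rot i s j t).1 hc
    exact (D.height_rot_lt i s j t).trans ((h.order _ _ _ _ h1.symm).trans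
      (D'.height_rot_lt (e i) (φ i s) (e j) (φ j t)).symm)

/-- The reflection itself does not preserve isotopy classes, but its composition with a change of all
crossings does. -/
theorem PreservesIsotopy.conj_reflY {g : E3 → E3} (h : PreservesIsotopy g) :
    PreservesIsotopy fun x => reflY (g (reflY x)) := by
  intro K K' e ht
  have h1 := ht.rot
  simp only [reflY_reflY] at h1
  exact (K.isotopic_rot.trans (h K.rot K'.rot e h1)).trans K'.isotopic_rot.symm

theorem Equi.rot {D D' : LinkDiagram} (h : D.Equi D') : D.rot.Equi D'.rot := by
  obtain ⟨g, g', e, φ, hg, hi, ht⟩ := h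
  exact ⟨_, _, e, φ, hg.conj_reflY, hi.conj_reflY, ht.rot⟩

end LinkDiagram

/-! ### Flips -/

/-- The linear form `a₁ x + a₂ z`, whose zero set is a plane orthogonal to the plane of the great
circle `y = 0`. -/
def lin (a : ℝ × ℝ) (x : E3) : ℝ := a.1 * x 0 + a.2 * x 2

@[simp] theorem lin_reflY (a : ℝ × ℝ) (x : E3) : lin a (reflY x) = lin a x := rfl

theorem contDiff_lin (a : ℝ × ℝ) : ContDiff ℝ ∞ (lin a) := by
  unfold lin
  fun_prop

/-- A smooth function of `u` that vanishes for `|u| ≤ ε / 2` and is `1` for `|u| ≥ ε`. -/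
noncomputable def cutoff (ε u : ℝ) : ℝ := Real.smoothTransition (2 * (u / ε) ^ 2 - 1)

theorem contDiff_cutoff (ε : ℝ) : ContDiff ℝ ∞ (cutoff ε) :=
  Real.smoothTransition.contDiff.comp (by fun_prop)

theorem cutoff_of_abs_le {ε u : ℝ} (hε : 0 < ε) (h : |u| ≤ ε / 2) : cutoff ε u = 0 := by
  apply Real.smoothTransition.zero_of_nonpos
  have : |u / ε| ≤ 1 / 2 := by
    rw [abs_div, abs_of_pos hε, div_le_iff₀ hε]
    linarith
  nlinarith [sq_abs (u / ε), abs_nonneg (u / ε)]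

theorem cutoff_of_le_abs {ε u : ℝ} (hε : 0 < ε) (h : ε ≤ |u|) : cutoff ε u = 1 := by
  apply Real.smoothTransition.one_of_one_le
  have : 1 ≤ |u / ε| := by
    rw [abs_div, abs_of_pos hε, le_div_iff₀ hε]
    linarith
  nlinarith [sq_abs (u / ε)]

namespace LinkDiagram

/-- `F` is obtained from `E` by rotating by `π`, about the great circle `y = w = 0`, the part of `E`
in the half space `lin a < 0`. This is possible if `E` lies in the plane `y = 0` as long as
`|lin a| < ε`, which the first two conditions imply. -/
structure IsFlip (a : ℝ × ℝ) (ε : ℝ) (E F : LinkDiagram) (e : E.ι ≃ F.ι) : Prop where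
  pos : 0 < ε
  flipped : ∀ i t, lin a (E.shadow i t) < ε → F.shadow (e i) t = reflY (E.shadow i t)
  kept : ∀ i t, -ε < lin a (E.shadow i t) → F.shadow (e i) t = E.shadow i t
  order_flipped : ∀ i s j t, E.IsCrossing i s j t → lin a (E.shadow i s) < 0 →
    (E.height i s < E.height j t ↔ F.height (e j) t < F.height (e i) s)
  order_kept : ∀ i s j t, E.IsCrossing i s j t → 0 < lin a (E.shadow i s) →
    (E.height i s < E.height j t ↔ F.height (e i) s < F.height (e j) t)

/-- Where `|lin a| < ε`, the projected curves lie on the great circle `y = 0`. -/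
def IsFlat (D : LinkDiagram) (a : ℝ × ℝ) (ε : ℝ) : Prop :=
  ∀ i t, |lin a (D.shadow i t)| < ε → D.shadow i t 1 = 0

/-- There are no crossings on an arc of a great circle. -/
theorem IsFlat.le_abs {D : LinkDiagram} {a : ℝ × ℝ} {ε : ℝ} (h : D.IsFlat a ε) {i s j t}
    (hc : D.IsCrossing i s j t) : ε ≤ |lin a (D.shadow i s)| := by
  by_contra! hlt
  have key : ∀ i t, |lin a (D.shadow i t)| < ε → deriv (D.shadow i) t 1 = 0 ∧
      D.shadow i t 0 * deriv (D.shadow i) t 0 + D.shadow i t 2 * deriv (D.shadow i) t 2 = 0 := by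
    intro i t ht
    have hd := hasDerivAt_pi.1 ((EuclideanSpace.equiv (Fin 3) ℝ).toContinuousLinearMap.hasFDerivAt.comp_hasDerivAt
      t (D.hasDerivAt_shadow i t))
    have h1 : deriv (D.shadow i) t 1 = 0 := by
      refine (hd 1).unique ((hasDerivAt_const t (0 : ℝ)).congr_of_eventuallyEq ?_)
      have hcont : Continuous fun t => |lin a (D.shadow i t)| :=
        ((contDiff_lin a).continuous.comp (D.smooth_shadow i).continuous).abs
      filter_upwards [(hcont.tendsto t).eventually (gt_mem_nhds ht)] with t' ht'
      exact h i t' ht'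
    refine ⟨h1, ?_⟩
    have h2 := (D.hasDerivAt_shadow i t).norm_sq
    simp only [D.norm_shadow] at h2
    have h3 := h2.unique (hasDerivAt_const t _)
    simp only [PiLp.inner_apply, Fin.sum_univ_three, h1] at h3
    simp at h3
    linarith
  obtain ⟨h1, h2⟩ := key i s hlt
  obtain ⟨h3, h4⟩ := key j t (hc.1 ▸ hlt)
  rw [← hc.1] at h4
  have h5 := D.norm_shadow i s
  have h6 := norm_sq_E3 (D.shadow i s)
  rw [h5, h i s hlt] at h6
  have h7 := D.regular.transverse i s j t hc
  rw [LinearIndependent.pair_iff] at h7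
  set p := D.shadow i s with hp
  set u := deriv (D.shadow i) s
  set v := deriv (D.shadow j) t
  -- Both velocities are multiples of `(-z, 0, x)` if `p = (x, 0, z)`.
  have h8 := h7 (-p 2 * v 0 + p 0 * v 2) (-(-p 2 * u 0 + p 0 * u 2)) (by
    ext k
    fin_cases k
    · simp
      linear_combination v 2 * h2 - u 2 * h4
    · simp [h1, h3]
    · simp
      linear_combination u 0 * h4 - v 0 * h2)
  have h9 : u = 0 := by
    ext k
    fin_cases k
    · simp
      linear_combination u 0 * h6 + p 0 * h2 + p 2 * h8.2
    · exact h1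
    · simp
      linear_combination u 2 * h6 + p 2 * h2 - p 0 * h8.2
  exact D.regular.immersion i s h9

section flip

variable (D : LinkDiagram) (a : ℝ × ℝ) (ε : ℝ)

theorem continuous_lin_shadow (i : D.ι) : Continuous fun t => lin a (D.shadow i t) :=
  (contDiff_lin a).continuous.comp (D.smooth_shadow i).continuous

/-- The slopes of `D`, changed to `0` near the plane `lin a = 0`. -/
noncomputable def cutSlope (i : D.ι) (t : ℝ) : ℝ := D.slope i t * cutoff ε (lin a (D.shadow i t))

theorem contDiff_cutSlope (i : D.ι) : ContDiff ℝ ∞ (D.cutSlope a ε i) :=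
  (D.smooth_slope i).mul ((contDiff_cutoff ε).comp ((contDiff_lin a).comp (D.smooth_shadow i)))

theorem periodic_cutSlope (i : D.ι) : Function.Periodic (D.cutSlope a ε i) 1 := by
  intro t
  simp only [cutSlope, D.periodic_shadow i t, D.periodic_slope i t]

variable {D a ε}

theorem cutSlope_of_abs_le (hε : 0 < ε) {i t} (h : |lin a (D.shadow i t)| ≤ ε / 2) :
    D.cutSlope a ε i t = 0 := by
  rw [cutSlope, cutoff_of_abs_le hε h, mul_zero]

theorem cutSlope_of_isCrossing (hε : 0 < ε) (h : D.IsFlat a ε) {i s j t}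
    (hc : D.IsCrossing i s j t) : D.cutSlope a ε i s = D.slope i s := by
  rw [cutSlope, cutoff_of_le_abs hε (h.le_abs hc), mul_one]

theorem isDiagramData_cut (hε : 0 < ε) (h : D.IsFlat a ε) :
    IsDiagramData D.shadow (D.cutSlope a ε) :=
  { D.isDiagramData with
    smooth_height := D.contDiff_cutSlope a ε
    periodic_height := D.periodic_cutSlope a ε
    height_ne := fun i s j t h1 h2 => by
      have hc : D.IsCrossing i s j t := ⟨h1, h2⟩
      rw [cutSlope_of_isCrossing hε h hc, cutSlope_of_isCrossing hε h hc.symm]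
      exact D.isDiagramData.height_ne i s j t h1 h2 }

/-- `D` with the heights changed to `0` near the plane `lin a = 0`. -/
@[reducible] noncomputable def cut (D : LinkDiagram) {a : ℝ × ℝ} {ε : ℝ} (hε : 0 < ε)
    (h : D.IsFlat a ε) : LinkDiagram :=
  @ofData _ D.finite _ _ (isDiagramData_cut hε h)

/-- Crossings are not affected by the change of heights, since there are none near the plane
`lin a = 0`. -/
theorem isotopic_cut (hε : 0 < ε) (h : D.IsFlat a ε) :
    D.Isotopic (D.cut hε h).toOrientedLink := by
  have := D.finite
  refine PreservesIsotopy.id D (D.cut hε h) (Equiv.refl D.ι)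
    ⟨fun _ => IsCircleReparam.id, fun i t => shadow_ofData _ i t, fun i s j t hc => ?_⟩
  refine Iff.trans ?_ (height_ofData_lt (isDiagramData_cut hε h) i s j t).symm
  rw [cutSlope_of_isCrossing hε h hc, cutSlope_of_isCrossing hε h hc.symm, D.slope_lt_iff]

open Classical in
/-- The projected curves of the flipped diagram. -/
noncomputable def flipShadow (D : LinkDiagram) (a : ℝ × ℝ) (i : D.ι) (t : ℝ) : E3 :=
  if lin a (D.shadow i t) < 0 then reflY (D.shadow i t) else D.shadow i t

open Classical in
/-- The slopes of the flipped diagram. -/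
noncomputable def flipSlope (D : LinkDiagram) (a : ℝ × ℝ) (ε : ℝ) (i : D.ι) (t : ℝ) : ℝ :=
  if lin a (D.shadow i t) < 0 then -D.cutSlope a ε i t else D.cutSlope a ε i t

theorem lin_flipShadow (i : D.ι) (t : ℝ) :
    lin a (D.flipShadow a i t) = lin a (D.shadow i t) := by
  unfold flipShadow
  split_ifs <;> simp

theorem flipShadow_of_lt (h : D.IsFlat a ε) {i t} (ht : lin a (D.shadow i t) < ε) :
    D.flipShadow a i t = reflY (D.shadow i t) := by
  unfold flipShadow
  split_ifs with h0
  · rfl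
  · exact (reflY_eq_self_iff.2 (h i t (abs_lt.2 ⟨by linarith, ht⟩))).symm

theorem flipShadow_of_gt (h : D.IsFlat a ε) {i t} (ht : -ε < lin a (D.shadow i t)) :
    D.flipShadow a i t = D.shadow i t := by
  unfold flipShadow
  split_ifs with h0
  · exact reflY_eq_self_iff.2 (h i t (abs_lt.2 ⟨ht, by linarith⟩))
  · rfl

theorem flipSlope_of_lt (hε : 0 < ε) {i t} (ht : lin a (D.shadow i t) < ε / 2) :
    D.flipSlope a ε i t = -D.cutSlope a ε i t := by
  unfold flipSlope
  split_ifs with h0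
  · rfl
  · rw [cutSlope_of_abs_le hε (abs_le.2 ⟨by linarith, ht.le⟩), neg_zero]

theorem flipSlope_of_gt (hε : 0 < ε) {i t} (ht : -(ε / 2) < lin a (D.shadow i t)) :
    D.flipSlope a ε i t = D.cutSlope a ε i t := by
  unfold flipSlope
  split_ifs with h0
  · rw [cutSlope_of_abs_le hε (abs_le.2 ⟨ht.le, by linarith⟩), neg_zero]
  · rfl

theorem eventually_lin_lt {b : ℝ} {i t} (ht : lin a (D.shadow i t) < b) :
    ∀ᶠ t' in nhds t, lin a (D.shadow i t') < b :=
  ((D.continuous_lin_shadow a i).tendsto t).eventually (gt_mem_nhds ht)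

theorem eventually_lt_lin {b : ℝ} {i t} (ht : b < lin a (D.shadow i t)) :
    ∀ᶠ t' in nhds t, b < lin a (D.shadow i t') :=
  ((D.continuous_lin_shadow a i).tendsto t).eventually (lt_mem_nhds ht)

theorem hasDerivAt_flipShadow_of_lt (h : D.IsFlat a ε) {i t}
    (ht : lin a (D.shadow i t) < ε) :
    HasDerivAt (D.flipShadow a i) (reflY (deriv (D.shadow i) t)) t := by
  refine (reflY.hasFDerivAt.comp_hasDerivAt t (D.hasDerivAt_shadow i t)).congr_of_eventuallyEq ?_
  filter_upwards [eventually_lin_lt ht] with t' ht'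
  exact flipShadow_of_lt h ht'

theorem hasDerivAt_flipShadow_of_gt (h : D.IsFlat a ε) {i t}
    (ht : -ε < lin a (D.shadow i t)) :
    HasDerivAt (D.flipShadow a i) (deriv (D.shadow i) t) t := by
  refine (D.hasDerivAt_shadow i t).congr_of_eventuallyEq ?_
  filter_upwards [eventually_lt_lin ht] with t' ht'
  exact flipShadow_of_gt h ht'

theorem flipShadow_eq_iff (h : D.IsFlat a ε) (hε : 0 < ε) {i s j t} :
    D.flipShadow a i s = D.flipShadow a j t ↔ D.shadow i s = D.shadow j t := by
  have key : ∀ i t j t', D.flipShadow a i t = D.flipShadow a j t' →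
      D.shadow i t = D.shadow j t' := by
    intro i t j t' h1
    have h2 : lin a (D.shadow i t) = lin a (D.shadow j t') := by
      rw [← lin_flipShadow, h1, lin_flipShadow]
    rcases lt_or_ge (lin a (D.shadow i t)) ε with h3 | h3
    · rw [flipShadow_of_lt h h3, flipShadow_of_lt h (h2 ▸ h3)] at h1
      exact reflY_injective h1
    · rwa [flipShadow_of_gt h (by linarith), flipShadow_of_gt h (by linarith)] at h1
  refine ⟨key _ _ _ _, fun h1 => ?_⟩
  unfold flipShadow
  rw [h1]

theorem isDiagramData_flip (hε : 0 < ε) (h : D.IsFlat a ε) :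
    IsDiagramData (D.flipShadow a) (D.flipSlope a ε) := by
  have h0 := D.isDiagramData
  constructor
  · intro i t
    unfold flipShadow
    split_ifs <;> simp [D.norm_shadow]
  · intro i
    rw [contDiff_iff_contDiffAt]
    intro t
    rcases lt_or_ge (lin a (D.shadow i t)) ε with ht | ht
    · refine (reflY.contDiff.comp (D.smooth_shadow i)).contDiffAt.congr_of_eventuallyEq ?_
      filter_upwards [eventually_lin_lt ht] with t' ht'
      exact flipShadow_of_lt h ht'
    · refine (D.smooth_shadow i).contDiffAt.congr_of_eventuallyEq ?_
      filter_upwards [eventually_lt_lin (hε.trans_le ht)] with t' ht'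
      exact flipShadow_of_gt h (by linarith)
  · intro i
    rw [contDiff_iff_contDiffAt]
    intro t
    rcases lt_or_ge (lin a (D.shadow i t)) (ε / 2) with ht | ht
    · refine (D.contDiff_cutSlope a ε i).neg.contDiffAt.congr_of_eventuallyEq ?_
      filter_upwards [eventually_lin_lt ht] with t' ht'
      exact flipSlope_of_lt hε ht'
    · refine (D.contDiff_cutSlope a ε i).contDiffAt.congr_of_eventuallyEq ?_
      filter_upwards [eventually_lt_lin ((half_pos hε).trans_le ht)] with t' ht'
      exact flipSlope_of_gt hε (by linarith)
  · intro i t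
    simp only [flipShadow, D.periodic_shadow i t]
  · intro i t
    simp only [flipSlope, D.periodic_shadow i t, D.periodic_cutSlope a ε i t]
  · intro i t h1
    rcases lt_or_ge (lin a (D.shadow i t)) ε with ht | ht
    · rw [(hasDerivAt_flipShadow_of_lt h ht).deriv, map_eq_zero_iff _ reflY_injective] at h1
      exact D.regular.immersion i t h1
    · rw [(hasDerivAt_flipShadow_of_gt h (by linarith)).deriv] at h1
      exact D.regular.immersion i t h1
  · intro i s j t h1 h2
    have h1 := (flipShadow_eq_iff h hε).1 h1
    have h3 := h0.transverse i s j t h1 h2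
    rcases lt_or_ge (lin a (D.shadow i s)) ε with ht | ht
    · rw [LinearIndependent.pair_iff] at h3 ⊢
      intro c d hcd
      rw [(hasDerivAt_flipShadow_of_lt h ht).deriv,
        (hasDerivAt_flipShadow_of_lt h (h1 ▸ ht)).deriv, ← map_smul, ← map_smul, ← map_add,
        map_eq_zero_iff _ reflY_injective] at hcd
      exact h3 c d hcd
    · rwa [(hasDerivAt_flipShadow_of_gt h (by linarith)).deriv,
        (hasDerivAt_flipShadow_of_gt h (by rw [← h1]; linarith)).deriv]
  · intro i s j t k r h1 h2 h3 h4
    exact h0.no_triple i s j t k r ((flipShadow_eq_iff h hε).1 h1) h2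
      ((flipShadow_eq_iff h hε).1 h3) h4
  · intro i s j t h1 h2
    have h1 := (flipShadow_eq_iff h hε).1 h1
    have hc : D.IsCrossing i s j t := ⟨h1, h2⟩
    have h3 := h0.height_ne i s j t h1 h2
    unfold flipSlope
    rw [cutSlope_of_isCrossing hε h hc, cutSlope_of_isCrossing hε h hc.symm, ← h1]
    split_ifs
    · exact fun h4 => h3 (neg_injective h4)
    · exact h3

/-- The diagram obtained from `D` by flipping the part in the half space `lin a < 0`. -/
@[reducible] noncomputable def flip (D : LinkDiagram) {a : ℝ × ℝ} {ε : ℝ} (hε : 0 < ε)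
    (h : D.IsFlat a ε) : LinkDiagram :=
  @ofData _ D.finite _ _ (isDiagramData_flip hε h)

theorem isFlip_flip (hε : 0 < ε) (h : D.IsFlat a ε) :
    IsFlip a ε D (D.flip hε h) (Equiv.refl D.ι) := by
  have := D.finite
  have hs : ∀ i t, (D.flip hε h).shadow i t = D.flipShadow a i t := fun i t => shadow_ofData _ i t
  have ho : ∀ i s j t, (D.flip hε h).height i s < (D.flip hε h).height j t ↔
      D.flipSlope a ε i s < D.flipSlope a ε j t := fun i s j t => height_ofData_lt _ i s j t
  refine ⟨hε, fun i t ht => (hs i t).trans (flipShadow_of_lt h ht),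
    fun i t ht => (hs i t).trans (flipShadow_of_gt h ht), fun i s j t hc h0 => ?_,
    fun i s j t hc h0 => ?_⟩
  · refine Iff.trans ?_ (ho j t i s).symm
    unfold flipSlope
    rw [← hc.1, if_pos h0, if_pos h0, cutSlope_of_isCrossing hε h hc,
      cutSlope_of_isCrossing hε h hc.symm, neg_lt_neg_iff, D.slope_lt_iff]
  · refine Iff.trans ?_ (ho i s j t).symm
    unfold flipSlope
    rw [← hc.1, if_neg h0.not_gt, if_neg h0.not_gt, cutSlope_of_isCrossing hε h hc,
      cutSlope_of_isCrossing hε h hc.symm, D.slope_lt_iff]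

open Classical in
/-- The rotation about the great circle `y = w = 0` of the part of `D` with `lin a < 0` is an
isotopy, because `D` lies on that great circle near the plane `lin a = 0`, and because `lin a` is
invariant under the rotation. -/
theorem isotopic_flip (hε : 0 < ε) (h : D.IsFlat a ε) :
    D.Isotopic (D.flip hε h).toOrientedLink := by
  refine (isotopic_cut hε h).trans ?_
  have := D.finite
  set E := D.cut hε h with hE
  have hcE : ∀ i t, E.curve i t = spherePoint (D.shadow i t) (D.cutSlope a ε i t) :=
    fun i t => rfl
  let H : D.ι → ℝ → ℝ → E3 × ℝ := fun i s t =>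
    if lin a (D.shadow i t) < 0 then turn (Real.pi * s) (E.curve i t) else E.curve i t
  have hfix : ∀ i t s, |lin a (D.shadow i t)| ≤ ε / 2 →
      turn (Real.pi * s) (E.curve i t) = E.curve i t := by
    intro i t s ht
    apply turn_eq_self
    · rw [hcE]
      simp [spherePoint, h i t (ht.trans_lt (by linarith))]
    · rw [hcE]
      simp [spherePoint, cutSlope_of_abs_le hε ht]
  have H1 : ∀ i s t, lin a (D.shadow i t) < ε / 2 →
      H i s t = turn (Real.pi * s) (E.curve i t) := by
    intro i s t ht
    simp only [H]
    split_ifs with h0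
    · rfl
    · exact (hfix i t s (abs_le.2 ⟨by linarith, ht.le⟩)).symm
  have H2 : ∀ i s t, -(ε / 2) < lin a (D.shadow i t) → H i s t = E.curve i t := by
    intro i s t ht
    simp only [H]
    split_ifs with h0
    · exact hfix i t s (abs_le.2 ⟨ht.le, by linarith⟩)
    · rfl
  have hlin : ∀ i s t, (lin a (H i s t).1 < 0 ↔ lin a (D.shadow i t) < 0) := by
    intro i s t
    have hb := Real.cos_arctan_pos (D.cutSlope a ε i t)
    have h1 : lin a (H i s t).1
        = Real.cos (Real.arctan (D.cutSlope a ε i t)) * lin a (D.shadow i t) := by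
      have h2 : lin a (H i s t).1 = lin a (E.curve i t).1 := by
        simp only [H]
        split_ifs <;> rfl
      rw [h2, hcE]
      simp only [spherePoint, lin, PiLp.smul_apply, smul_eq_mul]
      ring
    rw [h1]
    constructor
    · intro h3
      by_contra! h4
      exact h3.not_ge (mul_nonneg hb.le h4)
    · exact fun h3 => mul_neg_of_pos_of_neg hb h3
  have hsm : ∀ i, ContDiff ℝ ∞ fun q : ℝ × ℝ => H i q.1 q.2 := by
    intro i
    rw [contDiff_iff_contDiffAt]
    rintro ⟨s, t⟩
    rcases lt_or_ge (lin a (D.shadow i t)) (ε / 2) with ht | ht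
    · have : ContDiff ℝ ∞ fun q : ℝ × ℝ => turn (Real.pi * q.1) (E.curve i q.2) :=
        contDiff_turn (contDiff_const.mul contDiff_fst) ((E.isLink.smooth i).comp contDiff_snd)
      refine this.contDiffAt.congr_of_eventuallyEq ?_
      filter_upwards [(continuous_snd.tendsto (s, t)).eventually (eventually_lin_lt ht)] with q hq
      exact H1 i q.1 q.2 hq
    · refine ((E.isLink.smooth i).comp contDiff_snd).contDiffAt.congr_of_eventuallyEq ?_
      filter_upwards [(continuous_snd.tendsto (s, t)).eventually
        (eventually_lt_lin ((half_pos hε).trans_le ht))] with q hq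
      exact H2 i q.1 q.2 (by linarith)
  refine ⟨Equiv.refl _, H, hsm, fun s _ => ⟨fun i t => ?_, fun i => ?_, fun i t => ?_,
    fun i t => ?_, fun i s' j t h1 => ?_⟩, fun i t => ?_, fun i t => ?_⟩
  · simp only [H]
    split_ifs
    · exact turn_mem (E.isLink.mem_sphere i t)
    · exact E.isLink.mem_sphere i t
  · exact (hsm i).comp (f := fun t : ℝ => ((s, t) : ℝ × ℝ)) (by fun_prop)
  · simp only [H, D.periodic_shadow i t, E.isLink.periodic i t]
  · have hd : HasDerivAt (E.curve i) (deriv (E.curve i) t) t :=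
      ((E.isLink.smooth i).differentiable (by simp) t).hasDerivAt
    rcases lt_or_ge (lin a (D.shadow i t)) (ε / 2) with ht | ht
    · have h1 := ((turn (Real.pi * s)).hasFDerivAt.comp_hasDerivAt t hd).congr_of_eventuallyEq
        (f₁ := H i s) (by
          filter_upwards [eventually_lin_lt ht] with t' ht'
          exact H1 i s t' ht')
      rw [h1.deriv]
      exact (map_ne_zero_iff _ (turn_injective _)).2 (E.isLink.immersion i t)
    · have h1 := hd.congr_of_eventuallyEq (f₁ := H i s) (by
          filter_upwards [eventually_lt_lin ((half_pos hε).trans_le ht)] with t' ht'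
          exact H2 i s t' (by linarith))
      rw [h1.deriv]
      exact E.isLink.immersion i t
  · have h2 : lin a (D.shadow i s') < 0 ↔ lin a (D.shadow j t) < 0 := by
      rw [← hlin i s s', ← hlin j s t]
      exact iff_of_eq (congrArg (fun q : E3 × ℝ => lin a q.1 < 0) h1)
    simp only [H] at h1
    by_cases h3 : lin a (D.shadow i s') < 0
    · rw [if_pos h3, if_pos (h2.1 h3)] at h1
      exact E.isLink.injective i s' j t (turn_injective _ h1)
    · rw [if_neg h3, if_neg (h2.not.1 h3)] at h1
      exact E.isLink.injective i s' j t h1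
  · simp only [H, mul_zero, turn_zero, ite_self]
  · have h1 : (D.flip hε h).curve i t = spherePoint (D.flipShadow a i t) (D.flipSlope a ε i t) :=
      rfl
    refine Eq.trans ?_ h1.symm
    simp only [H, flipShadow, flipSlope, mul_one]
    split_ifs with h0
    · rw [hcE, turn_pi_spherePoint]
    · rfl

end flip

namespace IsFlip

variable {a : ℝ × ℝ} {ε : ℝ} {E F : LinkDiagram} {e : E.ι ≃ F.ι}

theorem isFlat (h : IsFlip a ε E F e) : E.IsFlat a ε := by
  intro i t ht
  rw [abs_lt] at ht
  rw [← reflY_eq_self_iff, ← h.flipped i t ht.2, h.kept i t ht.1]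

theorem lin_shadow (h : IsFlip a ε E F e) (i t) :
    lin a (F.shadow (e i) t) = lin a (E.shadow i t) := by
  have := h.pos
  rcases lt_or_ge (lin a (E.shadow i t)) ε with ht | ht
  · rw [h.flipped i t ht, lin_reflY]
  · rw [h.kept i t (by linarith)]

theorem shadow_eq_iff (h : IsFlip a ε E F e) {i s j t} :
    F.shadow (e i) s = F.shadow (e j) t ↔ E.shadow i s = E.shadow j t := by
  have := h.pos
  constructor
  · intro h1
    have h2 : lin a (E.shadow i s) = lin a (E.shadow j t) := by
      rw [← h.lin_shadow, h1, h.lin_shadow]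
    rcases lt_or_ge (lin a (E.shadow i s)) ε with ht | ht
    · rw [h.flipped _ _ ht, h.flipped _ _ (h2 ▸ ht)] at h1
      exact reflY_injective h1
    · rwa [h.kept _ _ (by linarith), h.kept _ _ (by linarith)] at h1
  · intro h1
    rcases lt_or_ge (lin a (E.shadow i s)) ε with ht | ht
    · rw [h.flipped _ _ ht, h.flipped _ _ (h1 ▸ ht), h1]
    · rw [h.kept _ _ (by linarith), h.kept _ _ (by rw [← h1]; linarith), h1]

theorem isCrossing_iff (h : IsFlip a ε E F e) {i s j t} :
    F.IsCrossing (e i) s (e j) t ↔ E.IsCrossing i s j t := by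
  unfold OrientedLink.IsCrossing SamePoint
  rw [h.shadow_eq_iff, e.injective.eq_iff]

theorem isotopic (h : IsFlip a ε E F e) : E.Isotopic F.toOrientedLink := by
  refine (isotopic_flip h.pos h.isFlat).trans ?_
  have h1 := isFlip_flip h.pos h.isFlat
  have hpos := h.pos
  refine PreservesIsotopy.id (E.flip h.pos h.isFlat) F e ⟨fun _ => IsCircleReparam.id,
    fun i t => ?_, fun i s j t hc => ?_⟩
  · rcases lt_or_ge (lin a (E.shadow i t)) ε with ht | ht
    · exact (h.flipped i t ht).trans (h1.flipped i t ht).symm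
    · exact (h.kept i t (by linarith)).trans (h1.kept i t (by linarith)).symm
  · have hc' : E.IsCrossing i s j t := h1.isCrossing_iff.1 hc
    have h2 := h.isFlat.le_abs hc'
    rcases lt_or_gt_of_ne (abs_pos.1 (hpos.trans_le h2)) with h0 | h0
    · exact (h1.order_flipped j t i s hc'.symm (hc'.1 ▸ h0)).symm.trans
        (h.order_flipped j t i s hc'.symm (hc'.1 ▸ h0))
    · exact (h1.order_kept i s j t hc' h0).symm.trans (h.order_kept i s j t hc' h0)

theorem hasDerivAt_of_lt (h : IsFlip a ε E F e) {i t} (ht : lin a (E.shadow i t) < ε) :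
    HasDerivAt (F.shadow (e i)) (reflY (deriv (E.shadow i) t)) t := by
  refine (reflY.hasFDerivAt.comp_hasDerivAt t (E.hasDerivAt_shadow i t)).congr_of_eventuallyEq ?_
  filter_upwards [eventually_lin_lt ht] with t' ht'
  exact h.flipped i t' ht'

theorem hasDerivAt_of_gt (h : IsFlip a ε E F e) {i t} (ht : -ε < lin a (E.shadow i t)) :
    HasDerivAt (F.shadow (e i)) (deriv (E.shadow i) t) t := by
  refine (E.hasDerivAt_shadow i t).congr_of_eventuallyEq ?_
  filter_upwards [eventually_lt_lin ht] with t' ht'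
  exact h.kept i t' ht'

/-- In the flipped part, the diagram is reflected and the crossings are switched: both change the
sign of a crossing. -/
theorem isPositive (h : IsFlip a ε E F e) (hE : E.IsPositive) : F.IsPositive := by
  intro i' s j' t hc hlt
  obtain ⟨i, rfl⟩ := e.surjective i'
  obtain ⟨j, rfl⟩ := e.surjective j'
  have hpos := h.pos
  have hc := h.isCrossing_iff.1 hc
  change 0 < det3 (F.shadow (e i) s) (deriv (F.shadow (e i)) s) (deriv (F.shadow (e j)) t)
  have h2 := h.isFlat.le_abs hc
  rcases lt_or_gt_of_ne (abs_pos.1 (hpos.trans_le h2)) with h0 | h0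
  · have h1 : 0 < det3 (E.shadow j t) (deriv (E.shadow j) t) (deriv (E.shadow i) s) :=
      hE j t i s hc.symm ((h.order_flipped i s j t hc h0).2 hlt)
    rw [h.flipped i s (by linarith), (h.hasDerivAt_of_lt (by linarith)).deriv,
      (h.hasDerivAt_of_lt (by rw [← hc.1]; linarith)).deriv, det3_reflY, ← det3_swap, hc.1]
    exact h1
  · have h1 : 0 < det3 (E.shadow i s) (deriv (E.shadow i) s) (deriv (E.shadow j) t) :=
      hE i s j t hc ((h.order_kept j t i s hc.symm (hc.1 ▸ h0)).2 hlt)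
    rwa [h.kept i s (by linarith), (h.hasDerivAt_of_gt (by linarith)).deriv,
      (h.hasDerivAt_of_gt (by rw [← hc.1]; linarith)).deriv]

end IsFlip

end LinkDiagram

/-! ### Squeezing a cap of the sphere -/

/-- The great circle `y = 0` of `S²`, with the parametrization of `greatCircle`. -/
noncomputable def circ (t : ℝ) : E3 :=
  !₂[-Real.cos (2 * Real.pi * t), 0, Real.sin (2 * Real.pi * t)]

@[simp] theorem circ_zero (t : ℝ) : circ t 0 = -Real.cos (2 * Real.pi * t) := rfl
@[simp] theorem circ_one (t : ℝ) : circ t 1 = 0 := rfl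
@[simp] theorem circ_two (t : ℝ) : circ t 2 = Real.sin (2 * Real.pi * t) := rfl

theorem norm_circ (t : ℝ) : ‖circ t‖ = 1 := by
  rw [← sq_eq_sq₀ (norm_nonneg _) zero_le_one, norm_sq_E3, circ_zero, circ_one, circ_two]
  linear_combination Real.cos_sq_add_sin_sq (2 * Real.pi * t)

theorem circ_ne_zero (t : ℝ) : circ t ≠ 0 := by
  rw [← norm_ne_zero_iff, norm_circ]
  exact one_ne_zero

theorem hasDerivAt_circ (t : ℝ) : HasDerivAt circ
    ((2 * Real.pi) • !₂[Real.sin (2 * Real.pi * t), 0, Real.cos (2 * Real.pi * t)]) t := by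
  have h0 : HasDerivAt (fun t => 2 * Real.pi * t) (2 * Real.pi) t := by
    simpa using (hasDerivAt_id t).const_mul (2 * Real.pi)
  have h1 : HasDerivAt (fun t => ![-Real.cos (2 * Real.pi * t), 0, Real.sin (2 * Real.pi * t)])
      ((2 * Real.pi) • ![Real.sin (2 * Real.pi * t), 0, Real.cos (2 * Real.pi * t)]) t := by
    rw [hasDerivAt_pi]
    intro k
    fin_cases k
    · simpa [mul_comm] using h0.cos.fun_neg
    · simpa using hasDerivAt_const t (0 : ℝ)
    · simpa [mul_comm] using h0.sin
  exact (EuclideanSpace.equiv (Fin 3) ℝ).symm.toContinuousLinearMap.hasFDerivAt.comp_hasDerivAt t h1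

theorem deriv_circ_ne_zero (t : ℝ) :
    (2 * Real.pi) • !₂[Real.sin (2 * Real.pi * t), 0, Real.cos (2 * Real.pi * t)] ≠ (0 : E3) := by
  refine smul_ne_zero (by positivity) fun h => ?_
  have h0 := congrArg (fun x : E3 => x 0) h
  have h2 := congrArg (fun x : E3 => x 2) h
  have h3 := Real.cos_sq_add_sin_sq (2 * Real.pi * t)
  simp at h0 h2
  rw [h0, h2] at h3
  norm_num at h3

theorem circ_eq_iff {s t : ℝ} : circ s = circ t ↔ ∃ n : ℤ, t = s + n := by
  constructor
  · intro h
    have h0 := congrArg (fun x : E3 => x 0) h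
    have h2 := congrArg (fun x : E3 => x 2) h
    simp only [circ_zero, circ_two, neg_inj] at h0 h2
    obtain ⟨n, hn⟩ := Real.Angle.angle_eq_iff_two_pi_dvd_sub.1 (Real.Angle.cos_sin_inj h0.symm h2.symm)
    refine ⟨n, ?_⟩
    have : (0 : ℝ) < 2 * Real.pi := by positivity
    have : 2 * Real.pi * (t - s - n) = 0 := by linarith
    have := (mul_eq_zero.1 this).resolve_left (by positivity)
    linarith
  · rintro ⟨n, rfl⟩
    have h1 : 2 * Real.pi * (s + n) = 2 * Real.pi * s + n * (2 * Real.pi) := by ring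
    simp only [circ, h1, Real.cos_add_int_mul_two_pi, Real.sin_add_int_mul_two_pi]

/-- A smooth increasing function that is `0` below `-δ` and `1` above `-δ/2`. -/
noncomputable def capBump (δ c : ℝ) : ℝ := Real.smoothTransition ((c + δ) / (δ / 2))

theorem contDiff_capBump (δ : ℝ) : ContDiff ℝ ∞ (capBump δ) :=
  Real.smoothTransition.contDiff.comp (by fun_prop)

theorem monotone_capBump {δ : ℝ} (hδ : 0 < δ) : Monotone (capBump δ) := by
  intro a b h
  apply Real.smoothTransition.monotone
  gcongr

theorem capBump_of_le {δ c : ℝ} (hδ : 0 < δ) (h : c ≤ -δ) : capBump δ c = 0 := by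
  apply Real.smoothTransition.zero_of_nonpos
  exact div_nonpos_of_nonpos_of_nonneg (by linarith) (by linarith)

theorem capBump_of_ge {δ c : ℝ} (hδ : 0 < δ) (h : -(δ / 2) ≤ c) : capBump δ c = 1 := by
  apply Real.smoothTransition.one_of_one_le
  rw [le_div_iff₀ (by linarith)]
  linarith

/-- The factor by which `squeeze` scales at the latitude `z = c`. -/
noncomputable def capScale (δ k s c : ℝ) : ℝ := Real.exp (-(s * k) * capBump δ c)

theorem capScale_pos (δ k s c : ℝ) : 0 < capScale δ k s c := Real.exp_pos _

theorem capScale_antitone {δ k s : ℝ} (hδ : 0 < δ) (hk : 0 ≤ k) (hs : 0 ≤ s) :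
    Antitone (capScale δ k s) := by
  intro a b h
  apply Real.exp_le_exp.2
  nlinarith [monotone_capBump hδ h, mul_nonneg hs hk]

/-- In the stereographic projection from the south pole of `S²`, this is the scaling by a factor
that depends on the latitude. It moves points to the north within the cap `z > -δ`. -/
noncomputable def squeeze (δ k s : ℝ) (x : E3) : E3 :=
  (‖x‖ + x 2 + capScale δ k s (x 2 / ‖x‖) ^ 2 * (‖x‖ - x 2))⁻¹ •
    !₂[2 * capScale δ k s (x 2 / ‖x‖) * x 0, 2 * capScale δ k s (x 2 / ‖x‖) * x 1,
      ‖x‖ + x 2 - capScale δ k s (x 2 / ‖x‖) ^ 2 * (‖x‖ - x 2)]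

theorem abs_two_le_norm (x : E3) : |x 2| ≤ ‖x‖ := by
  apply abs_le_of_sq_le_sq _ (norm_nonneg x)
  rw [norm_sq_E3]
  nlinarith [sq_nonneg (x 0), sq_nonneg (x 1)]

theorem squeeze_den_pos {n z l : ℝ} (hn : 0 < n) (hz : |z| ≤ n) (hl : 0 < l) :
    0 < n + z + l ^ 2 * (n - z) := by
  obtain ⟨h1, h2⟩ := abs_le.1 hz
  rcases h2.eq_or_lt with rfl | h3
  · nlinarith
  · have := mul_pos (pow_pos hl 2) (sub_pos.2 h3)
    linarith

theorem squeeze_of_norm_eq_one {δ k s : ℝ} {p : E3} (hp : ‖p‖ = 1) :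
    squeeze δ k s p = (1 + p 2 + capScale δ k s (p 2) ^ 2 * (1 - p 2))⁻¹ •
      !₂[2 * capScale δ k s (p 2) * p 0, 2 * capScale δ k s (p 2) * p 1,
        1 + p 2 - capScale δ k s (p 2) ^ 2 * (1 - p 2)] := by
  simp only [squeeze, hp, div_one]

theorem contDiffOn_squeeze (δ k : ℝ) :
    ContDiffOn ℝ ∞ (fun q : ℝ × E3 => squeeze δ k q.1 q.2) {q | q.2 ≠ 0} := by
  have hn : ContDiffOn ℝ ∞ (fun q : ℝ × E3 => ‖q.2‖) {q | q.2 ≠ 0} :=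
    contDiffOn_snd.norm ℝ fun q hq => hq
  have hx : ∀ i, ContDiffOn ℝ ∞ (fun q : ℝ × E3 => q.2 i) {q | q.2 ≠ 0} := fun i => by
    have : ContDiff ℝ ∞ (fun q : ℝ × E3 => q.2 i) := by fun_prop
    exact this.contDiffOn
  have hl : ContDiffOn ℝ ∞ (fun q : ℝ × E3 => capScale δ k q.1 (q.2 2 / ‖q.2‖)) {q | q.2 ≠ 0} := by
    refine Real.contDiff_exp.comp_contDiffOn (((contDiff_fst.mul contDiff_const).neg).contDiffOn.mul
      ((contDiff_capBump δ).comp_contDiffOn ((hx 2).div hn fun q hq => norm_ne_zero_iff.2 hq)))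
  have hd := (hn.add (hx 2)).add ((hl.pow 2).mul (hn.sub (hx 2)))
  refine (hd.inv fun q hq => ?_).smul ?_
  · exact (squeeze_den_pos (norm_pos_iff.2 hq) (abs_two_le_norm _) (capScale_pos _ _ _ _)).ne'
  · rw [contDiffOn_euclidean]
    intro i
    fin_cases i
    · exact (contDiffOn_const.mul hl).mul (hx 0)
    · exact (contDiffOn_const.mul hl).mul (hx 1)
    · exact (hn.add (hx 2)).sub ((hl.pow 2).mul (hn.sub (hx 2)))

theorem norm_squeeze {δ k s : ℝ} {p : E3} (hp : ‖p‖ = 1) : ‖squeeze δ k s p‖ = 1 := by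
  have hpos := squeeze_den_pos one_pos (hp ▸ abs_two_le_norm p) (capScale_pos δ k s (p 2))
  have h1 := norm_sq_E3 p
  rw [hp] at h1
  rw [← sq_eq_sq₀ (norm_nonneg _) zero_le_one, norm_sq_E3, squeeze_of_norm_eq_one hp]
  simp only [PiLp.smul_apply, smul_eq_mul, Matrix.cons_val]
  field_simp
  linear_combination -4 * capScale δ k s (p 2) ^ 2 * h1

/-- The image determines the latitude by monotonicity, and then the point. -/
theorem squeeze_injOn {δ k s : ℝ} (hδ : 0 < δ) (hk : 0 ≤ k) (hs : 0 ≤ s) {p q : E3}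
    (hp : ‖p‖ = 1) (hq : ‖q‖ = 1) (h : squeeze δ k s p = squeeze δ k s q) : p = q := by
  have key : ∀ p q : E3, ‖p‖ = 1 → ‖q‖ = 1 → squeeze δ k s p = squeeze δ k s q →
      ¬ p 2 < q 2 := by
    intro p q hp hq h hlt
    have hdp := squeeze_den_pos one_pos (hp ▸ abs_two_le_norm p) (capScale_pos δ k s (p 2))
    have hdq := squeeze_den_pos one_pos (hq ▸ abs_two_le_norm q) (capScale_pos δ k s (q 2))
    have h2 := congrArg (fun x : E3 => x 2) h
    simp only [squeeze_of_norm_eq_one hp, squeeze_of_norm_eq_one hq, PiLp.smul_apply, smul_eq_mul,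
      Matrix.cons_val] at h2
    have hl := capScale_antitone hδ hk hs hlt.le
    have hlp := capScale_pos δ k s (p 2)
    have hlq := capScale_pos δ k s (q 2)
    have hp1 := abs_le.1 (hp ▸ abs_two_le_norm p)
    have hq1 := abs_le.1 (hq ▸ abs_two_le_norm q)
    generalize capScale δ k s (p 2) = a at *
    generalize capScale δ k s (q 2) = b at *
    field_simp at h2
    have h3 : b ^ 2 * ((1 - q 2) * (1 + p 2)) = a ^ 2 * ((1 - p 2) * (1 + q 2)) := by
      linear_combination (1 / 2) * h2
    have h4 : b ^ 2 ≤ a ^ 2 := by gcongr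
    have h5 : (1 - q 2) * (1 + p 2) < (1 - p 2) * (1 + q 2) := by nlinarith
    have h6 : 0 ≤ (1 - q 2) * (1 + p 2) := mul_nonneg (by linarith) (by linarith)
    have h7 := mul_le_mul_of_nonneg_right h4 h6
    have h8 := mul_lt_mul_of_pos_left h5 (pow_pos hlp 2)
    linarith
  have hz : p 2 = q 2 := le_antisymm (not_lt.1 (key q p hq hp h.symm)) (not_lt.1 (key p q hp hq h))
  have hd := squeeze_den_pos one_pos (hq ▸ abs_two_le_norm q) (capScale_pos δ k s (q 2))
  rw [squeeze_of_norm_eq_one hp, squeeze_of_norm_eq_one hq, hz] at h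
  have h1 := smul_right_injective E3 (inv_ne_zero hd.ne') h
  have hl : 2 * capScale δ k s (q 2) ≠ 0 := (mul_pos two_pos (capScale_pos δ k s (q 2))).ne'
  ext i
  fin_cases i
  · exact mul_left_cancel₀ hl (congrArg (fun x : E3 => x 0) h1)
  · exact mul_left_cancel₀ hl (congrArg (fun x : E3 => x 1) h1)
  · exact hz

theorem continuous_capScale (δ k s : ℝ) : Continuous (capScale δ k s) := by
  unfold capScale
  have := (contDiff_capBump δ).continuous
  fun_prop

theorem squeeze_surjOn {δ k s : ℝ} {q : E3} (hq : ‖q‖ = 1) :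
    ∃ p, ‖p‖ = 1 ∧ squeeze δ k s p = q := by
  let l := capScale δ k s
  have hden : ∀ z ∈ Set.Icc (-1 : ℝ) 1, 0 < 1 + z + l z ^ 2 * (1 - z) := fun z hz =>
    squeeze_den_pos one_pos (abs_le.2 hz) (capScale_pos δ k s z)
  let f : ℝ → ℝ := fun z => (1 + z + l z ^ 2 * (1 - z))⁻¹ * (1 + z - l z ^ 2 * (1 - z))
  have hl : Continuous l := continuous_capScale δ k s
  have hf : ContinuousOn f (Set.Icc (-1) 1) :=
    ContinuousOn.mul (ContinuousOn.inv₀ (by fun_prop) fun z hz => (hden z hz).ne') (by fun_prop)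
  have hl0 : l (-1) ≠ 0 := (capScale_pos δ k s (-1)).ne'
  have hq2 := abs_le.1 (hq ▸ abs_two_le_norm q)
  have hf1 : f (-1) = -1 := by
    simp only [f]
    field_simp
    ring
  have hf2 : f 1 = 1 := by
    simp only [f]
    norm_num
  obtain ⟨z, hz, hfz⟩ := intermediate_value_Icc (by norm_num : (-1 : ℝ) ≤ 1) hf
    (show q 2 ∈ Set.Icc (f (-1)) (f 1) by rw [hf1, hf2]; exact hq2)
  have hd := hden z hz
  have hlz : 0 < l z := capScale_pos δ k s z
  have hq1 := norm_sq_E3 q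
  rw [hq] at hq1
  let p : E3 := !₂[q 0 * (1 + z + l z ^ 2 * (1 - z)) / (2 * l z),
    q 1 * (1 + z + l z ^ 2 * (1 - z)) / (2 * l z), z]
  have hp2 : p 2 = z := rfl
  have hp : ‖p‖ = 1 := by
    have h1 : q 2 * (1 + z + l z ^ 2 * (1 - z)) = 1 + z - l z ^ 2 * (1 - z) := by
      rw [← hfz]
      simp only [f]
      field_simp
    rw [← sq_eq_sq₀ (norm_nonneg _) zero_le_one, norm_sq_E3]
    simp only [p, Matrix.cons_val]
    field_simp
    linear_combination (-(1 + z + l z ^ 2 * (1 - z)) ^ 2) * hq1 -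
      (q 2 * (1 + z + l z ^ 2 * (1 - z)) + (1 + z - l z ^ 2 * (1 - z))) * h1
  refine ⟨p, hp, ?_⟩
  rw [squeeze_of_norm_eq_one hp, hp2]
  change (1 + z + l z ^ 2 * (1 - z))⁻¹ • !₂[2 * l z * p 0, 2 * l z * p 1,
    1 + z - l z ^ 2 * (1 - z)] = q
  ext i
  fin_cases i
  · simp only [p, PiLp.smul_apply, smul_eq_mul, Matrix.cons_val, Fin.zero_eta]
    field_simp
  · simp only [p, PiLp.smul_apply, smul_eq_mul, Matrix.cons_val, Fin.mk_one]
    field_simp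
  · exact hfz

/-- Along the meridians `squeeze` is increasing with positive derivative, because the scaling factor
decreases to the north; along the parallels it is a scaling. -/
theorem squeeze_immersion {δ k s : ℝ} (hδ : 0 < δ) (hk : 0 ≤ k) (hs : 0 ≤ s) {p u : E3}
    (hp : ‖p‖ = 1) (hu : inner ℝ p u = 0) (h0 : fderiv ℝ (squeeze δ k s) p u = 0) : u = 0 := by
  have hp0 : p ≠ 0 := by
    rw [← norm_ne_zero_iff, hp]
    exact one_ne_zero
  have hopen : IsOpen {q : ℝ × E3 | q.2 ≠ 0} := isOpen_compl_singleton.preimage continuous_snd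
  have hsm : ContDiffAt ℝ ∞ (squeeze δ k s) p :=
    ((contDiffOn_squeeze δ k).contDiffAt (hopen.mem_nhds (x := (s, p)) hp0)).comp p
      (f := fun x : E3 => ((s, x) : ℝ × E3)) (by fun_prop)
  have hline : HasDerivAt (fun r : ℝ => p + r • u) u 0 := by
    simpa using ((hasDerivAt_id (0 : ℝ)).smul_const u).const_add p
  have hfd : HasFDerivAt (squeeze δ k s) (fderiv ℝ (squeeze δ k s) p) (p + (0 : ℝ) • u) := by
    simpa using (hsm.differentiableAt (by simp)).hasFDerivAt
  have hder := hfd.comp_hasDerivAt (0 : ℝ) hline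
  rw [h0] at hder
  have hcomp : ∀ i : Fin 3, HasDerivAt (fun r : ℝ => squeeze δ k s (p + r • u) i) 0 0 := by
    intro i
    exact hasDerivAt_pi.1 ((EuclideanSpace.equiv (Fin 3) ℝ).toContinuousLinearMap.hasFDerivAt.comp_hasDerivAt
      (0 : ℝ) hder) i
  have hn := hasDerivAt_norm_line hp0 hu
  have hx : ∀ i : Fin 3, HasDerivAt (fun r : ℝ => (p + r • u) i) (u i) 0 := fun i => by
    simpa using ((hasDerivAt_id (0 : ℝ)).mul_const (u i)).const_add (p i)
  have hn1 : ‖p + (0 : ℝ) • u‖ = 1 := by simpa using hp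
  have hc : HasDerivAt (fun r : ℝ => (p + r • u) 2 / ‖p + r • u‖) (u 2) 0 := by
    have := (hx 2).fun_div hn (by rw [hn1]; exact one_ne_zero)
    rw [hn1] at this
    simpa using this
  obtain ⟨m, hm, hmd⟩ : ∃ m, 0 ≤ m ∧ HasDerivAt (capBump δ) m (p 2) :=
    ⟨_, (monotone_capBump hδ).deriv_nonneg,
      ((contDiff_capBump δ).differentiable (by simp) (p 2)).hasDerivAt⟩
  set l := capScale δ k s (p 2) with hl
  have hlpos : 0 < l := capScale_pos _ _ _ _
  have hscale : HasDerivAt (fun r : ℝ => capScale δ k s ((p + r • u) 2 / ‖p + r • u‖))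
      (l * (-(s * k) * (m * u 2))) 0 := by
    have h1 : HasDerivAt (capBump δ) m ((p + (0 : ℝ) • u) 2 / ‖p + (0 : ℝ) • u‖) := by
      rw [hn1]
      simpa using hmd
    have h2 := ((h1.comp (0 : ℝ) hc).const_mul (-(s * k))).exp
    have h3 : (p + (0 : ℝ) • u) 2 / ‖p + (0 : ℝ) • u‖ = p 2 := by
      rw [hn1]
      simp
    simp only [Function.comp_def, h3] at h2
    exact h2
  have hden := (hn.fun_add (hx 2)).fun_add ((hscale.fun_pow 2).fun_mul (hn.fun_sub (hx 2)))
  have hnum := (hn.fun_add (hx 2)).fun_sub ((hscale.fun_pow 2).fun_mul (hn.fun_sub (hx 2)))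
  have hd := squeeze_den_pos one_pos (hp ▸ abs_two_le_norm p) hlpos
  have hp2 := abs_le.1 (hp ▸ abs_two_le_norm p)
  have e0 : ∀ i : Fin 3, (p + (0 : ℝ) • u) i = p i := fun i => by simp
  have el : capScale δ k s ((p + (0 : ℝ) • u) 2 / ‖p + (0 : ℝ) • u‖) = l := by
    rw [hn1, e0, div_one]
  have hd' : ‖p + (0 : ℝ) • u‖ + (p + (0 : ℝ) • u) 2 +
      capScale δ k s ((p + (0 : ℝ) • u) 2 / ‖p + (0 : ℝ) • u‖) ^ 2 *
        (‖p + (0 : ℝ) • u‖ - (p + (0 : ℝ) • u) 2) ≠ 0 := by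
    rw [el, hn1, e0]
    exact hd.ne'
  -- First the component of `u` in the direction of the meridians, from the coordinate `z`.
  have hu2 : u 2 = 0 := by
    have h1 := (hden.fun_inv hd').fun_mul hnum
    have h2 := h1.unique (hcomp 2)
    rw [el, hn1, e0] at h2
    have h3 : (2 * u 2 * l ^ 2) * (2 + 2 * ((1 - p 2) * (1 + p 2)) * (s * k * m)) = 0 := by
      field_simp at h2
      linear_combination h2
    have h4 : 0 < 2 + 2 * ((1 - p 2) * (1 + p 2)) * (s * k * m) := by
      have := mul_nonneg (mul_nonneg (by linarith [hp2.2] : 0 ≤ 1 - p 2)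
        (by linarith [hp2.1] : 0 ≤ 1 + p 2)) (mul_nonneg (mul_nonneg hs hk) hm)
      linarith
    have h5 := (mul_eq_zero.1 h3).resolve_right h4.ne'
    have h6 := (mul_eq_zero.1 h5).resolve_right (pow_pos hlpos 2).ne'
    linarith
  have hother : ∀ i : Fin 3, HasDerivAt (fun r : ℝ =>
      (‖p + r • u‖ + (p + r • u) 2 + capScale δ k s ((p + r • u) 2 / ‖p + r • u‖) ^ 2 *
        (‖p + r • u‖ - (p + r • u) 2))⁻¹ *
      (2 * capScale δ k s ((p + r • u) 2 / ‖p + r • u‖) * (p + r • u) i)) 0 0 → u i = 0 := by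
    intro i hi
    have h1 := (hden.fun_inv hd').fun_mul ((hscale.const_mul 2).fun_mul (hx i))
    have h2 := h1.unique hi
    rw [el, hn1, e0, hu2] at h2
    simp only [e0] at h2
    field_simp at h2
    simpa [hlpos.ne', hd.ne'] using h2
  ext i
  fin_cases i
  · exact hother 0 (hcomp 0)
  · exact hother 1 (hcomp 1)
  · exact hu2

theorem isSphereIsotopy_squeeze {δ k : ℝ} (hδ : 0 < δ) (hk : 0 ≤ k) :
    IsSphereIsotopy (squeeze δ k) where
  smooth := contDiffOn_squeeze δ k
  bijOn s hs := by
    refine ⟨fun p hp => ?_, fun p hp q hq h => ?_, fun q hq => ?_⟩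
    · rw [mem_sphere_zero_iff_norm] at hp ⊢
      exact norm_squeeze hp
    · rw [mem_sphere_zero_iff_norm] at hp hq
      exact squeeze_injOn hδ hk hs.1 hp hq h
    · rw [mem_sphere_zero_iff_norm] at hq
      obtain ⟨p, hp, h⟩ := squeeze_surjOn (δ := δ) (k := k) (s := s) hq
      exact ⟨p, by rwa [mem_sphere_zero_iff_norm], h⟩
  immersion s hs p hp u hu hu0 h0 :=
    hu0 (squeeze_immersion hδ hk hs.1 (mem_sphere_zero_iff_norm.1 hp) hu h0)
  start p hp := by
    rw [mem_sphere_zero_iff_norm] at hp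
    rw [squeeze_of_norm_eq_one hp]
    have : capScale δ k 0 (p 2) = 1 := by simp [capScale]
    rw [this]
    ext i
    fin_cases i <;> simp <;> ring

theorem squeeze_of_le {δ k s : ℝ} (hδ : 0 < δ) {p : E3} (hp : ‖p‖ = 1) (h : p 2 ≤ -δ) :
    squeeze δ k s p = p := by
  rw [squeeze_of_norm_eq_one hp]
  have : capScale δ k s (p 2) = 1 := by simp [capScale, capBump_of_le hδ h]
  rw [this]
  ext i
  fin_cases i <;> simp <;> ring

/-- The cap `z ≥ -δ / 2` is scaled by `exp (-k)`. -/
theorem dist_squeeze_sq_le {δ k : ℝ} (hδ : 0 < δ) (hδ' : δ ≤ 1 / 2) {p : E3}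
    (hp : ‖p‖ = 1) (h : -(δ / 2) ≤ p 2) :
    ‖squeeze δ k 1 p - !₂[0, 0, 1]‖ ^ 2 ≤ (3 * Real.exp (-k)) ^ 2 := by
  have hl : capScale δ k 1 (p 2) = Real.exp (-k) := by simp [capScale, capBump_of_ge hδ h]
  have hd := squeeze_den_pos one_pos (hp ▸ abs_two_le_norm p) (capScale_pos δ k 1 (p 2))
  have h1 := norm_squeeze (δ := δ) (k := k) (s := 1) hp
  have h2 := norm_sq_E3 (squeeze δ k 1 p)
  rw [h1] at h2
  have h3 : squeeze δ k 1 p 2 = (1 + p 2 + capScale δ k 1 (p 2) ^ 2 * (1 - p 2))⁻¹ *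
      (1 + p 2 - capScale δ k 1 (p 2) ^ 2 * (1 - p 2)) := by
    rw [squeeze_of_norm_eq_one hp]
    rfl
  have h4 : 1 - squeeze δ k 1 p 2 ≤ 4 * Real.exp (-k) ^ 2 := by
    rw [h3]
    rw [hl] at hd ⊢
    have hp2 := abs_le.1 (hp ▸ abs_two_le_norm p)
    rw [inv_mul_eq_div, sub_le_iff_le_add, ← sub_le_iff_le_add', le_div_iff₀ hd]
    generalize Real.exp (-k) = l at *
    nlinarith [sq_nonneg l, mul_nonneg (sq_nonneg (l ^ 2)) (by linarith [hp2.2] : 0 ≤ 1 - p 2),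
      mul_nonneg (sq_nonneg l) (by linarith : 0 ≤ 4 * (1 + p 2) - 2 * (1 - p 2))]
  rw [norm_sq_E3]
  simp only [PiLp.sub_apply, Matrix.cons_val, sub_zero]
  nlinarith

/-- The movement of the points of the great circle `y = 0` under `squeeze`. Writing the difference of
the angles as an arctangent makes the lift to `ℝ` smooth and equivariant. -/
noncomputable def squeezeParam (δ k t : ℝ) : ℝ :=
  t + Real.pi⁻¹ * Real.arctan ((capScale δ k 1 (Real.sin (2 * Real.pi * t)) - 1) *
    -Real.cos (2 * Real.pi * t) /
    (1 + Real.sin (2 * Real.pi * t) + capScale δ k 1 (Real.sin (2 * Real.pi * t)) *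
      (1 - Real.sin (2 * Real.pi * t))))

theorem squeezeParam_den_pos (δ k t : ℝ) :
    0 < 1 + Real.sin (2 * Real.pi * t) + capScale δ k 1 (Real.sin (2 * Real.pi * t)) *
      (1 - Real.sin (2 * Real.pi * t)) := by
  have h1 := capScale_pos δ k 1 (Real.sin (2 * Real.pi * t))
  have := squeeze_den_pos one_pos (Real.abs_sin_le_one (2 * Real.pi * t)) (Real.sqrt_pos.2 h1)
  rwa [Real.sq_sqrt h1.le] at this

theorem squeeze_circ (δ k t : ℝ) : squeeze δ k 1 (circ t) = circ (squeezeParam δ k t) := by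
  rw [squeeze_of_norm_eq_one (norm_circ t)]
  have hden := squeezeParam_den_pos δ k t
  have hden' := squeeze_den_pos one_pos (Real.abs_sin_le_one (2 * Real.pi * t))
    (capScale_pos δ k 1 (Real.sin (2 * Real.pi * t)))
  have hang : 2 * Real.pi * squeezeParam δ k t = 2 * Real.pi * t + 2 * Real.arctan
      ((capScale δ k 1 (Real.sin (2 * Real.pi * t)) - 1) * -Real.cos (2 * Real.pi * t) /
      (1 + Real.sin (2 * Real.pi * t) + capScale δ k 1 (Real.sin (2 * Real.pi * t)) *
      (1 - Real.sin (2 * Real.pi * t)))) := by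
    rw [squeezeParam]
    field_simp
  have hsc := Real.cos_sq_add_sin_sq (2 * Real.pi * t)
  simp only [circ_zero, circ_one, circ_two] at *
  set l := capScale δ k 1 (Real.sin (2 * Real.pi * t))
  set S := Real.sin (2 * Real.pi * t)
  set C := Real.cos (2 * Real.pi * t)
  set b := (l - 1) * -C / (1 + S + l * (1 - S)) with hb
  have hb1 : 0 < 1 + b ^ 2 := by positivity
  have hbb : b * (1 + S + l * (1 - S)) = (l - 1) * -C := by
    rw [hb]
    field_simp
  have h2b : (1 + b ^ 2) * (1 + S + l * (1 - S)) ^ 2 = 2 * (1 + S + l ^ 2 * (1 - S)) := by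
    have : (1 + b ^ 2) * (1 + S + l * (1 - S)) ^ 2
        = (1 + S + l * (1 - S)) ^ 2 + (b * (1 + S + l * (1 - S))) ^ 2 := by ring
    rw [this, hbb]
    linear_combination (l - 1) ^ 2 * hsc
  have hcos : Real.cos (2 * Real.arctan b) = (1 - b ^ 2) / (1 + b ^ 2) := by
    rw [Real.cos_two_mul, Real.cos_sq_arctan]
    field_simp
    ring
  have hsin : Real.sin (2 * Real.arctan b) = 2 * b / (1 + b ^ 2) := by
    have h1 : Real.sin (Real.arctan b) = b * Real.cos (Real.arctan b) := by
      rw [Real.sin_arctan, Real.cos_arctan]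
      ring
    rw [Real.sin_two_mul, h1]
    have : 2 * (b * Real.cos (Real.arctan b)) * Real.cos (Real.arctan b)
        = 2 * b * Real.cos (Real.arctan b) ^ 2 := by ring
    rw [this, Real.cos_sq_arctan]
    ring
  have hE2 : 0 < (1 + S + l * (1 - S)) ^ 2 := by positivity
  ext i
  fin_cases i
  · simp only [PiLp.smul_apply, smul_eq_mul, Matrix.cons_val, Fin.zero_eta, circ_zero, hang,
      Real.cos_add, hcos, hsin]
    change _ = -(C * _ - S * _)
    rw [inv_mul_eq_div, div_eq_iff hden'.ne']
    field_simp
    refine mul_right_cancel₀ hE2.ne' ?_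
    linear_combination (2 * l * -C) * h2b +
      ((C * (1 + S + l ^ 2 * (1 - S))) * (b * (1 + S + l * (1 - S)) + (l - 1) * -C) * (-1)
        - 2 * S * (1 + S + l ^ 2 * (1 - S)) * (1 + S + l * (1 - S))) * hbb -
      C * ((1 + S) * (1 - 2 * l) + 2 * l ^ 2 - 2 * l ^ 3 * (1 - S) + l ^ 4 * (1 - S)) * hsc
  · simp [circ]
  · simp only [PiLp.smul_apply, smul_eq_mul, Matrix.cons_val, Fin.reduceFinMk, circ_two, hang,
      Real.sin_add, hcos, hsin]
    change _ = S * _ + C * _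
    rw [inv_mul_eq_div, div_eq_iff hden'.ne']
    field_simp
    refine mul_right_cancel₀ hE2.ne' ?_
    linear_combination (1 + S - l ^ 2 * (1 - S)) * h2b -
      (1 + S + l ^ 2 * (1 - S)) * (-S * (b * (1 + S + l * (1 - S)) + (l - 1) * -C) +
        2 * C * (1 + S + l * (1 - S))) * hbb +
      (2 * S * l + 2 * S * l ^ 2 + 2 * S * l ^ 3 - 3 * S * l ^ 4 - 3 * S + 2 * S ^ 2 * l -
        2 * S ^ 2 * l ^ 3 + S ^ 2 * l ^ 4 - S ^ 2 + 2 * l ^ 4 - 2) * hsc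

/-- The derivative does not vanish, because a diffeomorphism is an immersion of the circle, and it has
the value `1` somewhere, because the lift has degree `1`. -/
theorem isCircleReparam_squeezeParam {δ k : ℝ} {g g' : E3 → E3} (hg : IsSphereDiffeo g g')
    (h : ∀ t, g (circ t) = circ (squeezeParam δ k t)) : IsCircleReparam (squeezeParam δ k) := by
  have hS : ContDiff ℝ ∞ fun t => Real.sin (2 * Real.pi * t) := by fun_prop
  have hC : ContDiff ℝ ∞ fun t => Real.cos (2 * Real.pi * t) := by fun_prop
  have hl : ContDiff ℝ ∞ fun t => capScale δ k 1 (Real.sin (2 * Real.pi * t)) :=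
    Real.contDiff_exp.comp (contDiff_const.mul ((contDiff_capBump δ).comp hS))
  have hsm : ContDiff ℝ ∞ (squeezeParam δ k) := by
    refine contDiff_id.add (contDiff_const.mul (Real.contDiff_arctan.comp (ContDiff.div ?_ ?_
      fun t => (squeezeParam_den_pos δ k t).ne')))
    · exact (hl.sub contDiff_const).mul hC.neg
    · exact (contDiff_const.add hS).add (hl.mul (contDiff_const.sub hS))
  have heq : ∀ t, squeezeParam δ k (t + 1) = squeezeParam δ k t + 1 := by
    intro t
    have h1 : 2 * Real.pi * (t + 1) = 2 * Real.pi * t + 2 * Real.pi := by ring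
    simp only [squeezeParam, h1, Real.sin_add_two_pi, Real.cos_add_two_pi]
    ring
  have hd : ∀ t, HasDerivAt (squeezeParam δ k) (deriv (squeezeParam δ k) t) t := fun t =>
    (hsm.differentiable (by simp) t).hasDerivAt
  have hne : ∀ t, deriv (squeezeParam δ k) t ≠ 0 := by
    intro t h0
    have h1 : HasDerivAt (fun t => g (circ t)) _ t :=
      hg.hasDerivAt_comp (hasDerivAt_circ t) (circ_ne_zero t)
    have h2 : HasDerivAt (fun t => circ (squeezeParam δ k t)) _ t :=
      (hasDerivAt_circ (squeezeParam δ k t)).scomp t (hd t)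
    simp only [← h, h0, zero_smul] at h2
    exact deriv_circ_ne_zero t (hg.fderiv_injective (circ_ne_zero t) (h1.unique h2))
  refine ⟨hsm, fun t => ?_, heq⟩
  obtain ⟨c, -, hc⟩ := exists_deriv_eq_slope (squeezeParam δ k) (zero_lt_one' ℝ)
    hsm.continuous.continuousOn (fun t _ => (hd t).differentiableAt.differentiableWithinAt)
  have hc1 : deriv (squeezeParam δ k) c = 1 := by
    rw [hc, ← zero_add (1 : ℝ), heq 0]
    norm_num
  by_contra hneg
  have hcont : Continuous (deriv (squeezeParam δ k)) := hsm.continuous_deriv (by simp)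
  obtain ⟨r, -, hr⟩ := isPreconnected_univ.intermediate_value (Set.mem_univ t) (Set.mem_univ c)
    hcont.continuousOn (show (0 : ℝ) ∈ Set.Icc _ _ from ⟨not_lt.1 hneg, hc1 ▸ zero_le_one⟩)
  exact hne r hr

/-- A cap of the sphere can be moved into any neighbourhood of its centre, by a diffeomorphism which
is the identity outside of a slightly larger cap, and which preserves a great circle through the
centre. -/
theorem exists_squeeze {δ : ℝ} (hδ : 0 < δ) (hδ' : δ ≤ 1 / 2) {N : Set E3}
    (hN : N ∈ nhds (!₂[0, 0, 1] : E3)) :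
    ∃ (κ κ' : E3 → E3) (τ : ℝ → ℝ), IsSphereDiffeo κ κ' ∧ LinkDiagram.PreservesIsotopy κ ∧
      IsCircleReparam τ ∧ (∀ p, ‖p‖ = 1 → p 2 ≤ -δ → κ p = p) ∧
      (∀ p, ‖p‖ = 1 → -(δ / 2) ≤ p 2 → κ p ∈ N) ∧ (∀ t, κ (circ t) = circ (τ t)) ∧
      ∀ t, Real.sin (2 * Real.pi * t) ≤ -δ → τ t = t := by
  obtain ⟨r, hr, hrN⟩ := Metric.mem_nhds_iff.1 hN
  obtain ⟨k, hk, hkr⟩ : ∃ k : ℝ, 0 ≤ k ∧ 3 * Real.exp (-k) < r := by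
    have h1 : Filter.Tendsto (fun k : ℝ => 3 * Real.exp (-k)) Filter.atTop (nhds (3 * 0)) :=
      (Real.tendsto_exp_neg_atTop_nhds_zero).const_mul 3
    rw [mul_zero] at h1
    exact ((Filter.eventually_ge_atTop 0).and (h1.eventually (gt_mem_nhds hr))).exists
  obtain ⟨κ, κ', h1, h2, h3⟩ := (isSphereIsotopy_squeeze hδ hk).exists_isSphereDiffeo
  have h4 : ∀ t, κ (circ t) = circ (squeezeParam δ k t) := fun t => by
    rw [h3 _ (norm_circ t), squeeze_circ]
  refine ⟨κ, κ', squeezeParam δ k, h1, h2, isCircleReparam_squeezeParam h1 h4, fun p hp h => ?_,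
    fun p hp h => ?_, h4, fun t ht => ?_⟩
  · rw [h3 p hp, squeeze_of_le hδ hp h]
  · rw [h3 p hp]
    apply hrN
    rw [mem_ball_iff_norm]
    exact lt_of_le_of_lt (le_of_sq_le_sq (dist_squeeze_sq_le hδ hδ' hp h) (by positivity)) hkr
  · have : capScale δ k 1 (Real.sin (2 * Real.pi * t)) = 1 := by simp [capScale, capBump_of_le hδ ht]
    simp [squeezeParam, this]

/-! ### Glued diagrams -/

namespace LinkDiagram

/-- The projected curves of `D` consist of those of `A` in the southern hemisphere and those of `B`
in the northern hemisphere, where `A` in the cap `z > -δ`, and `B` in the cap `z < δ`, is just an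
arc of the great circle `y = 0`, on the components `a` and `b`. The crossings of `A` and `B` are
also the same in `D`. The maps `α` and `β` tell which component of `D` contains a given component of
`A` or `B`. -/
structure IsGluing (δ : ℝ) (A B D : LinkDiagram) (a : A.ι) (b : B.ι) (α : A.ι → D.ι)
    (β : B.ι → D.ι) : Prop where
  pos : 0 < δ
  le_half : δ ≤ 1 / 2
  inj_left : Function.Injective α
  inj_right : Function.Injective β
  glue : α a = β b
  only_glue : ∀ i j, α i = β j → i = a ∧ j = b
  cover : ∀ k, (∃ i, α i = k) ∨ ∃ j, β j = k
  left_arc : ∀ t, -δ < Real.sin (2 * Real.pi * t) → A.shadow a t = circ t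
  left_rest : ∀ t, Real.sin (2 * Real.pi * t) ≤ -δ → A.shadow a t 2 ≤ -δ
  left_other : ∀ i, i ≠ a → ∀ t, A.shadow i t 2 ≤ -δ
  right_arc : ∀ t, Real.sin (2 * Real.pi * t) < δ → B.shadow b t = circ t
  right_rest : ∀ t, δ ≤ Real.sin (2 * Real.pi * t) → δ ≤ B.shadow b t 2
  right_other : ∀ j, j ≠ b → ∀ t, δ ≤ B.shadow j t 2
  south : ∀ t, Real.sin (2 * Real.pi * t) ≤ 0 → D.shadow (α a) t = A.shadow a t
  north : ∀ t, 0 ≤ Real.sin (2 * Real.pi * t) → D.shadow (β b) t = B.shadow b t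
  south_other : ∀ i, i ≠ a → ∀ t, D.shadow (α i) t = A.shadow i t
  north_other : ∀ j, j ≠ b → ∀ t, D.shadow (β j) t = B.shadow j t
  order_left : ∀ i s j t, A.IsCrossing i s j t →
    (A.height i s < A.height j t ↔ D.height (α i) s < D.height (α j) t)
  order_right : ∀ i s j t, B.IsCrossing i s j t →
    (B.height i s < B.height j t ↔ D.height (β i) s < D.height (β j) t)

namespace IsGluing

variable {δ : ℝ} {A B D : LinkDiagram} {a : A.ι} {b : B.ι} {α : A.ι → D.ι} {β : B.ι → D.ι}

theorem left_cases (h : IsGluing δ A B D a b α β) (i t) : A.shadow i t 2 ≤ -δ ∨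
    (i = a ∧ -δ < Real.sin (2 * Real.pi * t) ∧ A.shadow i t = circ t) := by
  by_cases hi : i = a
  · subst hi
    rcases le_or_gt (Real.sin (2 * Real.pi * t)) (-δ) with h0 | h0
    · exact Or.inl (h.left_rest t h0)
    · exact Or.inr ⟨rfl, h0, h.left_arc t h0⟩
  · exact Or.inl (h.left_other i hi t)

theorem right_cases (h : IsGluing δ A B D a b α β) (j t) : δ ≤ B.shadow j t 2 ∨
    (j = b ∧ Real.sin (2 * Real.pi * t) < δ ∧ B.shadow j t = circ t) := by
  by_cases hj : j = b
  · subst hj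
    rcases le_or_gt δ (Real.sin (2 * Real.pi * t)) with h0 | h0
    · exact Or.inl (h.right_rest t h0)
    · exact Or.inr ⟨rfl, h0, h.right_arc t h0⟩
  · exact Or.inl (h.right_other j hj t)

theorem sin_le_of_left (h : IsGluing δ A B D a b α β) {t} (h0 : A.shadow a t 2 ≤ -δ) :
    Real.sin (2 * Real.pi * t) ≤ -δ := by
  by_contra! h1
  rw [h.left_arc t h1, circ_two] at h0
  linarith

theorem le_sin_of_right (h : IsGluing δ A B D a b α β) {t} (h0 : δ ≤ B.shadow b t 2) :
    δ ≤ Real.sin (2 * Real.pi * t) := by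
  by_contra! h1
  rw [h.right_arc t h1, circ_two] at h0
  linarith

theorem shadow_left (h : IsGluing δ A B D a b α β) {i t} (h0 : A.shadow i t 2 ≤ -δ) :
    D.shadow (α i) t = A.shadow i t := by
  by_cases hi : i = a
  · subst hi
    exact h.south t ((h.sin_le_of_left h0).trans (by linarith [h.pos]))
  · exact h.south_other i hi t

theorem shadow_right (h : IsGluing δ A B D a b α β) {j t} (h0 : δ ≤ B.shadow j t 2) :
    D.shadow (β j) t = B.shadow j t := by
  by_cases hj : j = b
  · subst hj
    exact h.north t (h.pos.le.trans (h.le_sin_of_right h0))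
  · exact h.north_other j hj t

/-- The three kinds of points of a glued diagram. -/
theorem cases (h : IsGluing δ A B D a b α β) (k t) :
    (∃ i, α i = k ∧ A.shadow i t 2 ≤ -δ ∧ D.shadow k t = A.shadow i t) ∨
    (∃ j, β j = k ∧ δ ≤ B.shadow j t 2 ∧ D.shadow k t = B.shadow j t) ∨
    (k = α a ∧ -δ < Real.sin (2 * Real.pi * t) ∧ Real.sin (2 * Real.pi * t) < δ ∧
      D.shadow k t = circ t) := by
  have hpos := h.pos
  by_cases hk : k = α a
  · subst hk
    rcases le_or_gt (Real.sin (2 * Real.pi * t)) (-δ) with h0 | h0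
    · have h1 := h.left_rest t h0
      exact Or.inl ⟨a, rfl, h1, h.shadow_left h1⟩
    rcases le_or_gt δ (Real.sin (2 * Real.pi * t)) with h0' | h0'
    · have h1 := h.right_rest t h0'
      exact Or.inr (Or.inl ⟨b, h.glue.symm, h1, h.glue ▸ h.shadow_right h1⟩)
    · refine Or.inr (Or.inr ⟨rfl, h0, h0', ?_⟩)
      rcases le_total (Real.sin (2 * Real.pi * t)) 0 with h1 | h1
      · rw [h.south t h1, h.left_arc t h0]
      · rw [h.glue, h.north t h1, h.right_arc t h0']
  · rcases h.cover k with ⟨i, rfl⟩ | ⟨j, rfl⟩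
    · have hi : i ≠ a := fun hi => hk (congrArg α hi)
      have h1 := h.left_other i hi t
      exact Or.inl ⟨i, rfl, h1, h.shadow_left h1⟩
    · have hj : j ≠ b := fun hj => hk ((congrArg β hj).trans h.glue.symm)
      have h1 := h.right_other j hj t
      exact Or.inr (Or.inl ⟨j, rfl, h1, h.shadow_right h1⟩)

/-- The arc of `A` in the northern hemisphere has no crossings. -/
theorem left_le_of_isCrossing (h : IsGluing δ A B D a b α β) {i s j t}
    (hc : A.IsCrossing i s j t) : A.shadow i s 2 ≤ -δ := by
  rcases h.left_cases i s with h1 | ⟨rfl, h1, h2⟩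
  · exact h1
  rcases h.left_cases j t with h3 | ⟨rfl, h3, h4⟩
  · rwa [hc.1]
  · have h5 := hc.1
    rw [h2, h4, circ_eq_iff] at h5
    exact absurd ⟨rfl, h5⟩ hc.2

theorem right_ge_of_isCrossing (h : IsGluing δ A B D a b α β) {i s j t}
    (hc : B.IsCrossing i s j t) : δ ≤ B.shadow i s 2 := by
  rcases h.right_cases i s with h1 | ⟨rfl, h1, h2⟩
  · exact h1
  rcases h.right_cases j t with h3 | ⟨rfl, h3, h4⟩
  · rwa [hc.1]
  · have h5 := hc.1
    rw [h2, h4, circ_eq_iff] at h5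
    exact absurd ⟨rfl, h5⟩ hc.2

theorem isCrossing_left (h : IsGluing δ A B D a b α β) {i s j t} (hc : A.IsCrossing i s j t) :
    D.IsCrossing (α i) s (α j) t := by
  refine ⟨?_, fun h1 => hc.2 ⟨h.inj_left h1.1, h1.2⟩⟩
  rw [h.shadow_left (h.left_le_of_isCrossing hc),
    h.shadow_left (h.left_le_of_isCrossing hc.symm), hc.1]

theorem isCrossing_right (h : IsGluing δ A B D a b α β) {i s j t} (hc : B.IsCrossing i s j t) :
    D.IsCrossing (β i) s (β j) t := by
  refine ⟨?_, fun h1 => hc.2 ⟨h.inj_right h1.1, h1.2⟩⟩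
  rw [h.shadow_right (h.right_ge_of_isCrossing hc),
    h.shadow_right (h.right_ge_of_isCrossing hc.symm), hc.1]

/-- Each crossing of a glued diagram is a crossing of one of its two parts. -/
theorem isCrossing_cases (h : IsGluing δ A B D a b α β) {k s l t} (hc : D.IsCrossing k s l t) :
    (∃ i j, α i = k ∧ α j = l ∧ A.IsCrossing i s j t) ∨
      ∃ i j, β i = k ∧ β j = l ∧ B.IsCrossing i s j t := by
  have hpos := h.pos
  obtain ⟨hc1, hc2⟩ := hc
  rcases h.cases k s with ⟨i, rfl, h1, h2⟩ | ⟨i, rfl, h1, h2⟩ | ⟨rfl, h1, h1', h2⟩ <;>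
  rcases h.cases l t with ⟨j, rfl, h3, h4⟩ | ⟨j, rfl, h3, h4⟩ | ⟨rfl, h3, h3', h4⟩ <;>
  rw [h2, h4] at hc1
  · exact Or.inl ⟨i, j, rfl, rfl, hc1, fun h5 => hc2 ⟨congrArg α h5.1, h5.2⟩⟩
  · rw [hc1] at h1
    linarith
  · rw [hc1, circ_two] at h1
    linarith
  · rw [hc1] at h1
    linarith
  · exact Or.inr ⟨i, j, rfl, rfl, hc1, fun h5 => hc2 ⟨congrArg β h5.1, h5.2⟩⟩
  · rw [hc1, circ_two] at h1
    linarith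
  · rw [← hc1, circ_two] at h3
    linarith
  · rw [← hc1, circ_two] at h3
    linarith
  · exact absurd ⟨rfl, circ_eq_iff.1 hc1⟩ hc2

theorem rot (h : IsGluing δ A B D a b α β) : IsGluing δ A.rot B.rot D.rot a b α β where
  pos := h.pos
  le_half := h.le_half
  inj_left := h.inj_left
  inj_right := h.inj_right
  glue := h.glue
  only_glue := h.only_glue
  cover := h.cover
  left_arc t ht := by
    rw [shadow_rot, h.left_arc t ht, reflY_eq_self_iff, circ_one]
  left_rest t ht := by
    rw [shadow_rot]
    exact h.left_rest t ht
  left_other i hi t := by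
    rw [shadow_rot]
    exact h.left_other i hi t
  right_arc t ht := by
    rw [shadow_rot, h.right_arc t ht, reflY_eq_self_iff, circ_one]
  right_rest t ht := by
    rw [shadow_rot]
    exact h.right_rest t ht
  right_other i hi t := by
    rw [shadow_rot]
    exact h.right_other i hi t
  south t ht := by rw [shadow_rot, shadow_rot, h.south t ht]
  north t ht := by rw [shadow_rot, shadow_rot, h.north t ht]
  south_other i hi t := by rw [shadow_rot, shadow_rot, h.south_other i hi t]
  north_other i hi t := by rw [shadow_rot, shadow_rot, h.north_other i hi t]
  order_left i s j t hc := by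
    rw [height_rot_lt, height_rot_lt]
    exact h.order_left _ _ _ _ ((isCrossing_rot A i s j t).1 hc).symm
  order_right i s j t hc := by
    rw [height_rot_lt, height_rot_lt]
    exact h.order_right _ _ _ _ ((isCrossing_rot B i s j t).1 hc).symm

end IsGluing

/-- `D` is a connected sum of `A` and `B`, where all diagrams are considered up to `Equi`. -/
def IsSum (A B D : LinkDiagram) : Prop :=
  ∃ (A' B' D' : LinkDiagram) (δ : ℝ) (a : A'.ι) (b : B'.ι) (α : A'.ι → D'.ι) (β : B'.ι → D'.ι),
    A.Equi A' ∧ B.Equi B' ∧ D.Equi D' ∧ IsGluing δ A' B' D' a b α β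

theorem IsSum.rot {A B D : LinkDiagram} (h : IsSum A B D) : IsSum A.rot B.rot D.rot := by
  obtain ⟨A', B', D', δ, a, b, α, β, hA, hB, hD, h⟩ := h
  exact ⟨A'.rot, B'.rot, D'.rot, δ, a, b, α, β, hA.rot, hB.rot, hD.rot, h.rot⟩

/-! ### Connected sums are glued diagrams -/

theorem shadow_of_curve {K : OrientedLink} {i : K.ι} {s t : ℝ} (h : K.curve i t = greatCircle s) :
    K.shadow i t = circ s := by
  have h1 : greatCircle s = (circ s, 0) := rfl
  simp [OrientedLink.shadow, h, h1, norm_circ]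

theorem sin_two_pi_sub_int (t : ℝ) (n : ℤ) :
    Real.sin (2 * Real.pi * (t - n)) = Real.sin (2 * Real.pi * t) := by
  have : 2 * Real.pi * (t - n) = 2 * Real.pi * t - n * (2 * Real.pi) := by ring
  rw [this, Real.sin_sub_int_mul_two_pi]

theorem circ_sub_int (t : ℝ) (n : ℤ) : circ (t - n) = circ t :=
  circ_eq_iff.2 ⟨n, by ring⟩

theorem periodic_sub_int {X : Type*} {f : ℝ → X} (hf : Function.Periodic f 1) (t : ℝ) (n : ℤ) :
    f (t - n) = f t := by
  have := hf.sub_int_mul_eq (x := t) n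
  rwa [mul_one] at this

/-- Each real number has a translate by an integer in a given interval of length `1`. -/
theorem exists_int_sub_mem (t c : ℝ) : ∃ n : ℤ, t - n ∈ Set.Icc c (c + 1) :=
  ⟨⌊t - c⌋, by linarith [Int.floor_le (t - c)], by linarith [Int.lt_floor_add_one (t - c)]⟩

theorem sin_le_of_mem {t : ℝ} (h : t ∈ Set.Icc (7 / 12 : ℝ) (11 / 12)) :
    Real.sin (2 * Real.pi * t) ≤ -1 / 2 := by
  have hpi := Real.pi_pos
  have h1 : Real.sin (2 * Real.pi * t) = -Real.cos (2 * Real.pi * t - 3 * Real.pi / 2) := by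
    have : 2 * Real.pi * t - 3 * Real.pi / 2
        = 2 * Real.pi * t + Real.pi / 2 - 2 * Real.pi := by ring
    rw [this, Real.cos_sub_two_pi, Real.cos_add_pi_div_two, neg_neg]
  have h2 : Real.cos (Real.pi / 3) ≤ Real.cos |2 * Real.pi * t - 3 * Real.pi / 2| := by
    apply Real.cos_le_cos_of_nonneg_of_le_pi (abs_nonneg _) (by linarith)
    rw [abs_le]
    constructor <;> nlinarith [h.1, h.2]
  rw [Real.cos_abs, Real.cos_pi_div_three] at h2
  rw [h1]
  linarith

theorem le_sin_of_mem {t : ℝ} (h : t ∈ Set.Icc (1 / 12 : ℝ) (5 / 12)) :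
    1 / 2 ≤ Real.sin (2 * Real.pi * t) := by
  have h1 := sin_le_of_mem (t := t + 1 / 2) ⟨by linarith [h.1], by linarith [h.2]⟩
  have h2 : 2 * Real.pi * (t + 1 / 2) = 2 * Real.pi * t + Real.pi := by ring
  rw [h2, Real.sin_add_pi] at h1
  linarith

open Classical in
theorem IsGluedSum.isGluing {A B D : LinkDiagram} (h : IsGluedSum A B D) :
    ∃ a b α β, IsGluing (1 / 2) A B D a b α β := by
  obtain ⟨a, b, c, f, hA1, hA2, hA3, hB1, hB2, hB3, hD1, hD2, hD3, hD4⟩ := h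
  have hAarc : ∀ t, -(1 / 2) < Real.sin (2 * Real.pi * t) → A.shadow a t = circ t := by
    intro t ht
    obtain ⟨n, hn⟩ := exists_int_sub_mem t (-1 / 12)
    rw [← periodic_sub_int (A.periodic_shadow a) t n, ← circ_sub_int t n]
    rw [← sin_two_pi_sub_int t n] at ht
    rcases le_or_gt (t - n) (7 / 12) with h1 | h1
    · exact shadow_of_curve (hA1 _ ⟨hn.1, h1⟩)
    · have := sin_le_of_mem (t := t - n) ⟨h1.le, by linarith [hn.2]⟩
      linarith
  have hArest : ∀ t, Real.sin (2 * Real.pi * t) ≤ -(1 / 2) → A.shadow a t 2 ≤ -(1 / 2) := by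
    intro t ht
    obtain ⟨n, hn⟩ := exists_int_sub_mem t (-1 / 12)
    rw [← periodic_sub_int (A.periodic_shadow a) t n]
    rw [← sin_two_pi_sub_int t n] at ht
    rcases le_or_gt (t - n) (7 / 12) with h1 | h1
    · rw [shadow_of_curve (hA1 _ ⟨hn.1, h1⟩)]
      exact ht
    · have := hA2 (t - n) ⟨h1.le, by linarith [hn.2]⟩
      linarith
  have hBarc : ∀ t, Real.sin (2 * Real.pi * t) < 1 / 2 → B.shadow b t = circ t := by
    intro t ht
    obtain ⟨n, hn⟩ := exists_int_sub_mem t (1 / 12)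
    rw [← periodic_sub_int (B.periodic_shadow b) t n, ← circ_sub_int t n]
    rw [← sin_two_pi_sub_int t n] at ht
    rcases le_or_gt (5 / 12) (t - n) with h1 | h1
    · exact shadow_of_curve (hB1 _ ⟨h1, by linarith [hn.2]⟩)
    · have := le_sin_of_mem (t := t - n) ⟨hn.1, h1.le⟩
      linarith
  have hBrest : ∀ t, 1 / 2 ≤ Real.sin (2 * Real.pi * t) → 1 / 2 ≤ B.shadow b t 2 := by
    intro t ht
    obtain ⟨n, hn⟩ := exists_int_sub_mem t (1 / 12)
    rw [← periodic_sub_int (B.periodic_shadow b) t n]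
    rw [← sin_two_pi_sub_int t n] at ht
    rcases le_or_gt (5 / 12) (t - n) with h1 | h1
    · rw [shadow_of_curve (hB1 _ ⟨h1, by linarith [hn.2]⟩)]
      exact ht
    · exact hB2 (t - n) ⟨hn.1, h1.le⟩
  have hcurve : ∀ (t : ℝ), (D.curve c t = B.curve b t ∧ 0 ≤ Real.sin (2 * Real.pi * t)) ∨
      (D.curve c t = A.curve a t ∧ Real.sin (2 * Real.pi * t) ≤ 0) := by
    intro t
    have hpi := Real.pi_pos
    obtain ⟨n, hn⟩ := exists_int_sub_mem t 0
    rw [← periodic_sub_int (D.isLink.periodic c) t n, ← periodic_sub_int (A.isLink.periodic a) t n,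
      ← periodic_sub_int (B.isLink.periodic b) t n, ← sin_two_pi_sub_int t n]
    have hn1 := hn.1
    have hn2 := hn.2
    rcases le_total (t - n) (1 / 2) with h1 | h1
    · exact Or.inl ⟨hD1 _ ⟨hn.1, h1⟩, Real.sin_nonneg_of_nonneg_of_le_pi (by positivity)
        (by nlinarith)⟩
    · refine Or.inr ⟨hD2 _ ⟨h1, by linarith [hn.2]⟩, ?_⟩
      have h2 : 0 ≤ Real.sin (2 * Real.pi * (t - n) - Real.pi) :=
        Real.sin_nonneg_of_nonneg_of_le_pi (by nlinarith) (by nlinarith)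
      rw [Real.sin_sub_pi] at h2
      linarith
  have hcurve' : ∀ (i : A.ι) (j : D.ι) (s t : ℝ), D.curve j t = A.curve i s →
      D.shadow j t = A.shadow i s ∧ D.height j t = A.height i s := fun i j s t h =>
    ⟨by rw [OrientedLink.shadow, OrientedLink.shadow, h],
      by rw [OrientedLink.height, OrientedLink.height, h]⟩
  have hcurve'' : ∀ (i : B.ι) (j : D.ι) (s t : ℝ), D.curve j t = B.curve i s →
      D.shadow j t = B.shadow i s ∧ D.height j t = B.height i s := fun i j s t h =>
    ⟨by rw [OrientedLink.shadow, OrientedLink.shadow, h],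
      by rw [OrientedLink.height, OrientedLink.height, h]⟩
  have hsouth : ∀ t, Real.sin (2 * Real.pi * t) ≤ 0 → D.shadow c t = A.shadow a t := by
    intro t ht
    rcases hcurve t with ⟨h1, h2⟩ | ⟨h1, h2⟩
    · rw [(hcurve'' _ _ _ _ h1).1, hAarc t (by linarith), hBarc t (by linarith)]
    · exact (hcurve' _ _ _ _ h1).1
  have hnorth : ∀ t, 0 ≤ Real.sin (2 * Real.pi * t) → D.shadow c t = B.shadow b t := by
    intro t ht
    rcases hcurve t with ⟨h1, h2⟩ | ⟨h1, h2⟩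
    · exact (hcurve'' _ _ _ _ h1).1
    · rw [(hcurve' _ _ _ _ h1).1, hAarc t (by linarith), hBarc t (by linarith)]
  let α : A.ι → D.ι := fun i => if hi : i = a then c else f (Sum.inl ⟨i, hi⟩)
  let β : B.ι → D.ι := fun j => if hj : j = b then c else f (Sum.inr ⟨j, hj⟩)
  have hαa : α a = c := dif_pos rfl
  have hβb : β b = c := dif_pos rfl
  have hα : ∀ i (hi : i ≠ a), α i = f (Sum.inl ⟨i, hi⟩) := fun i hi => dif_neg hi
  have hβ : ∀ j (hj : j ≠ b), β j = f (Sum.inr ⟨j, hj⟩) := fun j hj => dif_neg hj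
  have hheight : ∀ i t, A.shadow i t 2 ≤ -(1 / 2) → D.height (α i) t = A.height i t := by
    intro i t ht
    by_cases hi : i = a
    · subst hi
      have h0 : Real.sin (2 * Real.pi * t) < 0 := by
        by_contra! h1
        rw [hAarc t (by linarith), circ_two] at ht
        linarith
      rcases hcurve t with ⟨h1, h2⟩ | ⟨h1, h2⟩
      · linarith
      · rw [hαa, (hcurve' _ _ _ _ h1).2]
    · rw [hα i hi]
      exact (hcurve' _ _ _ _ (hD3 ⟨i, hi⟩ t)).2
  have hheight' : ∀ i t, 1 / 2 ≤ B.shadow i t 2 → D.height (β i) t = B.height i t := by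
    intro i t ht
    by_cases hi : i = b
    · subst hi
      have h0 : 0 < Real.sin (2 * Real.pi * t) := by
        by_contra! h1
        rw [hBarc t (by linarith), circ_two] at ht
        linarith
      rcases hcurve t with ⟨h1, h2⟩ | ⟨h1, h2⟩
      · rw [hβb, (hcurve'' _ _ _ _ h1).2]
      · linarith
    · rw [hβ i hi]
      exact (hcurve'' _ _ _ _ (hD4 ⟨i, hi⟩ t)).2
  refine ⟨a, b, α, β, ?_⟩
  have hstep : (∀ i s j t, A.IsCrossing i s j t → A.shadow i s 2 ≤ -(1 / 2)) := by
    intro i s j t hc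
    by_contra! h0
    have hcase : ∀ i s, -(1 / 2) < A.shadow i s 2 → i = a ∧ A.shadow i s = circ s := by
      intro i s h0
      by_cases hi : i = a
      · subst hi
        refine ⟨rfl, hAarc s ?_⟩
        by_contra! h1
        linarith [hArest s h1]
      · linarith [hA3 i hi s]
    obtain ⟨rfl, h1⟩ := hcase i s h0
    obtain ⟨rfl, h2⟩ := hcase j t (hc.1 ▸ h0)
    exact hc.2 ⟨rfl, circ_eq_iff.1 (h1.symm.trans (hc.1.trans h2))⟩
  have hstep' : (∀ i s j t, B.IsCrossing i s j t → 1 / 2 ≤ B.shadow i s 2) := by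
    intro i s j t hc
    by_contra! h0
    have hcase : ∀ i s, B.shadow i s 2 < 1 / 2 → i = b ∧ B.shadow i s = circ s := by
      intro i s h0
      by_cases hi : i = b
      · subst hi
        refine ⟨rfl, hBarc s ?_⟩
        by_contra! h1
        linarith [hBrest s h1]
      · linarith [hB3 i hi s]
    obtain ⟨rfl, h1⟩ := hcase i s h0
    obtain ⟨rfl, h2⟩ := hcase j t (hc.1 ▸ h0)
    exact hc.2 ⟨rfl, circ_eq_iff.1 (h1.symm.trans (hc.1.trans h2))⟩
  refine ⟨by norm_num, le_rfl, ?_, ?_, hαa.trans hβb.symm, ?_, ?_, hAarc, hArest, ?_, hBarc, hBrest,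
    ?_, fun t ht => by rw [hαa, hsouth t ht], fun t ht => by rw [hβb, hnorth t ht], ?_, ?_, ?_, ?_⟩
  · intro i j hij
    by_cases hi : i = a <;> by_cases hj : j = a
    · rw [hi, hj]
    · rw [hi, hαa, hα j hj] at hij
      exact absurd hij.symm (f _).2
    · rw [hj, hαa, hα i hi] at hij
      exact absurd hij (f _).2
    · rw [hα i hi, hα j hj] at hij
      have := f.injective (Subtype.ext hij)
      simpa using this
  · intro i j hij
    by_cases hi : i = b <;> by_cases hj : j = b
    · rw [hi, hj]
    · rw [hi, hβb, hβ j hj] at hij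
      exact absurd hij.symm (f _).2
    · rw [hj, hβb, hβ i hi] at hij
      exact absurd hij (f _).2
    · rw [hβ i hi, hβ j hj] at hij
      have := f.injective (Subtype.ext hij)
      simpa using this
  · intro i j hij
    by_cases hi : i = a <;> by_cases hj : j = b
    · exact ⟨hi, hj⟩
    · rw [hi, hαa, hβ j hj] at hij
      exact absurd hij.symm (f _).2
    · rw [hj, hβb, hα i hi] at hij
      exact absurd hij (f _).2
    · rw [hα i hi, hβ j hj] at hij
      have := f.injective (Subtype.ext hij)
      simp at this
  · intro k
    by_cases hk : k = c
    · exact Or.inl ⟨a, hαa.trans hk.symm⟩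
    · obtain ⟨x, hx⟩ := f.surjective ⟨k, hk⟩
      rcases x with ⟨i, hi⟩ | ⟨j, hj⟩
      · exact Or.inl ⟨i, by rw [hα i hi, hx]⟩
      · exact Or.inr ⟨j, by rw [hβ j hj, hx]⟩
  · intro i hi t
    linarith [hA3 i hi t]
  · exact fun j hj t => hB3 j hj t
  · intro i hi t
    rw [hα i hi]
    exact (hcurve' _ _ _ _ (hD3 ⟨i, hi⟩ t)).1
  · intro j hj t
    rw [hβ j hj]
    exact (hcurve'' _ _ _ _ (hD4 ⟨j, hj⟩ t)).1
  · intro i s j t hc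
    rw [hheight i s (hstep _ _ _ _ hc), hheight j t (hstep _ _ _ _ hc.symm)]
  · intro i s j t hc
    rw [hheight' i s (hstep' _ _ _ _ hc), hheight' j t (hstep' _ _ _ _ hc.symm)]

theorem IsConnectedSum.isSum {A B D : LinkDiagram} (h : IsConnectedSum A B D) : IsSum A B D := by
  obtain ⟨A', B', D', hA, hB, hD, h⟩ := h
  obtain ⟨a, b, α, β, h⟩ := h.isGluing
  exact ⟨A', B', D', _, a, b, α, β, hA.equi, hB.equi, hD.equi, h⟩

/-! ### Connected sums are symmetric -/

/-- The rotation of `ℝ³` by the angle `π s` about the axis of the coordinate `y`. -/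
noncomputable def spin (s : ℝ) (x : E3) : E3 :=
  !₂[Real.cos (Real.pi * s) * x 0 - Real.sin (Real.pi * s) * x 2, x 1,
    Real.sin (Real.pi * s) * x 0 + Real.cos (Real.pi * s) * x 2]

theorem norm_spin (s : ℝ) (x : E3) : ‖spin s x‖ = ‖x‖ := by
  rw [← sq_eq_sq₀ (norm_nonneg _) (norm_nonneg _), norm_sq_E3, norm_sq_E3]
  simp only [spin, Matrix.cons_val]
  linear_combination (x 0 ^ 2 + x 2 ^ 2) * Real.cos_sq_add_sin_sq (Real.pi * s)

theorem spin_neg_spin (s : ℝ) (x : E3) : spin (-s) (spin s x) = x := by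
  have h := Real.cos_sq_add_sin_sq (Real.pi * s)
  ext i
  fin_cases i
  · simp only [spin, mul_neg, Real.cos_neg, Real.sin_neg, Matrix.cons_val, Fin.zero_eta]
    linear_combination x 0 * h
  · rfl
  · simp only [spin, mul_neg, Real.cos_neg, Real.sin_neg, Matrix.cons_val, Fin.reduceFinMk]
    linear_combination x 2 * h

theorem isSphereIsotopy_spin : IsSphereIsotopy spin where
  smooth := by
    apply ContDiff.contDiffOn
    rw [contDiff_euclidean]
    intro i
    fin_cases i <;> simp only [spin, Matrix.cons_val, Fin.zero_eta, Fin.mk_one, Fin.reduceFinMk] <;>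
      fun_prop
  bijOn s _ := by
    refine ⟨fun p hp => ?_, fun p _ q _ h => ?_, fun q hq => ⟨spin (-s) q, ?_, ?_⟩⟩
    · rwa [mem_sphere_zero_iff_norm, norm_spin, ← mem_sphere_zero_iff_norm]
    · rw [← spin_neg_spin s p, h, spin_neg_spin]
    · rwa [mem_sphere_zero_iff_norm, norm_spin, ← mem_sphere_zero_iff_norm]
    · have := spin_neg_spin (-s) q
      rwa [neg_neg] at this
  immersion s _ p _ u _ hu h := by
    let L : E3 →L[ℝ] E3 := LinearMap.toContinuousLinearMap
      { toFun := spin s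
        map_add' := fun x y => by
          ext i
          fin_cases i <;> simp [spin] <;> ring
        map_smul' := fun r x => by
          ext i
          fin_cases i <;> simp [spin] <;> ring }
    have h1 : fderiv ℝ (spin s) p = L := L.hasFDerivAt.fderiv
    rw [h1] at h
    apply hu
    have h2 : spin s u = 0 := h
    rw [← norm_eq_zero, ← norm_spin s u, h2, norm_zero]
  start p _ := by
    ext i
    fin_cases i <;> simp [spin]

theorem isCircleReparam_add_half : IsCircleReparam fun t => t + 1 / 2 :=
  ⟨by fun_prop, fun t => by simp, fun t => by ring⟩

theorem sin_add_half (t : ℝ) :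
    Real.sin (2 * Real.pi * (t + 1 / 2)) = -Real.sin (2 * Real.pi * t) := by
  have : 2 * Real.pi * (t + 1 / 2) = 2 * Real.pi * t + Real.pi := by ring
  rw [this, Real.sin_add_pi]

theorem spin_one_circ (t : ℝ) : spin 1 (circ (t + 1 / 2)) = circ t := by
  have : 2 * Real.pi * (t + 1 / 2) = 2 * Real.pi * t + Real.pi := by ring
  simp only [spin, circ, this, Real.cos_add_pi, Real.sin_add_pi]
  ext i
  fin_cases i <;> simp

theorem spin_one_two (x : E3) : spin 1 x 2 = -x 2 := by simp [spin]

/-- The rotation by `π` about the axis of `y` exchanges the two hemispheres. -/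
theorem IsSum.symm {A B D : LinkDiagram} (h : IsSum A B D) : IsSum B A D := by
  obtain ⟨A', B', D', δ, a, b, α, β, hA, hB, hD, h⟩ := h
  obtain ⟨g, g', hg, hi, hgs⟩ := isSphereIsotopy_spin.exists_isSphereDiffeo
  have hs : ∀ (K : LinkDiagram) i t, (K.map hg fun _ => isCircleReparam_add_half).shadow i t
      = spin 1 (K.shadow i (t + 1 / 2)) := by
    intro K i t
    rw [shadow_map, hgs _ (K.norm_shadow i _)]
  have ho : ∀ (K : LinkDiagram) i s j t,
      (K.map hg fun _ => isCircleReparam_add_half).height i s <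
        (K.map hg fun _ => isCircleReparam_add_half).height j t ↔
      K.height i (s + 1 / 2) < K.height j (t + 1 / 2) := fun K i s j t => height_map_lt _ _ _ _ _ _
  have hcr : ∀ (K : LinkDiagram) i s j t,
      (K.map hg fun _ => isCircleReparam_add_half).IsCrossing i s j t →
      K.IsCrossing i (s + 1 / 2) j (t + 1 / 2) := fun K i s j t h =>
    (isCrossing_map (D := K) hg (fun _ => isCircleReparam_add_half) i s j t).1 h
  refine ⟨B'.map hg fun _ => isCircleReparam_add_half, A'.map hg fun _ => isCircleReparam_add_half,
    D'.map hg fun _ => isCircleReparam_add_half, δ, b, a, β, α,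
    hB.trans (equi_map _ hg hi fun _ => isCircleReparam_add_half),
    hA.trans (equi_map _ hg hi fun _ => isCircleReparam_add_half),
    hD.trans (equi_map _ hg hi fun _ => isCircleReparam_add_half), ?_⟩
  constructor
  · exact h.pos
  · exact h.le_half
  · exact h.inj_right
  · exact h.inj_left
  · exact h.glue.symm
  · exact fun i j hij => (h.only_glue j i hij.symm).symm
  · exact fun k => (h.cover k).symm
  · intro t ht
    rw [hs, h.right_arc _ (by rw [sin_add_half]; linarith), spin_one_circ]
  · intro t ht
    rw [hs, spin_one_two]
    linarith [h.right_rest (t + 1 / 2) (by rw [sin_add_half]; linarith)]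
  · intro i hi t
    rw [hs, spin_one_two]
    linarith [h.right_other i hi (t + 1 / 2)]
  · intro t ht
    rw [hs, h.left_arc _ (by rw [sin_add_half]; linarith), spin_one_circ]
  · intro t ht
    rw [hs, spin_one_two]
    linarith [h.left_rest (t + 1 / 2) (by rw [sin_add_half]; linarith)]
  · intro i hi t
    rw [hs, spin_one_two]
    linarith [h.left_other i hi (t + 1 / 2)]
  · intro t ht
    rw [hs, hs, h.north _ (by rw [sin_add_half]; linarith)]
  · intro t ht
    rw [hs, hs, h.south _ (by rw [sin_add_half]; linarith)]
  · intro i hi t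
    rw [hs, hs, h.north_other i hi]
  · intro i hi t
    rw [hs, hs, h.south_other i hi]
  · intro i s j t hc
    rw [ho, ho]
    exact h.order_right i _ j _ (hcr B' i s j t hc)
  · intro i s j t hc
    rw [ho, ho]
    exact h.order_left i _ j _ (hcr A' i s j t hc)

end LinkDiagram

/-! ### Flips of a summand -/

namespace LinkDiagram

/-- `D` moved by a diffeomorphism of `S²`. -/
@[reducible] noncomputable def move (D : LinkDiagram) {g g' : E3 → E3} (hg : IsSphereDiffeo g g') :
    LinkDiagram :=
  D.map hg fun _ => IsCircleReparam.id

section move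

variable (D : LinkDiagram) {g g' : E3 → E3} (hg : IsSphereDiffeo g g')

theorem shadow_move (i : D.ι) (t : ℝ) : (D.move hg).shadow i t = g (D.shadow i t) :=
  shadow_map (D := D) hg _ i t

theorem height_move_lt (i : D.ι) (s : ℝ) (j : D.ι) (t : ℝ) :
    (D.move hg).height i s < (D.move hg).height j t ↔ D.height i s < D.height j t :=
  height_map_lt (D := D) hg _ i s j t

theorem isCrossing_move (i : D.ι) (s : ℝ) (j : D.ι) (t : ℝ) :
    (D.move hg).IsCrossing i s j t ↔ D.IsCrossing i s j t :=
  isCrossing_map (D := D) hg _ i s j t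

theorem equi_move (hi : PreservesIsotopy g) : D.Equi (D.move hg) :=
  D.equi_map hg hi _

end move

namespace IsGluing

variable {δ : ℝ} {A B D : LinkDiagram} {a : A.ι} {b : B.ι} {α : A.ι → D.ι} {β : B.ι → D.ι}
  {g g' : E3 → E3} {l : ℝ × ℝ} {ε m : ℝ}

theorem isFlat_move (h : IsGluing δ A B D a b α β) (hg : IsSphereDiffeo g g')
    (hA : (A.move hg).IsFlat l ε) (hm : ∀ p, ‖p‖ = 1 → -(δ / 2) ≤ p 2 → m ≤ lin l (g p)) :
    (D.move hg).IsFlat l (min ε m) := by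
  have hδ := h.pos
  intro k t ht
  obtain ⟨ht1, ht2⟩ := lt_min_iff.1 ht
  rw [shadow_move] at ht1 ht2 ⊢
  have hcap : ¬ -(δ / 2) ≤ D.shadow k t 2 := fun h1 =>
    (ht2.trans_le (hm _ (D.norm_shadow k t) h1)).not_ge (le_abs_self _)
  have hleft : ∀ i, D.shadow k t = A.shadow i t → g (D.shadow k t) 1 = 0 := by
    intro i h1
    rw [h1, ← shadow_move A hg] at ht1 ⊢
    exact hA i t ht1
  rcases h.cases k t with ⟨i, -, -, h1⟩ | ⟨j, -, h1, h2⟩ | ⟨-, h1, -, h2⟩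
  · exact hleft i h1
  · rw [h2] at hcap
    linarith
  · exact hleft a (h2.trans (h.left_arc t h1).symm)

/-- If the cap of `A` that is replaced in the gluing does not meet the half space of a flip, then
this flip of `A` is also a flip of the glued diagram `D`, and the flipped `D` is glued from the
flipped `A` and the unchanged `B`. Here `g` moves the diagrams into a position where the flip is
given by a linear form. -/
theorem of_isFlip (h : IsGluing δ A B D a b α β) (hg : IsSphereDiffeo g g')
    {A₂ D₂ : LinkDiagram} {e : (A.move hg).ι ≃ A₂.ι} {d : (D.move hg).ι ≃ D₂.ι}
    (hA : IsFlip l ε (A.move hg) A₂ e) (hD : IsFlip l (min ε m) (D.move hg) D₂ d)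
    (hm : ∀ p, ‖p‖ = 1 → -(δ / 2) ≤ p 2 → m ≤ lin l (g p)) :
    IsGluing (δ / 2) (A₂.move hg.symm) B (D₂.move hg.symm) (e a) b
      (fun i => d (α (e.symm i))) (fun j => d (β j)) := by
  have hδ := h.pos
  have hε := hA.pos
  have hm0 : 0 < m := hD.pos.trans_le (min_le_right _ _)
  have hAcap : ∀ i t, -(δ / 2) ≤ A.shadow i t 2 → A₂.shadow (e i) t = g (A.shadow i t) := by
    intro i t h1
    have h2 := hm _ (A.norm_shadow i t) h1
    rw [hA.kept i t, shadow_move]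
    rw [shadow_move]
    linarith
  have hDcap : ∀ i t, -(δ / 2) ≤ D.shadow i t 2 → D₂.shadow (d i) t = g (D.shadow i t) := by
    intro i t h1
    have h2 := hm _ (D.norm_shadow i t) h1
    have h3 := hD.pos
    rw [hD.kept i t, shadow_move]
    rw [shadow_move]
    linarith
  have hAsouth : ∀ i t, A.shadow i t 2 ≤ -(δ / 2) →
      (A₂.move hg.symm).shadow (e i) t 2 ≤ -(δ / 2) := by
    intro i t h1
    by_contra! h2
    -- In the cap, the flipped diagram agrees with the original one.
    have h3 : A₂.shadow (e i) t = g (A.shadow i t) := by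
      have h4 := hm _ ((A₂.move hg.symm).norm_shadow (e i) t) h2.le
      rw [shadow_move, hg.right_inv, hA.lin_shadow] at h4
      rw [hA.kept i t (by linarith), shadow_move]
    rw [shadow_move, h3, hg.left_inv] at h2
    linarith
  have hsame : ∀ i t, D.shadow (α i) t = A.shadow i t →
      D₂.shadow (d (α i)) t = A₂.shadow (e i) t := by
    intro i t h1
    have h2 : (D.move hg).shadow (α i) t = (A.move hg).shadow i t := by
      rw [shadow_move, shadow_move, h1]
    have h3 := hD.pos
    have h4 := min_le_left ε m
    rcases lt_or_ge (lin l ((A.move hg).shadow i t)) (min ε m) with h5 | h5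
    · rw [hA.flipped i t (h5.trans_le h4), hD.flipped _ t (h2 ▸ h5), h2]
    · rw [hA.kept i t (by linarith), hD.kept _ t (by rw [h2]; linarith), h2]
  have hkeep : ∀ j t, D.shadow (β j) t = B.shadow j t → 0 ≤ B.shadow j t 2 →
      (D₂.move hg.symm).shadow (d (β j)) t = B.shadow j t := by
    intro j t h1 h2
    rw [shadow_move, hDcap _ t (by rw [h1]; linarith), hg.left_inv, h1]
  constructor
  · exact half_pos hδ
  · linarith [h.le_half]
  · exact d.injective.comp (h.inj_left.comp e.symm.injective)
  · exact d.injective.comp h.inj_right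
  · rw [e.symm_apply_apply, h.glue]
  · intro i j hij
    obtain ⟨h1, h2⟩ := h.only_glue _ _ (d.injective hij)
    exact ⟨by rw [← h1, e.apply_symm_apply], h2⟩
  · intro k
    rcases h.cover (d.symm k) with ⟨i, hi⟩ | ⟨j, hj⟩
    · exact Or.inl ⟨e i, by rw [e.symm_apply_apply, hi, d.apply_symm_apply]⟩
    · exact Or.inr ⟨j, by rw [hj, d.apply_symm_apply]⟩
  · intro t ht
    have h1 := h.left_arc t (by linarith)
    rw [shadow_move, hAcap a t (by rw [h1, circ_two]; linarith), hg.left_inv, h1]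
  · intro t ht
    apply hAsouth
    rcases le_or_gt (Real.sin (2 * Real.pi * t)) (-δ) with h1 | h1
    · linarith [h.left_rest t h1]
    · rwa [h.left_arc t h1]
  · intro i hi t
    obtain ⟨i, rfl⟩ := e.surjective i
    apply hAsouth
    linarith [h.left_other i (fun h1 => hi (congrArg e h1)) t]
  · exact fun t ht => h.right_arc t (by linarith)
  · intro t ht
    rcases lt_or_ge (Real.sin (2 * Real.pi * t)) δ with h1 | h1
    · rwa [h.right_arc t h1]
    · linarith [h.right_rest t h1]
  · exact fun j hj t => by linarith [h.right_other j hj t]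
  · intro t ht
    rw [shadow_move, shadow_move, e.symm_apply_apply, hsame a t (h.south t ht)]
  · intro t ht
    apply hkeep b t (h.north t ht)
    rcases h.right_cases b t with h1 | ⟨-, -, h1⟩
    · linarith
    · rwa [h1]
  · intro i hi t
    obtain ⟨i, rfl⟩ := e.surjective i
    rw [shadow_move, shadow_move, e.symm_apply_apply,
      hsame i t (h.south_other i (fun h1 => hi (congrArg e h1)) t)]
  · exact fun j hj t => hkeep j t (h.north_other j hj t) (hδ.le.trans (h.right_other j hj t))
  · intro i s j t hc
    obtain ⟨i, rfl⟩ := e.surjective i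
    obtain ⟨j, rfl⟩ := e.surjective j
    rw [isCrossing_move, hA.isCrossing_iff] at hc
    have hc0 := (A.isCrossing_move hg i s j t).1 hc
    have hc1 := h.isCrossing_left hc0
    have hc2 := (D.isCrossing_move hg _ _ _ _).2 hc1
    have h1 : (D.move hg).shadow (α i) s = (A.move hg).shadow i s := by
      rw [shadow_move, shadow_move, h.shadow_left (h.left_le_of_isCrossing hc0)]
    rw [height_move_lt, height_move_lt, e.symm_apply_apply, e.symm_apply_apply]
    rcases lt_or_gt_of_ne (abs_pos.1 (hε.trans_le (hA.isFlat.le_abs hc))) with h0 | h0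
    · rw [← hA.order_flipped j t i s hc.symm (hc.1 ▸ h0),
        ← hD.order_flipped _ t _ s hc2.symm (by rw [← hc2.1, h1]; exact h0), height_move_lt,
        height_move_lt]
      exact h.order_left j t i s hc0.symm
    · rw [← hA.order_kept i s j t hc h0, ← hD.order_kept _ s _ t hc2 (h1 ▸ h0), height_move_lt,
        height_move_lt]
      exact h.order_left i s j t hc0
  · intro i s j t hc
    have hc1 := h.isCrossing_right hc
    have hc2 := (D.isCrossing_move hg _ _ _ _).2 hc1
    have h1 := h.right_ge_of_isCrossing hc
    have h2 : 0 < lin l ((D.move hg).shadow (β i) s) := by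
      rw [shadow_move]
      exact hm0.trans_le (hm _ (D.norm_shadow _ s) (by rw [h.shadow_right h1]; linarith))
    rw [height_move_lt, ← hD.order_kept _ s _ t hc2 h2, height_move_lt]
    exact h.order_right i s j t hc

end IsGluing

namespace IsFlip

variable {l : ℝ × ℝ} {ε : ℝ} {E F : LinkDiagram} {e : E.ι ≃ F.ι}

theorem _root_.abs_apply_le_one {p : E3} (hp : ‖p‖ = 1) (i : Fin 3) : |p i| ≤ 1 :=
  (PiLp.norm_apply_le p i).trans hp.le

/-- The plane of a flip can be tilted away from a given point of the diagram. -/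
theorem exists_lin_ne_zero (h : IsFlip l ε E F e) (i : E.ι) (t : ℝ) :
    ∃ l' ε', IsFlip l' ε' E F e ∧ lin l' (E.shadow i t) ≠ 0 := by
  have hε := h.pos
  by_cases h0 : lin l (E.shadow i t) = 0
  swap
  · exact ⟨l, ε, h, h0⟩
  set q := E.shadow i t with hq
  have hqn := norm_sq_E3 q
  rw [E.norm_shadow i t, h.isFlat i t (by rw [← hq, h0, abs_zero]; exact hε)] at hqn
  have hlin : ∀ p : E3, lin (l + (ε / 4) • (q 0, q 2)) p
      = lin l p + ε / 4 * (q 0 * p 0 + q 2 * p 2) := fun p => by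
    simp only [lin, Prod.fst_add, Prod.snd_add, Prod.smul_fst, Prod.smul_snd, smul_eq_mul]
    ring
  have hclose : ∀ p : E3, ‖p‖ = 1 →
      |lin (l + (ε / 4) • (q 0, q 2)) p - lin l p| ≤ ε / 2 := by
    intro p hp
    have h1 : |q 0 * p 0 + q 2 * p 2| ≤ 2 := by
      refine (abs_add_le _ _).trans ?_
      rw [abs_mul, abs_mul]
      have := mul_le_one₀ (abs_apply_le_one (E.norm_shadow i t) 0) (abs_nonneg _)
        (abs_apply_le_one hp 0)
      have := mul_le_one₀ (abs_apply_le_one (E.norm_shadow i t) 2) (abs_nonneg _)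
        (abs_apply_le_one hp 2)
      linarith
    rw [hlin, add_sub_cancel_left, abs_mul, abs_of_pos (by positivity : 0 < ε / 4)]
    nlinarith
  have hc : ∀ j s, _ := fun j s => abs_le.1 (hclose _ (E.norm_shadow j s))
  refine ⟨l + (ε / 4) • (q 0, q 2), ε / 2, ⟨half_pos hε, ?_, ?_, ?_, ?_⟩, ?_⟩
  · exact fun j s hs => h.flipped j s (by linarith [(hc j s).1])
  · exact fun j s hs => h.kept j s (by linarith [(hc j s).2])
  · intro j s k r hcr hs
    refine h.order_flipped j s k r hcr ?_
    by_contra! h1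
    have h2 := h.isFlat.le_abs hcr
    rw [abs_of_nonneg h1] at h2
    linarith [(hc j s).1]
  · intro j s k r hcr hs
    refine h.order_kept j s k r hcr ?_
    by_contra! h1
    have h2 := h.isFlat.le_abs hcr
    rw [abs_of_nonpos h1] at h2
    linarith [(hc j s).2]
  · rw [hlin, h0]
    nlinarith

/-- Flipping the part on one side of a plane differs by a rotation of the whole diagram from
flipping the part on the other side. -/
theorem neg_rot (h : IsFlip l ε E F e) : IsFlip (-l) ε E F.rot e := by
  have hlin : ∀ p, lin (-l) p = -lin l p := fun p => by
    simp only [lin, Prod.fst_neg, Prod.snd_neg]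
    ring
  refine ⟨h.pos, fun i t ht => ?_, fun i t ht => ?_, fun i s j t hc h0 => ?_,
    fun i s j t hc h0 => ?_⟩
  · rw [hlin] at ht
    rw [shadow_rot, h.kept i t (by linarith)]
  · rw [hlin] at ht
    rw [shadow_rot, h.flipped i t (by linarith), reflY_reflY]
  · rw [hlin] at h0
    rw [height_rot_lt]
    exact h.order_kept i s j t hc (by linarith)
  · rw [hlin] at h0
    rw [height_rot_lt]
    exact h.order_flipped i s j t hc (by linarith)

theorem reparam (h : IsFlip l ε E F e) {E₀ : LinkDiagram} {f : E₀.ι ≃ E.ι} {ψ : E₀.ι → ℝ → ℝ}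
    (ht : IsTransport E₀ E (fun x => x) f ψ) :
    IsFlip l ε E₀ (F.map IsSphereDiffeo.id fun i => ht.reparam (f.symm (e.symm i)))
      (f.trans e) := by
  have hs : ∀ i t, (F.map IsSphereDiffeo.id fun i => ht.reparam (f.symm (e.symm i))).shadow
      (e (f i)) t = F.shadow (e (f i)) (ψ i t) := by
    intro i t
    rw [shadow_map (D := F), e.symm_apply_apply, f.symm_apply_apply]
  have ho : ∀ i s j t,
      (F.map IsSphereDiffeo.id fun i => ht.reparam (f.symm (e.symm i))).height (e (f i)) s <
        (F.map IsSphereDiffeo.id fun i => ht.reparam (f.symm (e.symm i))).height (e (f j)) t ↔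
      F.height (e (f i)) (ψ i s) < F.height (e (f j)) (ψ j t) := by
    intro i s j t
    rw [height_map_lt (D := F), e.symm_apply_apply, f.symm_apply_apply, e.symm_apply_apply,
      f.symm_apply_apply]
  refine ⟨h.pos, fun i t h0 => ?_, fun i t h0 => ?_, fun i s j t hc h0 => ?_,
    fun i s j t hc h0 => ?_⟩
  · rw [← ht.shadow_eq] at h0 ⊢
    exact (hs i t).trans (h.flipped _ _ h0)
  · rw [← ht.shadow_eq] at h0 ⊢
    exact (hs i t).trans (h.kept _ _ h0)
  · rw [← ht.shadow_eq] at h0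
    exact ((ht.order i s j t hc).trans (h.order_flipped _ _ _ _
      ((ht.isCrossing_iff Function.injective_id).2 hc) h0)).trans (ho j t i s).symm
  · rw [← ht.shadow_eq] at h0
    exact ((ht.order i s j t hc).trans (h.order_kept _ _ _ _
      ((ht.isCrossing_iff Function.injective_id).2 hc) h0)).trans (ho i s j t).symm

end IsFlip

/-- The cap of `A` that is replaced in the gluing can be squeezed into a small disc, which does not
meet the half space of the flip. -/
theorem IsGluing.exists_isFlip {δ : ℝ} {A B D : LinkDiagram} {a : A.ι} {b : B.ι} {α : A.ι → D.ι}
    {β : B.ι → D.ι} (h : IsGluing δ A B D a b α β) {A₁ A₂ : LinkDiagram} {g g' : E3 → E3}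
    {f : A.ι ≃ A₁.ι} {φ : A.ι → ℝ → ℝ} (ht : IsTransport A A₁ g f φ) (hg : IsSphereDiffeo g g')
    (hi : PreservesIsotopy g) {l : ℝ × ℝ} {ε : ℝ} {e : A₁.ι ≃ A₂.ι} (hf : IsFlip l ε A₁ A₂ e)
    (hl : 0 < lin l (g !₂[0, 0, 1])) :
    ∃ (D₁ D₂ : LinkDiagram) (l : ℝ × ℝ) (ε : ℝ) (e : D₁.ι ≃ D₂.ι),
      D.Equi D₁ ∧ IsFlip l ε D₁ D₂ e ∧ IsSum A₂ B D₂ := by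
  classical
  have hδ := h.pos
  set m := lin l (g !₂[0, 0, 1]) / 2 with hm
  have hN : {x : E3 | m < lin l (g x)} ∈ nhds (!₂[0, 0, 1] : E3) := by
    have h0 : (!₂[0, 0, 1] : E3) ≠ 0 := fun h0 => by
      have := congrArg (fun x : E3 => x 2) h0
      simp at this
    have h1 : ContinuousAt (fun x => lin l (g x)) !₂[0, 0, 1] :=
      (contDiff_lin l).continuous.continuousAt.comp (hg.contDiffAt h0).continuousAt
    exact h1.eventually (lt_mem_nhds (half_lt_self hl))
  obtain ⟨κ, κ', τ, hκ, hκi, hτ, hκ1, hκ2, hκ3, hτ1⟩ := exists_squeeze hδ h.le_half hN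
  have hG : IsSphereDiffeo (fun x => g (κ x)) fun x => κ' (g' x) := hg.comp hκ
  have hGi : PreservesIsotopy fun x => g (κ x) := hi.comp hκ hκi
  let ψ : A.ι → ℝ → ℝ := fun i t => if i = a then φ i (τ t) else φ i t
  have hψ : ∀ i t, A.shadow i t 2 ≤ -δ → ψ i t = φ i t := by
    intro i t h1
    simp only [ψ]
    split_ifs with h2
    · subst h2
      rw [hτ1 t (h.sin_le_of_left h1)]
    · rfl
  have htr : IsTransport (A.move hG) A₁ (fun x => x) f ψ := by
    refine ⟨fun i => ?_, fun i t => ?_, fun i s j t hc => ?_⟩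
    · by_cases h1 : i = a
      · simp only [ψ, if_pos h1]
        exact (ht.reparam i).comp hτ
      · simp only [ψ, if_neg h1]
        exact ht.reparam i
    · refine Eq.trans ?_ (A.shadow_move hG i t).symm
      rcases h.left_cases i t with h1 | ⟨rfl, h1, h2⟩
      · rw [hψ i t h1, hκ1 _ (A.norm_shadow i t) h1]
        exact ht.shadow_eq i t
      · have h3 : -δ < Real.sin (2 * Real.pi * τ t) := by
          by_contra! h3
          have h4 := hτ.strictMono.injective (hτ1 _ h3)
          rw [h4] at h3
          linarith
        rw [h2, hκ3, ← h.left_arc _ h3]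
        simp only [ψ, if_true]
        exact ht.shadow_eq i (τ t)
    · have hc0 := (A.isCrossing_move hG i s j t).1 hc
      rw [hψ i s (h.left_le_of_isCrossing hc0), hψ j t (h.left_le_of_isCrossing hc0.symm)]
      exact (A.height_move_lt hG i s j t).trans (ht.order i s j t hc0)
  have hf' := hf.reparam htr
  have hcap : ∀ p : E3, ‖p‖ = 1 → -(δ / 2) ≤ p 2 → m ≤ lin l (g (κ p)) :=
    fun p h1 h2 => (hκ2 p h1 h2).le
  have hflat := h.isFlat_move hG hf'.isFlat hcap
  have hpos : 0 < min ε m := lt_min hf.pos (half_pos hl)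
  have hflip := isFlip_flip hpos hflat
  have hglue := h.of_isFlip hG hf' hflip hcap
  exact ⟨D.move hG, (D.move hG).flip hpos hflat, l, min ε m, Equiv.refl _, D.equi_move hG hGi,
    hflip, _, B, _, δ / 2, _, b, _, _,
    (A₂.equi_map IsSphereDiffeo.id PreservesIsotopy.id _).trans
      (equi_move _ hG.symm (hGi.symm hG)), Equi.refl B,
    equi_move _ hG.symm (hGi.symm hG), hglue⟩

/-- A flip of `A` gives a flip of the connected sum of `A` and `B`, at least after changing the side
of the plane of the flip. -/
theorem IsSum.exists_isFlip {A B D A₁ A₂ : LinkDiagram} (h : IsSum A B D) (hA : A.Equi A₁)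
    {l : ℝ × ℝ} {ε : ℝ} {e : A₁.ι ≃ A₂.ι} (hf : IsFlip l ε A₁ A₂ e) :
    ∃ (D₁ D₂ : LinkDiagram) (l : ℝ × ℝ) (ε : ℝ) (e : D₁.ι ≃ D₂.ι),
      D.Equi D₁ ∧ IsFlip l ε D₁ D₂ e ∧ (IsSum A₂ B D₂ ∨ IsSum A₂.rot B D₂) := by
  obtain ⟨A', B', D', δ, a, b, α, β, hA', hB', hD', h⟩ := h
  have hBsum : ∀ {X Y : LinkDiagram}, IsSum X B' Y → IsSum X B Y := by
    rintro X Y ⟨X', B'', Y', δ, a, b, α, β, h1, h2, h3, h4⟩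
    exact ⟨X', B'', Y', δ, a, b, α, β, h1, hB'.trans h2, h3, h4⟩
  obtain ⟨g, g', f, φ, hg, hi, ht⟩ := hA'.symm.trans hA
  obtain ⟨l', ε', hf', hl⟩ := hf.exists_lin_ne_zero (f a) (φ a (1 / 4))
  have hquarter : 2 * Real.pi * (1 / 4) = Real.pi / 2 := by ring
  have hnorth : A'.shadow a (1 / 4) = !₂[0, 0, 1] := by
    rw [h.left_arc (1 / 4) (by rw [hquarter, Real.sin_pi_div_two]; linarith [h.pos])]
    simp only [circ, hquarter, Real.sin_pi_div_two, Real.cos_pi_div_two, neg_zero]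
  rw [ht.shadow_eq, hnorth] at hl
  rcases lt_or_gt_of_ne hl with h0 | h0
  · have h1 : 0 < lin (-l') (g !₂[0, 0, 1]) := by
      simp only [lin, Prod.fst_neg, Prod.snd_neg] at h0 ⊢
      linarith
    obtain ⟨D₁, D₂, l, ε, e, h2, h3, h4⟩ := h.exists_isFlip ht hg hi hf'.neg_rot h1
    exact ⟨D₁, D₂, l, ε, e, hD'.trans h2, h3, Or.inr (hBsum h4)⟩
  · obtain ⟨D₁, D₂, l, ε, e, h2, h3, h4⟩ := h.exists_isFlip ht hg hi hf' h0
    exact ⟨D₁, D₂, l, ε, e, hD'.trans h2, h3, Or.inl (hBsum h4)⟩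

end LinkDiagram

/-! ### Alternation of glued diagrams -/

section halves

/-- The interval `(n / 2, (n + 1) / 2)`. Its image in `ℝ / ℤ` is the half circle on which
`sin (2 π s)` is positive if `n` is even, and the one on which it is negative if `n` is odd. -/
def InHalf (n : ℤ) (s : ℝ) : Prop := (n : ℝ) / 2 < s ∧ s < ((n : ℝ) + 1) / 2

theorem InHalf.eq {m n : ℤ} {s : ℝ} (hm : InHalf m s) (hn : InHalf n s) : m = n := by
  have h1 : (m : ℝ) < n + 1 := by linarith [hm.1, hn.2]
  have h2 : (n : ℝ) < m + 1 := by linarith [hn.1, hm.2]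
  have h3 : m < n + 1 := by exact_mod_cast h1
  have h4 : n < m + 1 := by exact_mod_cast h2
  omega

theorem InHalf.sub_int {n : ℤ} {s : ℝ} (h : InHalf n s) (k : ℤ) : InHalf (n - 2 * k) (s - k) := by
  constructor <;> push_cast <;> linarith [h.1, h.2]

theorem InHalf.sin_pos {n : ℤ} {s : ℝ} (h : InHalf n s) (hn : Even n) :
    0 < Real.sin (2 * Real.pi * s) := by
  obtain ⟨k, rfl⟩ := hn
  have hpi := Real.pi_pos
  have h1 := h.1
  have h2 := h.2
  push_cast at h1 h2
  rw [← LinkDiagram.sin_two_pi_sub_int s k]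
  apply Real.sin_pos_of_pos_of_lt_pi
  · have : 0 < s - k := by linarith
    positivity
  · nlinarith

theorem InHalf.sin_neg {n : ℤ} {s : ℝ} (h : InHalf n s) (hn : ¬ Even n) :
    Real.sin (2 * Real.pi * s) < 0 := by
  have h1 : InHalf (n + 1) (s + 1 / 2) := by
    constructor <;> push_cast <;> linarith [h.1, h.2]
  have h2 := h1.sin_pos (by rwa [Int.even_add_one])
  rw [LinkDiagram.sin_add_half] at h2
  linarith

theorem exists_inHalf {s : ℝ} (h : Real.sin (2 * Real.pi * s) ≠ 0) : ∃ n, InHalf n s := by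
  refine ⟨⌊2 * s⌋, lt_of_le_of_ne ?_ ?_, ?_⟩
  · linarith [Int.floor_le (2 * s)]
  · intro h1
    apply h
    rw [← Real.sin_int_mul_pi ⌊2 * s⌋]
    congr 1
    linear_combination -(2 * Real.pi) * h1
  · linarith [Int.lt_floor_add_one (2 * s)]

variable {M O : ℝ → Prop}

/-- `s < t` are consecutive points of `M` in the half circle with number `n` and the next one. -/
structure IsChange (M : ℝ → Prop) (n : ℤ) (s t : ℝ) : Prop where
  left : M s
  right : M t
  half_left : InHalf n s
  half_right : InHalf (n + 1) t
  between : ∀ r ∈ Set.Ioo s t, ¬ M r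

theorem IsChange.lt {n : ℤ} {s t : ℝ} (h : IsChange M n s t) : s < t := by
  have h1 := h.half_right.1
  push_cast at h1
  exact h.half_left.2.trans h1

/-- Consecutive points in different half circles lie in adjacent half circles, since `M` is
periodic. -/
theorem isChange_of_ne (hM : ∀ t (k : ℤ), M (t - k) ↔ M t) {m n : ℤ} {s t : ℝ} (hst : s < t)
    (hs : M s) (ht : M t) (h : ∀ r ∈ Set.Ioo s t, ¬ M r) (hn : InHalf n s) (hm : InHalf m t)
    (hmn : ¬ Even (m - n)) : IsChange M n s t := by
  have h1 : (n : ℝ) < m + 1 := by linarith [hn.1, hm.2]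
  have h2 : n < m + 1 := by exact_mod_cast h1
  rw [Int.not_even_iff_odd] at hmn
  obtain ⟨k, hk⟩ := hmn
  -- The translate of `t` by `-k` lies in the half circle that follows the one of `s`.
  have h3 := hm.sub_int k
  have h4 : m - 2 * k = n + 1 := by omega
  rw [h4] at h3
  have h5 : s < t - k := by
    have := h3.1
    push_cast at this
    exact hn.2.trans this
  have hk0 : 0 ≤ k := by omega
  have hk0' : (0 : ℝ) ≤ k := by exact_mod_cast hk0
  rcases hk0'.eq_or_lt with h6 | h6
  · rw [← h6, sub_zero] at h3
    exact ⟨hs, ht, hn, h3, h⟩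
  · exact absurd ((hM t k).2 ht) (h _ ⟨h5, by linarith⟩)

theorem IsChange.sub_int (hM : ∀ t (k : ℤ), M (t - k) ↔ M t) {n : ℤ} {s t : ℝ}
    (h : IsChange M n s t) (k : ℤ) : IsChange M (n - 2 * k) (s - k) (t - k) where
  left := (hM _ _).2 h.left
  right := (hM _ _).2 h.right
  half_left := h.half_left.sub_int k
  half_right := by
    have := h.half_right.sub_int k
    rwa [show n + 1 - 2 * k = n - 2 * k + 1 by ring] at this
  between r hr hr' := h.between (r + k) ⟨by linarith [hr.1], by linarith [hr.2]⟩
    ((hM (r + k) k).1 (by rwa [add_sub_cancel_right]))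

/-- The points of `M` in each of the two half circles alternate between `O` and its complement:
consecutive ones may lie in different lifts of the same half circle. -/
def AlternatesInHalves (M O : ℝ → Prop) : Prop :=
  ∀ m n s t, InHalf n s → InHalf m t → Even (m - n) → s < t → M s → M t →
    (∀ r ∈ Set.Ioo s t, ∀ k, InHalf k r → Even (k - n) → ¬ M r) → (O s ↔ ¬ O t)

/-- Let `s, t` and `s', t'` be successive changes. In one half circle `s` and `t'` are consecutive, and
in the other one `s'` and `t + 1` are. So `O` takes different values at the points of each of these
two pairs. -/
theorem IsChange.iff_of_succ (hM : ∀ t (k : ℤ), M (t - k) ↔ M t) (hO : ∀ t (k : ℤ), O (t - k) ↔ O t)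
    (h : AlternatesInHalves M O) {n : ℤ} {s t s' t' : ℝ} (h1 : IsChange M n s t)
    (h2 : IsChange M (n + 1) s' t') : (O s ↔ O t) ↔ (O s' ↔ O t') := by
  have a1 := h1.half_left
  have a2 := h1.half_right
  have a3 := h2.half_left
  have a4 := h2.half_right
  have b2 := a2.1
  have b2' := a2.2
  have b3 := a3.1
  have b3' := a3.2
  have b4 := a4.1
  have b4' := a4.2
  push_cast at b2 b2' b3 b3' b4 b4'
  have c1 : O s ↔ ¬ O t' := by
    refine h _ n s t' a1 a4 ⟨1, by ring⟩ (by linarith [a1.2]) h1.left h2.right ?_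
    intro r hr k hk hkn hr'
    rcases lt_or_ge r t with h3 | h3
    · exact h1.between r ⟨hr.1, h3⟩ hr'
    rcases lt_or_ge s' r with h4 | h4
    · exact h2.between r ⟨h4, hr.2⟩ hr'
    · have h5 : InHalf (n + 1) r := ⟨a2.1.trans_le h3, h4.trans_lt a3.2⟩
      rw [hk.eq h5] at hkn
      simp at hkn
  have c2 : O s' ↔ ¬ O (t + 1) := by
    have a5 : InHalf (n + 3) (t + 1) := by
      constructor <;> push_cast <;> linarith
    have h6 : M (t + 1) := by
      rw [← hM _ 1]
      simpa using h1.right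
    refine h _ (n + 1) s' (t + 1) a3 a5 ⟨1, by ring⟩ (by linarith) h2.left h6 ?_
    intro r hr k hk hkn hr'
    rcases lt_or_ge r t' with h3 | h3
    · exact h2.between r ⟨hr.1, h3⟩ hr'
    rcases lt_or_ge (s + 1) r with h4 | h4
    · refine h1.between (r - 1) ⟨by linarith, by linarith [hr.2]⟩ ?_
      have := (hM r 1).2 hr'
      simpa using this
    · have h5 : InHalf (n + 2) r := by
        constructor <;> push_cast <;> linarith [a1.2]
      rw [hk.eq h5, show n + 2 - (n + 1) = 1 by ring] at hkn
      simp at hkn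
  have c3 : O (t + 1) ↔ O t := by
    rw [← hO _ 1]
    simp
  tauto

/-- If one change between the half circles fits into the alternating pattern, then all of them
do. -/
theorem IsChange.iff (hM : ∀ t (k : ℤ), M (t - k) ↔ M t) (hO : ∀ t (k : ℤ), O (t - k) ↔ O t)
    (h : AlternatesInHalves M O) {n n' : ℤ} {s t s' t' : ℝ} (h1 : IsChange M n s t)
    (h2 : IsChange M n' s' t') : (O s ↔ O t) ↔ (O s' ↔ O t') := by
  rcases Int.even_or_odd' (n' - n) with ⟨k, hk | hk⟩
  · have h3 := h2.sub_int hM k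
    rw [show n' - 2 * k = n by omega] at h3
    -- The two changes are in the same place of the circle, so they are translates of each other.
    have hs : s = s' - k := by
      rcases lt_trichotomy s (s' - k) with h4 | h4 | h4
      · refine absurd h3.left (h1.between _ ⟨h4, h3.half_left.2.trans ?_⟩)
        simpa using h1.half_right.1
      · exact h4
      · refine absurd h1.left (h3.between _ ⟨h4, h1.half_left.2.trans ?_⟩)
        simpa using h3.half_right.1
    have ht : t = t' - k := by
      rcases lt_trichotomy t (t' - k) with h4 | h4 | h4
      · exact absurd h1.right (h3.between _ ⟨hs ▸ h1.lt, h4⟩)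
      · exact h4
      · exact absurd h3.right (h1.between _ ⟨hs ▸ h3.lt, h4⟩)
    rw [hs, ht, hO, hO]
  · have h3 := h2.sub_int hM k
    rw [show n' - 2 * k = n + 1 by omega] at h3
    have h4 := h1.iff_of_succ hM hO h h3
    rwa [hO, hO] at h4

end halves

namespace LinkDiagram

/-! ### Connected sums of alternating diagrams -/

variable {D : LinkDiagram}

theorem isCrossing_sub_int {i : D.ι} {t : ℝ} {j : D.ι} {r : ℝ} (k : ℤ) :
    D.IsCrossing i (t - k) j r ↔ D.IsCrossing i t j r := by
  have h1 : SamePoint i (t - k) i t := ⟨rfl, k, by ring⟩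
  unfold OrientedLink.IsCrossing
  rw [periodic_sub_int (D.periodic_shadow i)]
  exact and_congr_right fun _ => not_congr ⟨fun h2 => h1.symm.trans h2, fun h2 => h1.trans h2⟩

theorem meetsCrossing_sub_int (i : D.ι) (t : ℝ) (k : ℤ) :
    D.MeetsCrossing i (t - k) ↔ D.MeetsCrossing i t := by
  simp only [MeetsCrossing, isCrossing_sub_int]

theorem passesOver_sub_int (i : D.ι) (t : ℝ) (k : ℤ) :
    D.PassesOver i (t - k) ↔ D.PassesOver i t := by
  have : D.height i (t - k) = D.height i t :=
    congrArg Prod.snd (periodic_sub_int (D.isLink.periodic i) t k)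
  simp only [PassesOver, isCrossing_sub_int, this]

/-- As there are no triple points, one crossing decides whether the strand passes over. -/
theorem _root_.OrientedLink.IsCrossing.passesOver_iff {i s j t} (h : D.IsCrossing i s j t) :
    D.PassesOver i s ↔ D.height j t < D.height i s := by
  refine ⟨fun ⟨j', t', h', hlt⟩ => ?_, fun hlt => ⟨j, t, h, hlt⟩⟩
  have h1 : D.curve j' t' = D.curve j t :=
    (D.regular.no_triple _ _ _ _ _ _ h' h).eq_of_periodic D.isLink.periodic
  have h2 : D.height j' t' = D.height j t := congrArg Prod.snd h1
  rwa [← h2]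

theorem _root_.OrientedLink.IsCrossing.not_passesOver_iff {i s j t} (h : D.IsCrossing i s j t) :
    ¬ D.PassesOver i s ↔ D.height i s < D.height j t := by
  rw [h.passesOver_iff, not_lt]
  exact ⟨fun h1 => lt_of_le_of_ne h1 h.height_ne, le_of_lt⟩

theorem isAlternating_rot (h : D.IsAlternating) : D.rot.IsAlternating := by
  have hm : ∀ i s, D.rot.MeetsCrossing i s ↔ D.MeetsCrossing i s := fun i s =>
    exists_congr fun j => exists_congr fun t => D.isCrossing_rot i s j t
  have ho : ∀ i s, D.MeetsCrossing i s → (D.rot.PassesOver i s ↔ ¬ D.PassesOver i s) := by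
    rintro i s ⟨j, t, hc⟩
    rw [((D.isCrossing_rot i s j t).2 hc).passesOver_iff, hc.not_passesOver_iff, height_rot_lt]
  intro i s t hst hs ht hr
  have hs := (hm i s).1 hs
  have ht := (hm i t).1 ht
  have h1 := h i s t hst hs ht fun r hr' h2 => hr r hr' ((hm i r).2 h2)
  have h2 := ho i s hs
  have h3 := ho i t ht
  tauto

namespace IsFlip

variable {l : ℝ × ℝ} {ε : ℝ} {F : LinkDiagram} {e : D.ι ≃ F.ι}

theorem meetsCrossing_iff (h : IsFlip l ε D F e) {i s} :
    F.MeetsCrossing (e i) s ↔ D.MeetsCrossing i s := by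
  constructor
  · rintro ⟨j, t, hc⟩
    obtain ⟨j, rfl⟩ := e.surjective j
    exact ⟨j, t, h.isCrossing_iff.1 hc⟩
  · rintro ⟨j, t, hc⟩
    exact ⟨e j, t, h.isCrossing_iff.2 hc⟩

theorem passesOver_of_neg (h : IsFlip l ε D F e) {i s} (hm : D.MeetsCrossing i s)
    (h0 : lin l (D.shadow i s) < 0) : F.PassesOver (e i) s ↔ ¬ D.PassesOver i s := by
  obtain ⟨j, t, hc⟩ := hm
  rw [(h.isCrossing_iff.2 hc).passesOver_iff, hc.not_passesOver_iff, h.order_flipped i s j t hc h0]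

theorem passesOver_of_pos (h : IsFlip l ε D F e) {i s} (hm : D.MeetsCrossing i s)
    (h0 : 0 < lin l (D.shadow i s)) : F.PassesOver (e i) s ↔ D.PassesOver i s := by
  obtain ⟨j, t, hc⟩ := hm
  rw [(h.isCrossing_iff.2 hc).passesOver_iff, hc.passesOver_iff,
    h.order_kept j t i s hc.symm (hc.1 ▸ h0)]

end IsFlip

namespace IsGluing

variable {δ : ℝ} {A B : LinkDiagram} {a : A.ι} {b : B.ι} {α : A.ι → D.ι} {β : B.ι → D.ι}

theorem meetsCrossing_cases (h : IsGluing δ A B D a b α β) {k s} (hm : D.MeetsCrossing k s) :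
    (∃ i, α i = k ∧ A.MeetsCrossing i s) ∨ ∃ j, β j = k ∧ B.MeetsCrossing j s := by
  obtain ⟨l, t, hc⟩ := hm
  rcases h.isCrossing_cases hc with ⟨i, j, h1, -, h2⟩ | ⟨i, j, h1, -, h2⟩
  · exact Or.inl ⟨i, h1, j, t, h2⟩
  · exact Or.inr ⟨i, h1, j, t, h2⟩

theorem meetsCrossing_left (h : IsGluing δ A B D a b α β) {i s} (hm : A.MeetsCrossing i s) :
    D.MeetsCrossing (α i) s := by
  obtain ⟨j, t, hc⟩ := hm
  exact ⟨_, _, h.isCrossing_left hc⟩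

theorem meetsCrossing_right (h : IsGluing δ A B D a b α β) {i s} (hm : B.MeetsCrossing i s) :
    D.MeetsCrossing (β i) s := by
  obtain ⟨j, t, hc⟩ := hm
  exact ⟨_, _, h.isCrossing_right hc⟩

theorem passesOver_left (h : IsGluing δ A B D a b α β) {i s} (hm : A.MeetsCrossing i s) :
    D.PassesOver (α i) s ↔ A.PassesOver i s := by
  obtain ⟨j, t, hc⟩ := hm
  rw [(h.isCrossing_left hc).passesOver_iff, hc.passesOver_iff, h.order_left _ _ _ _ hc.symm]

theorem passesOver_right (h : IsGluing δ A B D a b α β) {i s} (hm : B.MeetsCrossing i s) :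
    D.PassesOver (β i) s ↔ B.PassesOver i s := by
  obtain ⟨j, t, hc⟩ := hm
  rw [(h.isCrossing_right hc).passesOver_iff, hc.passesOver_iff, h.order_right _ _ _ _ hc.symm]

theorem left_neg (h : IsGluing δ A B D a b α β) {i s} (hm : A.MeetsCrossing i s) :
    D.shadow (α i) s 2 < 0 := by
  obtain ⟨j, t, hc⟩ := hm
  have h1 := h.left_le_of_isCrossing hc
  rw [h.shadow_left h1]
  linarith [h.pos]

theorem right_pos (h : IsGluing δ A B D a b α β) {i s} (hm : B.MeetsCrossing i s) :
    0 < D.shadow (β i) s 2 := by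
  obtain ⟨j, t, hc⟩ := hm
  have h1 := h.right_ge_of_isCrossing hc
  rw [h.shadow_right h1]
  linarith [h.pos]

theorem sin_neg (h : IsGluing δ A B D a b α β) {s} (hm : A.MeetsCrossing a s) :
    Real.sin (2 * Real.pi * s) < 0 := by
  obtain ⟨j, t, hc⟩ := hm
  linarith [h.pos, h.sin_le_of_left (h.left_le_of_isCrossing hc)]

theorem sin_pos (h : IsGluing δ A B D a b α β) {s} (hm : B.MeetsCrossing b s) :
    0 < Real.sin (2 * Real.pi * s) := by
  obtain ⟨j, t, hc⟩ := hm
  linarith [h.pos, h.le_sin_of_right (h.right_ge_of_isCrossing hc)]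

theorem sin_ne_zero (h : IsGluing δ A B D a b α β) {s} (hm : D.MeetsCrossing (α a) s) :
    Real.sin (2 * Real.pi * s) ≠ 0 := by
  rcases h.meetsCrossing_cases hm with ⟨i, hi, h1⟩ | ⟨j, hj, h1⟩
  · rw [h.inj_left hi] at h1
    exact (h.sin_neg h1).ne
  · rw [(h.only_glue a j hj.symm).2] at h1
    exact (h.sin_pos h1).ne'

/-- The crossings of `D` on the joined component come from `A` in one half circle and from `B` in the
other one. -/
theorem alternatesInHalves (h : IsGluing δ A B D a b α β) (hA : A.IsAlternating)
    (hB : B.IsAlternating) :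
    AlternatesInHalves (D.MeetsCrossing (α a)) (D.PassesOver (α a)) := by
  have hleft : ∀ n s, InHalf n s → ¬ Even n → D.MeetsCrossing (α a) s → A.MeetsCrossing a s := by
    intro n s hn he hm
    rcases h.meetsCrossing_cases hm with ⟨i, hi, h1⟩ | ⟨j, hj, h1⟩
    · rwa [h.inj_left hi] at h1
    · rw [(h.only_glue a j hj.symm).2] at h1
      exact absurd (h.sin_pos h1) (hn.sin_neg he).not_gt
  have hright : ∀ n s, InHalf n s → Even n → D.MeetsCrossing (α a) s → B.MeetsCrossing b s := by
    intro n s hn he hm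
    rcases h.meetsCrossing_cases hm with ⟨i, hi, h1⟩ | ⟨j, hj, h1⟩
    · rw [h.inj_left hi] at h1
      exact absurd (h.sin_neg h1) (hn.sin_pos he).not_gt
    · rwa [(h.only_glue a j hj.symm).2] at h1
  intro m n s t hn hm hmn hst hs ht hr
  rw [Int.even_sub] at hmn
  by_cases he : Even n
  · have hs' := hright n s hn he hs
    have ht' := hright m t hm (hmn.2 he) ht
    rw [h.glue, h.passesOver_right hs', h.passesOver_right ht']
    refine hB b s t hst hs' ht' fun r hr' h1 => ?_
    have h2 := h.meetsCrossing_right h1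
    rw [← h.glue] at h2
    obtain ⟨k, hk⟩ := exists_inHalf (h.sin_ne_zero h2)
    refine hr r hr' k hk ?_ h2
    by_contra h3
    rw [Int.even_sub] at h3
    exact (h.sin_pos h1).not_gt (hk.sin_neg fun h4 => h3 (iff_of_true h4 he))
  · have hs' := hleft n s hn he hs
    have ht' := hleft m t hm (fun h1 => he (hmn.1 h1)) ht
    rw [h.passesOver_left hs', h.passesOver_left ht']
    refine hA a s t hst hs' ht' fun r hr' h1 => ?_
    have h2 := h.meetsCrossing_left h1
    obtain ⟨k, hk⟩ := exists_inHalf (h.sin_ne_zero h2)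
    refine hr r hr' k hk ?_ h2
    by_contra h3
    rw [Int.even_sub] at h3
    refine (h.sin_neg h1).not_gt (hk.sin_pos ?_)
    by_contra h4
    exact h3 (iff_of_false h4 he)

/-- Two consecutive crossings on a component of `D` belong to the same part, in which they
alternate, or are on both sides of a junction of the two parts. -/
theorem consecutive_cases (h : IsGluing δ A B D a b α β) (hA : A.IsAlternating)
    (hB : B.IsAlternating) {k s t} (hst : s < t) (hs : D.MeetsCrossing k s)
    (ht : D.MeetsCrossing k t) (hr : ∀ r ∈ Set.Ioo s t, ¬ D.MeetsCrossing k r) :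
    ((D.PassesOver k s ↔ ¬ D.PassesOver k t) ∧ 0 < D.shadow k s 2 * D.shadow k t 2) ∨
      (D.shadow k s 2 * D.shadow k t 2 < 0 ∧ k = α a ∧
        ∃ n, IsChange (D.MeetsCrossing (α a)) n s t) := by
  have hchange : ∀ {s t}, s < t → D.MeetsCrossing (α a) s → D.MeetsCrossing (α a) t →
      (∀ r ∈ Set.Ioo s t, ¬ D.MeetsCrossing (α a) r) →
      Real.sin (2 * Real.pi * s) * Real.sin (2 * Real.pi * t) < 0 →
      ∃ n, IsChange (D.MeetsCrossing (α a)) n s t := by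
    intro s t hst hs ht hr h0
    obtain ⟨n, hn⟩ := exists_inHalf (h.sin_ne_zero hs)
    obtain ⟨m, hm⟩ := exists_inHalf (h.sin_ne_zero ht)
    refine ⟨n, isChange_of_ne (meetsCrossing_sub_int (α a)) hst hs ht hr hn hm fun h1 => ?_⟩
    rw [Int.even_sub] at h1
    by_cases he : Even n
    · exact h0.not_gt (mul_pos (hn.sin_pos he) (hm.sin_pos (h1.2 he)))
    · exact h0.not_gt (mul_pos_of_neg_of_neg (hn.sin_neg he) (hm.sin_neg fun h2 => he (h1.1 h2)))
  rcases h.meetsCrossing_cases hs with ⟨i, rfl, h1⟩ | ⟨i, rfl, h1⟩ <;>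
  rcases h.meetsCrossing_cases ht with ⟨j, hij, h2⟩ | ⟨j, hij, h2⟩
  · rw [h.inj_left hij] at h2
    refine Or.inl ⟨?_, mul_pos_of_neg_of_neg (h.left_neg h1) (h.left_neg h2)⟩
    rw [h.passesOver_left h1, h.passesOver_left h2]
    exact hA i s t hst h1 h2 fun r hr' h3 => hr r hr' (h.meetsCrossing_left h3)
  · obtain ⟨rfl, rfl⟩ := h.only_glue i j hij.symm
    refine Or.inr ⟨mul_neg_of_neg_of_pos (h.left_neg h1) (hij ▸ h.right_pos h2), rfl, ?_⟩
    exact hchange hst hs ht hr (mul_neg_of_neg_of_pos (h.sin_neg h1) (h.sin_pos h2))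
  · obtain ⟨rfl, rfl⟩ := h.only_glue j i hij
    refine Or.inr ⟨mul_neg_of_pos_of_neg (h.right_pos h1) (hij ▸ h.left_neg h2), hij.symm, ?_⟩
    rw [← hij] at hs ht hr
    exact hchange hst hs ht hr (mul_neg_of_pos_of_neg (h.sin_pos h1) (h.sin_neg h2))
  · rw [h.inj_right hij] at h2
    refine Or.inl ⟨?_, mul_pos (h.right_pos h1) (h.right_pos h2)⟩
    rw [h.passesOver_right h1, h.passesOver_right h2]
    exact hB i s t hst h1 h2 fun r hr' h3 => hr r hr' (h.meetsCrossing_right h3)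

/-- Near the equator, `D` consists of two arcs of the great circle `y = 0`. -/
theorem isFlat (h : IsGluing δ A B D a b α β) : D.IsFlat (0, 1) δ := by
  intro k t ht
  simp only [lin, zero_mul, one_mul, zero_add] at ht
  rw [abs_lt] at ht
  rcases h.cases k t with ⟨i, -, h1, h2⟩ | ⟨j, -, h1, h2⟩ | ⟨-, -, -, h2⟩
  · rw [h2] at ht
    linarith
  · rw [h2] at ht
    linarith
  · rw [h2, circ_one]

/-- If the glued diagram `D` is not alternating, then it fails to alternate at both junctions of its
two parts, and becomes alternating when one part is flipped. -/
theorem isAlternating_or (h : IsGluing δ A B D a b α β) (hA : A.IsAlternating)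
    (hB : B.IsAlternating) : D.IsAlternating ∨ (D.flip h.pos h.isFlat).IsAlternating := by
  have hf := isFlip_flip h.pos h.isFlat
  have hiff := @IsChange.iff _ _ (meetsCrossing_sub_int (α a)) (passesOver_sub_int (α a))
    (h.alternatesInHalves hA hB)
  by_cases hbad : ∃ n s t, IsChange (D.MeetsCrossing (α a)) n s t ∧
      (D.PassesOver (α a) s ↔ D.PassesOver (α a) t)
  · obtain ⟨n', s', t', h1, h2⟩ := hbad
    right
    intro i s t hst hs ht hr
    obtain ⟨k, rfl⟩ := (Equiv.refl D.ι).surjective i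
    have hs := hf.meetsCrossing_iff.1 hs
    have ht := hf.meetsCrossing_iff.1 ht
    have hr : ∀ r ∈ Set.Ioo s t, ¬ D.MeetsCrossing k r := fun r hr' h3 =>
      hr r hr' (hf.meetsCrossing_iff.2 h3)
    have hpos : ∀ s, D.MeetsCrossing k s → 0 < D.shadow k s 2 → _ := fun s hs h0 =>
      hf.passesOver_of_pos hs (by simpa only [lin, zero_mul, one_mul, zero_add] using h0)
    have hneg : ∀ s, D.MeetsCrossing k s → D.shadow k s 2 < 0 → _ := fun s hs h0 =>
      hf.passesOver_of_neg hs (by simpa only [lin, zero_mul, one_mul, zero_add] using h0)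
    rcases h.consecutive_cases hA hB hst hs ht hr with ⟨h3, h4⟩ | ⟨h4, rfl, n, h5⟩
    · rcases pos_and_pos_or_neg_and_neg_of_mul_pos h4 with ⟨h6, h7⟩ | ⟨h6, h7⟩
      · rwa [hpos s hs h6, hpos t ht h7]
      · rw [hneg s hs h6, hneg t ht h7]
        tauto
    · have h3 := (hiff h1 h5).1 h2
      rcases mul_neg_iff.1 h4 with ⟨h6, h7⟩ | ⟨h6, h7⟩
      · rw [hpos s hs h6, hneg t ht h7, not_not]
        exact h3
      · rw [hneg s hs h6, hpos t ht h7]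
        exact not_congr h3
  · left
    intro k s t hst hs ht hr
    rcases h.consecutive_cases hA hB hst hs ht hr with ⟨h1, -⟩ | ⟨-, rfl, n, h1⟩
    · exact h1
    · have h2 : ¬ (D.PassesOver (α a) s ↔ D.PassesOver (α a) t) := fun h2 => hbad ⟨n, s, t, h1, h2⟩
      tauto

end IsGluing

/-! ### Diagrams that can be made alternating -/

/-- `D` can be changed into an alternating diagram by diffeomorphisms of `S²`, rotations of the
whole diagram, and flips. -/
inductive FlipsToAlternating : LinkDiagram → Prop
  | alternating {D : LinkDiagram} : D.IsAlternating → FlipsToAlternating D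
  | rot {D : LinkDiagram} : FlipsToAlternating D.rot → FlipsToAlternating D
  | flip {D D₁ D₂ : LinkDiagram} {l : ℝ × ℝ} {ε : ℝ} {e : D₁.ι ≃ D₂.ι} :
      D.Equi D₁ → IsFlip l ε D₁ D₂ e → FlipsToAlternating D₂ → FlipsToAlternating D

theorem equi_rot_rot (D : LinkDiagram) : D.Equi D.rot.rot := by
  refine ⟨_, _, Equiv.refl _, fun _ t => t, IsSphereDiffeo.id, PreservesIsotopy.id,
    fun _ => IsCircleReparam.id, fun i t => ?_, fun i s j t _ => ?_⟩
  · refine (D.rot.shadow_rot i t).trans ?_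
    rw [shadow_rot, reflY_reflY]
  · exact ((D.rot.height_rot_lt i s j t).trans (D.height_rot_lt j t i s)).symm

namespace FlipsToAlternating

theorem congr (h : FlipsToAlternating D) : ∀ {D' : LinkDiagram}, D.Equi D' →
    FlipsToAlternating D' := by
  induction h with
  | alternating h => exact fun hD => alternating (hD.isAlternating h)
  | rot _ ih => exact fun hD => rot (ih hD.rot)
  | flip h hf h' => exact fun hD => flip (hD.symm.trans h) hf h'

theorem map_rot (h : FlipsToAlternating D) : FlipsToAlternating D.rot :=
  rot (h.congr D.equi_rot_rot)

/-- The changes that lead to an alternating diagram preserve the link and positivity. -/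
theorem exists_isAlternating (h : FlipsToAlternating D) : ∃ D' : LinkDiagram,
    D.Isotopic D'.toOrientedLink ∧ (D.IsPositive → D'.IsPositive) ∧ D'.IsAlternating := by
  induction h with
  | @alternating D h => exact ⟨D, OrientedLink.Isotopic.refl _, fun h => h, h⟩
  | @rot D _ ih =>
    obtain ⟨D', h1, h2, h3⟩ := ih
    exact ⟨D', D.isotopic_rot.trans h1, fun h => h2 (D.isPositive_rot h), h3⟩
  | flip h hf _ ih =>
    obtain ⟨D', h1, h2, h3⟩ := ih
    exact ⟨D', (h.isotopic.trans hf.isotopic).trans h1,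
      fun h' => h2 (hf.isPositive (h.isPositive h')), h3⟩

/-- The changes of a summand can be made in the connected sum. The class `P` of the other summands is a
parameter, so that the changes can be made for one summand after the other. -/
theorem sum_of_base {P : LinkDiagram → Prop} (hrot : ∀ {B}, P B → P B.rot)
    (hbase : ∀ {A B D}, A.IsAlternating → P B → IsSum A B D → FlipsToAlternating D)
    {A : LinkDiagram} (hA : FlipsToAlternating A) :
    ∀ {B D}, P B → IsSum A B D → FlipsToAlternating D := by
  induction hA with
  | alternating h => exact fun hB hD => hbase h hB hD
  | rot _ ih => exact fun hB hD => rot (ih (hrot hB) hD.rot)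
  | @flip A A₁ A₂ l ε e hA hf _ ih =>
    intro B D hB hD
    obtain ⟨D₁, D₂, l', ε', e', h1, h2, h3⟩ := hD.exists_isFlip hA hf
    refine flip h1 h2 ?_
    rcases h3 with h3 | h3
    · exact ih hB h3
    -- Rotating everything turns the summand back, up to a second rotation of the other summand.
    · obtain ⟨A', B', D', δ, a, b, α, β, hA', hB', hD', h4⟩ := h3.rot
      exact rot (ih (hrot hB)
        ⟨A', B', D', δ, a, b, α, β, A₂.equi_rot_rot.trans hA', hB', hD', h4⟩)

theorem sum {A B D : LinkDiagram} (hA : FlipsToAlternating A) (hB : FlipsToAlternating B)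
    (h : IsSum A B D) : FlipsToAlternating D := by
  refine sum_of_base (P := FlipsToAlternating) map_rot (fun {A B D} hA hB h => ?_) hA hB h
  refine sum_of_base (P := IsAlternating) isAlternating_rot (fun {A B D} hA hB h => ?_) hB hA h.symm
  obtain ⟨A', B', D', δ, a, b, α, β, hA', hB', hD', h⟩ := h
  rcases h.isAlternating_or (hA'.isAlternating hA) (hB'.isAlternating hB) with h1 | h1
  · exact alternating (hD'.symm.isAlternating h1)
  · exact flip hD' (isFlip_flip h.pos h.isFlat) (alternating h1)

end FlipsToAlternating

theorem IsIteratedSum.flipsToAlternating {Ds : List LinkDiagram} (h : IsIteratedSum Ds D)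
    (halt : ∀ E ∈ Ds, E.IsAlternating) : FlipsToAlternating D := by
  induction h with
  | single D => exact .alternating (halt D (List.mem_singleton_self D))
  | sum _ _ hD ihA ihB =>
    exact (ihA fun E hE => halt E (List.mem_append_left _ hE)).sum
      (ihB fun E hE => halt E (List.mem_append_right _ hE)) hD.isSum

end LinkDiagram

theorem proposition4p2 (L : OrientedLink) (D : LinkDiagram) (hDL : D.IsDiagramOf L)
    (Ds : List LinkDiagram) (hD : LinkDiagram.IsIteratedSum Ds D)
    (halt : ∀ E ∈ Ds, E.IsAlternating) (hpos : D.IsPositive) :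
    ∃ D' : LinkDiagram, D'.IsDiagramOf L ∧ D'.IsPositive ∧ D'.IsAlternating := by
  obtain ⟨D', h1, h2, h3⟩ := (hD.flipsToAlternating halt).exists_isAlternating
  exact ⟨D', h1.symm.trans hDL, h2 hpos, h3⟩
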